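/- Let $G$ be a connected real Lie group, $\Gamma\subset G$ a discrete subgroup such that $X=\Gamma\backslash G$ is compact, and $\mu$ the $G$-invariant probability measure on $X$. Let $P\subset G$ be an immersed Lie subgroup with Lie algebra $\mathfrak p\subset\mathfrak g$, and let $\mathcal F$ be the foliation of $X$ with leaves $\Gamma gP$, $g\in G$. Let $\bar H^p_{\mathcal F}(X,\mathbb C)=\bar H^p_{\mathcal F}(X)\otimes\mathbb C$ denote the reduced leafwise cohomology with complex coefficients, i.e. the kernel of the leafwise exterior differential $d_{\mathcal F}$ on complex valued smooth leafwise $p$-forms modulo the closure (in the $C^\infty$ topology) of its image. For $\pi$ in the unitary dual $\hat G$ let $H(\pi)\subset L^2(X,\mu)$ be the $\pi$-isotypic component of the representation $(R_gf)(\Gamma g')=f(\Gamma g'g)$, let $H(\pi)^\infty$ be its Fréchet space of smooth vectors, and let $\bar H^p(\mathfrak p,H(\pi)^\infty)$ be the maximal Hausdorff quotient of the Lie algebra cohomology $H^p(\mathfrak p,H(\pi)^\infty)$, i.e. cocycles modulo the closure of the coboundaries. A cochain $\alpha\in\mathrm{Hom}(\Lambda^p\mathfrak p,H(\pi)^\infty)$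 is identified with the leafwise $p$-form on $X$ whose value on the vector fields induced by $\xi_1,\dots,\xi_p\in\mathfrak p$ is the smooth function $\alpha(\xi_1,\dots,\xi_p)\in H(\pi)^\infty\subset L^2(X)^\infty= C^\infty(X,\mathbb C)$. Then for every $p\ge 0$ this identification induces, for each $\pi\in\hat G$, a well-defined continuous linear map $$\kappa_\pi:\bar H^p(\mathfrak p,H(\pi)^\infty)\longrightarrow\bar H^p_{\mathcal F}(X,\mathbb C),$$ and the following hold. 1. Each $\kappa_\pi$ is a split injection (it has a continuous linear left inverse), and hence has closed image. 2. The induced map $\bigoplus_{\pi\in\hat G}\bar H^p(\mathfrak p,H(\pi)^\infty)\to\bar H^p_{\mathcal F}(X,\mathbb C)$ on the algebraic direct sum is injective with dense image. 3. Every $h\in\bar H^p_{\mathcal F}(X,\mathbb C)$ can be written as an unconditionally convergent series $h=\sum_{\pi\in\hat G}\kappa_\pi(h_\pi)$ with $h_\pi\in\bar H^p(\mathfrak p,H(\pi)^\infty)$. -/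

import Mathlib

open scoped Manifold ContDiff
open MeasureTheory

noncomputable section
namespace LatticeQuotient
universe u


instance instLieGroupMinSmoothness {n : ℕ} {G : Type u} [TopologicalSpace G]
    [ChartedSpace (EuclideanSpace ℝ (Fin n)) G] [Group G] [LieGroup (𝓡 n) ∞ G] :
    LieGroup (𝓡 n) (minSmoothness ℝ 3) G :=
  LieGroup.of_le (n := ∞) (by simpa using ENat.LEInfty.out)

variable {n : ℕ} {G : Type u} [TopologicalSpace G] [ChartedSpace (EuclideanSpace ℝ (Fin n)) G]
  [Group G] [LieGroup (𝓡 n) ∞ G]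
  {F' : Type*} [NormedAddCommGroup F'] [NormedSpace ℝ F']

/-- The derivative of `F : G → F'` along the left invariant vector field of `ξ`: the derivative of
`h ↦ F (g h)` at the identity in the direction `ξ`. -/
def lieDeriv (ξ : GroupLieAlgebra (𝓡 n) G) (F : G → F') (g : G) : F' :=
  mfderiv (𝓡 n) 𝓘(ℝ, F') (fun h => F (g * h)) 1 ξ

/-- The derivative of `F` at `x` in the direction of the tangent vector `v`. -/
def dirDeriv (F : G → F') (x : G) (v : TangentSpace (𝓡 n) x) : F' :=
  mfderiv (𝓡 n) 𝓘(ℝ, F') F x v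

lemma contMDiff_lieDeriv (ξ : GroupLieAlgebra (𝓡 n) G) {F : G → F'}
    (hF : ContMDiff (𝓡 n) 𝓘(ℝ, F') ∞ F) : ContMDiff (𝓡 n) 𝓘(ℝ, F') ∞ (lieDeriv ξ F) := by
  intro g
  have h := ContMDiffAt.mfderiv_apply (I := 𝓡 n) (I' := 𝓘(ℝ, F')) (J := 𝓡 n) (J' := 𝓡 n)
    (m := ∞) (n := ∞) (x₀ := g)
    (fun g h : G => F (g * h)) (fun _ => (1 : G)) (id : G → G) (fun _ => ξ) ?_ ?_ ?_ ?_ ?_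
  · refine h.congr_of_eventuallyEq (Filter.Eventually.of_forall fun x => ?_)
    have e := inTangentCoordinates_eq (I := 𝓡 n) (I' := 𝓘(ℝ, F')) (fun _ : G => (1 : G))
      (fun x : G => F (x * 1)) (fun x => mfderiv (𝓡 n) 𝓘(ℝ, F') (fun h => F (x * h)) 1)
      (x₀ := g) (x := x) (by simp) (by rw [chartAt_self_eq]; simp)
    refine Eq.symm ((congrArg (fun T => T ξ) e).trans ?_)
    have e1 : (tangentBundleCore (𝓡 n) G).coordChange (achart _ 1) (achart _ 1) 1 ξ = ξ :=
      (tangentBundleCore (𝓡 n) G).coordChange_self _ _ (by simp) ξ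
    have e2 : ∀ w : F', (tangentBundleCore 𝓘(ℝ, F') F').coordChange (achart F' (F (x * 1)))
        (achart F' (F (g * 1))) (F (x * 1)) w = w := fun w => by
      rw [tangentBundleCore_coordChange_model_space]; rfl
    refine (e2 _).trans ?_
    exact congrArg (fun w : EuclideanSpace ℝ (Fin n) =>
      (mfderiv (𝓡 n) 𝓘(ℝ, F') (fun h => F (x * h)) 1 : EuclideanSpace ℝ (Fin n) →L[ℝ] F') w) e1
  · exact (hF.comp (contMDiff_mul (𝓡 n) ∞)).contMDiffAt
  · exact contMDiffAt_const
  · exact contMDiffAt_id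
  · exact contMDiffAt_const
  · simp

lemma lieDeriv_eq (ξ : GroupLieAlgebra (𝓡 n) G) {F : G → F'}
    (hF : ContMDiff (𝓡 n) 𝓘(ℝ, F') ∞ F) (g : G) :
    lieDeriv ξ F g = dirDeriv F g (mulInvariantVectorField ξ g) := by
  have h1 : MDifferentiableAt (𝓡 n) 𝓘(ℝ, F') F (g * 1) := hF.mdifferentiable (by simp) _
  have h2 : MDifferentiableAt (𝓡 n) (𝓡 n) (fun h : G => g * h) 1 :=
    (contMDiff_mul_left (I := 𝓡 n) (n := ∞)).mdifferentiable (by simp) _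
  have := mfderiv_comp (I' := 𝓡 n) (1 : G) (g := F) (f := fun h : G => g * h) h1 h2
  unfold lieDeriv mulInvariantVectorField
  change mfderiv (𝓡 n) 𝓘(ℝ, F') (F ∘ fun h => g * h) 1 ξ = _
  rw [this]
  have e : ∀ x : G, x = g → mfderiv (𝓡 n) 𝓘(ℝ, F') F x = mfderiv (𝓡 n) 𝓘(ℝ, F') F g := by
    rintro x rfl; rfl
  exact congrArg (fun T : EuclideanSpace ℝ (Fin n) →L[ℝ] F' =>
    T (mfderiv (𝓡 n) (𝓡 n) (fun h : G => g * h) 1 ξ)) (e (g * 1) (mul_one g))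

lemma apply_inverse_apply {E₁ E₂ : Type*} [TopologicalSpace E₁] [AddCommGroup E₁] [Module ℝ E₁]
    [TopologicalSpace E₂] [AddCommGroup E₂] [Module ℝ E₂] {T : E₁ →L[ℝ] E₂} (hT : T.IsInvertible) (y : E₂) :
    T (T.inverse y) = y := by
  obtain ⟨e, rfl⟩ := hT
  simp

lemma mfderiv_mlieBracket {F A B : G → F'} {V W : ∀ x : G, TangentSpace (𝓡 n) x}
    (hF : ContMDiff (𝓡 n) 𝓘(ℝ, F') ∞ F)
    (hV : MDifferentiable (𝓡 n) (𝓡 n).tangent (fun x => (⟨x, V x⟩ : TangentBundle (𝓡 n) G)))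
    (hW : MDifferentiable (𝓡 n) (𝓡 n).tangent (fun x => (⟨x, W x⟩ : TangentBundle (𝓡 n) G)))
    (hA : ContMDiff (𝓡 n) 𝓘(ℝ, F') ∞ A) (hB : ContMDiff (𝓡 n) 𝓘(ℝ, F') ∞ B)
    (hAV : ∀ x, A x = dirDeriv F x (V x))
    (hBW : ∀ x, B x = dirDeriv F x (W x)) (x : G) :
    dirDeriv F x (VectorField.mlieBracket (𝓡 n) V W x) =
      dirDeriv B x (V x) - dirDeriv A x (W x) := by
  have : IsManifold (𝓡 n) ∞ G := inferInstance
  have : IsManifold (𝓡 n) 2 G := .of_le (n := ∞) (by simpa using ENat.LEInfty.out)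
  have : IsManifold (𝓡 n) 1 G := .of_le (n := ∞) (by simp)
  let E := EuclideanSpace ℝ (Fin n)
  set φ := extChartAt (𝓡 n) x with hφ
  let V' : E → E := VectorField.mpullbackWithin 𝓘(ℝ, E) (𝓡 n) φ.symm V (Set.range (𝓡 n))
  let W' : E → E := VectorField.mpullbackWithin 𝓘(ℝ, E) (𝓡 n) φ.symm W (Set.range (𝓡 n))
  have hr : Set.range (𝓡 n) = Set.univ := by simp
  have hV' : DifferentiableAt ℝ V' (φ x) := by
    have := MDifferentiableWithinAt.differentiableWithinAt_mpullbackWithin_vectorField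
      (I := 𝓡 n) (s := Set.univ) (x := x) (V := V) (hV x).mdifferentiableWithinAt
    exact DifferentiableWithinAt.differentiableAt (f := V') this (by rw [hr]; simp)
  have hW' : DifferentiableAt ℝ W' (φ x) := by
    have := MDifferentiableWithinAt.differentiableWithinAt_mpullbackWithin_vectorField
      (I := 𝓡 n) (s := Set.univ) (x := x) (V := W) (hW x).mdifferentiableWithinAt
    exact DifferentiableWithinAt.differentiableAt (f := W') this (by rw [hr]; simp)
  have hxt : φ x ∈ φ.target := mem_extChartAt_target x
  have hto : IsOpen φ.target := isOpen_extChartAt_target x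
  have hsymm : ∀ y ∈ φ.target, MDifferentiableAt 𝓘(ℝ, E) (𝓡 n) φ.symm y := fun y hy => by
    have := mdifferentiableWithinAt_extChartAt_symm (I := 𝓡 n) hy
    rwa [hr, mdifferentiableWithinAt_univ] at this
  -- chain rule for a function read in the chart
  have chain : ∀ {K : G → F'}, ContMDiff (𝓡 n) 𝓘(ℝ, F') ∞ K → ∀ y ∈ φ.target,
      ∀ U : ∀ x : G, TangentSpace (𝓡 n) x,
      fderiv ℝ (K ∘ φ.symm) y
        (VectorField.mpullbackWithin 𝓘(ℝ, E) (𝓡 n) φ.symm U (Set.range (𝓡 n)) y) =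
      dirDeriv K (φ.symm y) (U (φ.symm y)) := by
    intro K hK y hy U
    have hc := mfderiv_comp (I' := 𝓡 n) y (hK.mdifferentiable (by simp) _) (hsymm y hy)
    rw [mfderiv_eq_fderiv] at hc
    have hinv := isInvertible_mfderivWithin_extChartAt_symm (I := 𝓡 n) hy
    rw [VectorField.mpullbackWithin_apply]
    rw [hr, mfderivWithin_univ] at hinv ⊢
    refine (congrArg (fun T : E →L[ℝ] F' => T _) hc).trans ?_
    exact congrArg (dirDeriv K (φ.symm y)) (apply_inverse_apply hinv _)
  have hφ1 : MDifferentiableAt (𝓡 n) 𝓘(ℝ, E) φ x :=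
    mdifferentiableAt_extChartAt (mem_chart_source _ x)
  have hF1 : ContDiffAt ℝ ∞ (F ∘ φ.symm) (φ x) := by
    rw [← contMDiffAt_iff_contDiffAt]
    exact hF.contMDiffAt.comp _ (((contMDiffOn_extChartAt_symm (I := 𝓡 n) (n := ∞) x) _
      hxt).contMDiffAt (hto.mem_nhds hxt))
  have key := VectorField.fderiv_apply_lieBracket (𝕜 := ℝ) (n := ∞) (V := V') (W := W') hF1
    (by simpa using ENat.LEInfty.out) hW' hV'
  have hnhds : ∀ᶠ y in nhds (φ x), y ∈ φ.target := hto.mem_nhds hxt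
  have eB : (fun y => fderiv ℝ (F ∘ φ.symm) y (W' y)) =ᶠ[nhds (φ x)] B ∘ φ.symm := by
    filter_upwards [hnhds] with y hy
    rw [chain hF y hy W, ← hBW]; rfl
  have eA : (fun y => fderiv ℝ (F ∘ φ.symm) y (V' y)) =ᶠ[nhds (φ x)] A ∘ φ.symm := by
    filter_upwards [hnhds] with y hy
    rw [chain hF y hy V, ← hAV]; rfl
  have hback : ∀ {K : G → F'} (U : ∀ x : G, TangentSpace (𝓡 n) x),
      dirDeriv K (φ.symm (φ x)) (U (φ.symm (φ x))) = dirDeriv K x (U x) := by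
    intro K U
    have : ∀ z, z = x → dirDeriv K z (U z) = dirDeriv K x (U x) := by rintro z rfl; rfl
    exact this _ (extChartAt_to_inv x)
  rw [eB.fderiv_eq, eA.fderiv_eq, chain hB _ hxt V, chain hA _ hxt W, hback V, hback W] at key
  rw [← key]
  have hFe : F =ᶠ[nhds x] (F ∘ φ.symm) ∘ φ := by
    filter_upwards [extChartAt_source_mem_nhds (I := 𝓡 n) x] with y hy
    exact congrArg F ((extChartAt (𝓡 n) x).left_inv hy).symm
  have hF3 : DifferentiableAt ℝ (F ∘ φ.symm : E → F') (φ x : E) :=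
    ContDiffAt.differentiableAt (𝕜 := ℝ) hF1 (by simp)
  have hF2 : MDifferentiableAt 𝓘(ℝ, E) 𝓘(ℝ, F') (F ∘ φ.symm) (φ x) :=
    mdifferentiableAt_iff_differentiableAt.2 hF3
  have hc := mfderiv_comp (I' := 𝓘(ℝ, E)) x hF2 hφ1
  rw [mfderiv_eq_fderiv (f := F ∘ φ.symm) (x := φ x)] at hc
  have hinv := isInvertible_mfderiv_extChartAt (I := 𝓡 n) (mem_extChartAt_source x)
  let Z : E := VectorField.lieBracket ℝ V' W' (φ x)
  have h1 : VectorField.mlieBracket (𝓡 n) V W x =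
      (mfderiv (𝓡 n) 𝓘(ℝ, E) φ x).inverse Z := by
    have hs : φ.symm ⁻¹' Set.univ ∩ Set.range (𝓡 n) = Set.univ := by rw [hr]; simp
    have h0 : VectorField.lieBracketWithin ℝ V' W' (φ.symm ⁻¹' Set.univ ∩ Set.range (𝓡 n)) (φ x)
        = Z := by
      rw [hs, VectorField.lieBracketWithin_univ]
    exact congrArg (fun z : E => (mfderiv (𝓡 n) 𝓘(ℝ, E) φ x).inverse z) h0
  rw [h1]
  have h2 := (hFe.mfderiv_eq (I := 𝓡 n) (I' := 𝓘(ℝ, F')))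
  refine (congrArg (fun T : E →L[ℝ] F' => T _) (h2.trans hc)).trans ?_
  exact congrArg (fderiv ℝ (F ∘ φ.symm) (φ x)) (apply_inverse_apply hinv _)

lemma lieDeriv_bracket (ξ η : GroupLieAlgebra (𝓡 n) G) {F : G → F'}
    (hF : ContMDiff (𝓡 n) 𝓘(ℝ, F') ∞ F) (g : G) :
    lieDeriv ⁅ξ, η⁆ F g = lieDeriv ξ (lieDeriv η F) g - lieDeriv η (lieDeriv ξ F) g := by
  rw [lieDeriv_eq _ hF, lieDeriv_eq _ (contMDiff_lieDeriv _ hF),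
    lieDeriv_eq _ (contMDiff_lieDeriv _ hF), GroupLieAlgebra.bracket_def,
    mulInvariantVector_mlieBracket]
  exact mfderiv_mlieBracket hF (mdifferentiable_mulInvariantVectorField ξ)
    (mdifferentiable_mulInvariantVectorField η) (contMDiff_lieDeriv _ hF) (contMDiff_lieDeriv _ hF)
    (lieDeriv_eq ξ hF) (lieDeriv_eq η hF) g


lemma mdifferentiableAt_translate {F : G → F'} (hF : ContMDiff (𝓡 n) 𝓘(ℝ, F') ∞ F) (g : G) :
    MDifferentiableAt (𝓡 n) 𝓘(ℝ, F') (fun h => F (g * h)) 1 :=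
  (hF.comp (contMDiff_mul_left (I := 𝓡 n) (n := ∞) (a := g))).mdifferentiable (by simp) _

lemma lieDeriv_clm {F'' : Type*} [NormedAddCommGroup F''] [NormedSpace ℝ F''] (T : F' →L[ℝ] F'')
    (ξ : GroupLieAlgebra (𝓡 n) G) {F : G → F'} (hF : ContMDiff (𝓡 n) 𝓘(ℝ, F') ∞ F) (g : G) :
    lieDeriv ξ (fun h => T (F h)) g = T (lieDeriv ξ F g) := by
  unfold lieDeriv
  have h := (T.hasMFDerivAt (x := F (g * 1))).comp (1 : G)
    (mdifferentiableAt_translate hF g).hasMFDerivAt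
  exact congrArg (fun S : EuclideanSpace ℝ (Fin n) →L[ℝ] F'' => S ξ) h.mfderiv

lemma lieDeriv_add_right (ξ : GroupLieAlgebra (𝓡 n) G) {F K : G → F'}
    (hF : ContMDiff (𝓡 n) 𝓘(ℝ, F') ∞ F) (hK : ContMDiff (𝓡 n) 𝓘(ℝ, F') ∞ K) (g : G) :
    lieDeriv ξ (fun h => F h + K h) g = lieDeriv ξ F g + lieDeriv ξ K g := by
  unfold lieDeriv
  have h := (mdifferentiableAt_translate hF g).hasMFDerivAt.add
    (mdifferentiableAt_translate hK g).hasMFDerivAt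
  exact congrArg (fun S : EuclideanSpace ℝ (Fin n) →L[ℝ] F' => S ξ) h.mfderiv

lemma lieDeriv_mul (ξ : GroupLieAlgebra (𝓡 n) G) {F K : G → ℂ}
    (hF : ContMDiff (𝓡 n) 𝓘(ℝ, ℂ) ∞ F) (hK : ContMDiff (𝓡 n) 𝓘(ℝ, ℂ) ∞ K) (g : G) :
    lieDeriv ξ (fun h => F h * K h) g = F g * lieDeriv ξ K g + K g * lieDeriv ξ F g := by
  unfold lieDeriv
  have h := (mdifferentiableAt_translate hF g).hasMFDerivAt.mul
    (mdifferentiableAt_translate hK g).hasMFDerivAt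
  have h2 := congrArg (fun S : EuclideanSpace ℝ (Fin n) →L[ℝ] ℂ => S ξ) h.mfderiv
  refine h2.trans ?_
  simp only [mul_one]
  rfl

section Quotient

variable (Γ : Subgroup G)

/-- The quotient `X = Γ \ G`, whose points are the cosets `Γ g`. -/
def LeftQuotient : Type u := Quotient (QuotientGroup.rightRel Γ)

/-- The projection `G → Γ \ G`. -/
def proj (g : G) : LeftQuotient Γ := Quotient.mk (QuotientGroup.rightRel Γ) g

instance : TopologicalSpace (LeftQuotient Γ) :=
  inferInstanceAs (TopologicalSpace (Quotient (QuotientGroup.rightRel Γ)))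

instance : MeasurableSpace (LeftQuotient Γ) := borel _

instance : BorelSpace (LeftQuotient Γ) := ⟨rfl⟩

variable {Γ}

/-- Right translation `Γ x ↦ Γ x g` on `Γ \ G`. -/
def rightTranslate (g : G) : LeftQuotient Γ → LeftQuotient Γ :=
  Quotient.map (· * g) fun a b h => by
    change QuotientGroup.rightRel Γ _ _ at h
    change QuotientGroup.rightRel Γ _ _
    rw [QuotientGroup.rightRel_apply] at h ⊢
    simpa [mul_assoc] using h

lemma rightTranslate_proj (g x : G) : rightTranslate g (proj Γ x) = proj Γ (x * g) := rfl

lemma continuous_rightTranslate [ContinuousMul G] (g : G) :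
    Continuous (rightTranslate g : LeftQuotient Γ → LeftQuotient Γ) := by
  refine continuous_quot_lift _ ?_
  exact continuous_quotient_mk'.comp (continuous_mul_const g)

variable (n Γ)

/-- Complex valued smooth functions on `Γ \ G`. As `G → Γ \ G` is a covering, a function on the
quotient is smooth exactly if its pullback to `G` is. -/
def smoothSubalgebra : Subalgebra ℂ (LeftQuotient Γ → ℂ) where
  carrier := {f | ContMDiff (𝓡 n) 𝓘(ℝ, ℂ) ∞ fun g => f (proj Γ g)}
  mul_mem' hf hg := (contDiff_mul (𝕜 := ℝ) (𝔸 := ℂ) (n := ∞)).contMDiff.comp (hf.prodMk_space hg)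
  add_mem' hf hg := hf.add hg
  algebraMap_mem' _ := contMDiff_const

/-- The algebra `C^∞(X)` of complex valued smooth functions on `X = Γ \ G`. -/
def SmoothFun : Type u := smoothSubalgebra n Γ

instance : CommRing (SmoothFun n Γ) := inferInstanceAs (CommRing (smoothSubalgebra n Γ))
instance : Algebra ℂ (SmoothFun n Γ) := inferInstanceAs (Algebra ℂ (smoothSubalgebra n Γ))
instance : CoeFun (SmoothFun n Γ) (fun _ => LeftQuotient Γ → ℂ) := ⟨fun f => f.1⟩

variable {n Γ}

lemma SmoothFun.ext {f g : SmoothFun n Γ} (h : ∀ x, f x = g x) : f = g := Subtype.ext (funext h)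

lemma SmoothFun.contMDiff (f : SmoothFun n Γ) :
    ContMDiff (𝓡 n) 𝓘(ℝ, ℂ) ∞ fun g => f (proj Γ g) := f.2

lemma SmoothFun.continuous (f : SmoothFun n Γ) : Continuous f :=
  continuous_coinduced_dom.2 f.contMDiff.continuous

/-- The derivative of a smooth function on `X` in the direction of the vector field on `X` induced
by `ξ`, that is `(ξ f)(x) = d/dt f(x exp(t ξ))` at `t = 0`. -/
def smoothDeriv (ξ : GroupLieAlgebra (𝓡 n) G) (f : SmoothFun n Γ) : SmoothFun n Γ :=
  ⟨fun x => mfderiv (𝓡 n) 𝓘(ℝ, ℂ) (fun h => f (rightTranslate h x)) 1 ξ,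
    contMDiff_lieDeriv ξ f.contMDiff⟩

lemma smoothDeriv_proj (ξ : GroupLieAlgebra (𝓡 n) G) (f : SmoothFun n Γ) (g : G) :
    smoothDeriv ξ f (proj Γ g) = lieDeriv ξ (fun h => f (proj Γ h)) g := rfl

lemma SmoothFun.ext_proj {f g : SmoothFun n Γ} (h : ∀ x, f (proj Γ x) = g (proj Γ x)) : f = g :=
  SmoothFun.ext fun x => Quotient.inductionOn x h

/-- The vector field on `X` induced by `ξ`, as a derivation of `C^∞(X)`. -/
def inducedField (Γ : Subgroup G) (ξ : GroupLieAlgebra (𝓡 n) G) :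
    Derivation ℂ (SmoothFun n Γ) (SmoothFun n Γ) where
  toFun := smoothDeriv ξ
  map_add' f g := SmoothFun.ext_proj fun x =>
    lieDeriv_add_right ξ f.contMDiff g.contMDiff x
  map_smul' c f := SmoothFun.ext_proj fun x =>
    lieDeriv_clm (((c • ContinuousLinearMap.id ℂ ℂ : ℂ →L[ℂ] ℂ)).restrictScalars ℝ) ξ
      f.contMDiff x
  map_one_eq_zero' := SmoothFun.ext_proj fun x => by
    have h : HasMFDerivAt (𝓡 n) 𝓘(ℝ, ℂ) (fun _ : G => (1 : ℂ)) 1 0 := hasMFDerivAt_const _ _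
    exact congrArg (fun S : EuclideanSpace ℝ (Fin n) →L[ℝ] ℂ => S ξ) h.mfderiv
  leibniz' f g := SmoothFun.ext_proj fun x => lieDeriv_mul ξ f.contMDiff g.contMDiff x

lemma inducedField_bracket (ξ η : GroupLieAlgebra (𝓡 n) G) :
    ⁅inducedField Γ ξ, inducedField Γ η⁆ = inducedField Γ ⁅ξ, η⁆ :=
  Derivation.ext fun f => SmoothFun.ext_proj fun x =>
    (lieDeriv_bracket ξ η f.contMDiff x).symm

/-- The Lie algebra `C^∞(X) ⊗ 𝔭` of (complexified) smooth vector fields on `X` tangent to the leaves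
`Γ g P` of the foliation: the submodule over `C^∞(X) = C^∞(X, ℂ)` of all derivations of `C^∞(X)` which
is spanned by the fields induced by the elements of `𝔭 = Lie P`. -/
def leafwiseFields (Γ : Subgroup G) (𝔭 : LieSubalgebra ℝ (GroupLieAlgebra (𝓡 n) G)) :
    Submodule (SmoothFun n Γ) (Derivation ℂ (SmoothFun n Γ) (SmoothFun n Γ)) :=
  Submodule.span (SmoothFun n Γ) (Set.range fun ξ : 𝔭 => inducedField Γ (ξ : GroupLieAlgebra (𝓡 n) G))

variable (𝔭 : LieSubalgebra ℝ (GroupLieAlgebra (𝓡 n) G))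

lemma lie_smul_field (f : SmoothFun n Γ) (D D' : Derivation ℂ (SmoothFun n Γ) (SmoothFun n Γ)) :
    ⁅D, f • D'⁆ = f • ⁅D, D'⁆ + D f • D' := by
  ext g
  simp [Derivation.commutator_apply]

lemma leafwiseFields_lie {D D' : Derivation ℂ (SmoothFun n Γ) (SmoothFun n Γ)}
    (hD : D ∈ leafwiseFields Γ 𝔭) (hD' : D' ∈ leafwiseFields Γ 𝔭) :
    ⁅D, D'⁆ ∈ leafwiseFields Γ 𝔭 := by
  have step : ∀ (D₀ : Derivation ℂ (SmoothFun n Γ) (SmoothFun n Γ)) (S : Set _),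
      (∀ d ∈ S, ⁅D₀, d⁆ ∈ leafwiseFields Γ 𝔭) → (S ⊆ leafwiseFields Γ 𝔭) →
      ∀ d ∈ Submodule.span (SmoothFun n Γ) S, ⁅D₀, d⁆ ∈ leafwiseFields Γ 𝔭 := by
    intro D₀ S h1 h2 d hd
    induction hd using Submodule.span_induction with
    | mem d h => exact h1 d h
    | zero => simp
    | add a b _ _ ha hb => rw [lie_add]; exact add_mem ha hb
    | smul f d hd h =>
      rw [lie_smul_field]
      exact add_mem (Submodule.smul_mem _ _ h) (Submodule.smul_mem _ _ (Submodule.span_le.2 h2 hd))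
  refine step D _ ?_ Submodule.subset_span D' hD'
  rintro _ ⟨η, rfl⟩
  rw [← lie_skew, neg_mem_iff]
  refine step _ _ ?_ Submodule.subset_span D hD
  rintro _ ⟨ξ, rfl⟩
  refine Submodule.subset_span ⟨⁅η, ξ⁆, ?_⟩
  exact (inducedField_bracket _ _).symm

instance : LieRing (leafwiseFields Γ 𝔭) where
  bracket D D' := ⟨⁅D.1, D'.1⁆, leafwiseFields_lie 𝔭 D.2 D'.2⟩
  add_lie _ _ _ := Subtype.ext (add_lie _ _ _)
  lie_add _ _ _ := Subtype.ext (lie_add _ _ _)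
  lie_self _ := Subtype.ext (lie_self _)
  leibniz_lie _ _ _ := Subtype.ext (leibniz_lie _ _ _)

/-- Leafwise vector fields act on smooth functions. -/
instance : LieRingModule (leafwiseFields Γ 𝔭) (SmoothFun n Γ) where
  bracket D f := D.1 f
  add_lie _ _ _ := rfl
  lie_add D f g := map_add D.1 f g
  leibniz_lie D D' f := leibniz_lie D.1 D'.1 f

end Quotient

section Topology

/-- The topology on `M` defined by a map `b : M → N` and operators `D ξ` on `M`: the coarsest one
for which all maps `m ↦ b (D ξ₁ (⋯ (D ξₖ m)))`, `k ≥ 0`, are continuous. -/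
@[reducible]
def operatorTopology {M N K : Type*} [TopologicalSpace N] (b : M → N) (D : K → M → M) :
    TopologicalSpace M :=
  ⨅ l : List K, TopologicalSpace.induced (fun m => b (l.foldr D m)) inferInstance

variable {M N K : Type*} [TopologicalSpace N] [AddCommGroup M] [Module ℂ M] [AddCommGroup N]
  [Module ℂ N] (b : M →ₗ[ℂ] N) (D : K → M →ₗ[ℂ] M)

/-- An iterated operator, as a linear map. -/
def foldOp (l : List K) : M →ₗ[ℂ] M := l.foldr (fun ξ T => D ξ ∘ₗ T) LinearMap.id

lemma foldOp_apply (l : List K) (m : M) : foldOp D l m = l.foldr (fun ξ => D ξ) m := by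
  induction l with
  | nil => rfl
  | cons ξ l ih => simpa [foldOp] using congrArg (D ξ) ih

lemma operatorTopology_eq : operatorTopology b (fun ξ => D ξ) =
    ⨅ l : List K, TopologicalSpace.induced (b ∘ₗ foldOp D l) inferInstance := by
  unfold operatorTopology
  congr! 3 with l
  ext m
  simp [foldOp_apply]

lemma isTopologicalAddGroup_operatorTopology [IsTopologicalAddGroup N] :
    @IsTopologicalAddGroup M (operatorTopology b (fun ξ => D ξ)) _ := by
  rw [operatorTopology_eq]
  exact topologicalAddGroup_iInf fun l => topologicalAddGroup_induced (b ∘ₗ foldOp D l)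

lemma continuousSMul_operatorTopology [ContinuousSMul ℂ N] :
    @ContinuousSMul ℂ M _ _ (operatorTopology b (fun ξ => D ξ)) := by
  rw [operatorTopology_eq]
  exact continuousSMul_iInf fun l => continuousSMul_induced (b ∘ₗ foldOp D l)

end Topology

section SmoothTopology

variable (Γ : Subgroup G)

/-- A smooth function on `X` as an element of the space `C(X)`. -/
def toContinuousMap : SmoothFun n Γ →ₗ[ℂ] C(LeftQuotient Γ, ℂ) where
  toFun f := ⟨f, f.continuous⟩
  map_add' _ _ := rfl
  map_smul' _ _ := rfl

/-- The `C^∞` topology on `C^∞(X)`: uniform convergence (on compact sets) of all derivatives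
`ξ₁ ⋯ ξₖ f` with `ξᵢ` in the Lie algebra of `G`. -/
instance : TopologicalSpace (SmoothFun n Γ) :=
  operatorTopology (toContinuousMap Γ)
    (fun ξ : GroupLieAlgebra (𝓡 n) G => (inducedField Γ ξ : SmoothFun n Γ →ₗ[ℂ] SmoothFun n Γ))

instance : IsTopologicalAddGroup (SmoothFun n Γ) := isTopologicalAddGroup_operatorTopology _ _

instance : ContinuousSMul ℂ (SmoothFun n Γ) := continuousSMul_operatorTopology _ _

end SmoothTopology

section Cohomology

/-- A Lie ring acting by complex linear maps. -/
class ComplexLinearAction (L M : Type*) [LieRing L] [AddCommGroup M] [LieRingModule L M]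
    [Module ℂ M] : Prop where
  lie_smul' : ∀ (x : L) (c : ℂ) (m : M), ⁅x, c • m⁆ = c • ⁅x, m⁆

instance (Γ : Subgroup G) (𝔭 : LieSubalgebra ℝ (GroupLieAlgebra (𝓡 n) G)) :
    ComplexLinearAction (leafwiseFields Γ 𝔭) (SmoothFun n Γ) :=
  ⟨fun D c f => D.1.map_smul c f⟩

variable (A L M : Type*) [CommRing A] [LieRing L] [Module A L] [AddCommGroup M] [Module A M]
  [Module ℂ M] [SMulCommClass A ℂ M] [LieRingModule L M]

variable {A L M} in
/-- The value of `dα` at `(v₀, …, v_p)`, by the formula of Cartan, Chevalley and Eilenberg: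
`∑ⱼ (-1)ʲ vⱼ α(…, v̂ⱼ, …) + ∑_{i<j} (-1)ʲ α(v₀, …, [vᵢ, vⱼ], …, v̂ⱼ, …, v_p)`,
the bracket standing in the place of `vᵢ`. (Moving it to the first place produces the other usual
form `(-1)^(i+j) α([vᵢ, vⱼ], v₀, …, v̂ᵢ, …, v̂ⱼ, …, v_p)` of the second sum.) -/
def differential {p : ℕ} (α : L [⋀^Fin p]→ₗ[A] M) (v : Fin (p + 1) → L) : M :=
  (∑ j : Fin (p + 1), (-1 : ℤ) ^ (j : ℕ) • ⁅v j, α (v ∘ j.succAbove)⁆) +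
    ∑ j : Fin (p + 1), ∑ i : Fin (p + 1) with i < j,
      (-1 : ℤ) ^ (j : ℕ) • α (Function.update v i ⁅v i, v j⁆ ∘ j.succAbove)

variable [ComplexLinearAction L M]

/-- The differential as a linear map on `p`-cochains. -/
def differentialₗ (p : ℕ) : (L [⋀^Fin p]→ₗ[A] M) →ₗ[ℂ] ((Fin (p + 1) → L) → M) where
  toFun := differential
  map_add' α β := by
    ext v
    simp only [differential, AlternatingMap.add_apply, lie_add, smul_add, Finset.sum_add_distrib,
      Pi.add_apply]
    abel
  map_smul' c α := by
    ext v
    simp only [differential, AlternatingMap.smul_apply, ComplexLinearAction.lie_smul', smul_add,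
      Pi.smul_apply, Finset.smul_sum, RingHom.id_apply, smul_comm c]

/-- A cochain as a function of its arguments. -/
def evalₗ (p : ℕ) : (L [⋀^Fin p]→ₗ[A] M) →ₗ[ℂ] ((Fin p → L) → M) where
  toFun α := α
  map_add' _ _ := rfl
  map_smul' _ _ := rfl

/-- The `p`-cocycles, the kernel of `d` on `p`-cochains. -/
def cocycles (p : ℕ) : Submodule ℂ (L [⋀^Fin p]→ₗ[A] M) :=
  LinearMap.ker (differentialₗ A L M p)

/-- The `p`-coboundaries: the cochains `β` of degree `p` of the form `β = dα`. -/
def coboundaries : (p : ℕ) → Submodule ℂ (L [⋀^Fin p]→ₗ[A] M)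
  | 0 => ⊥
  | p + 1 => (LinearMap.range (differentialₗ A L M p)).comap (evalₗ A L M (p + 1))

/-- The topology on cochains: pointwise convergence on tuples of elements of `L`. -/
instance [TopologicalSpace M] (p : ℕ) : TopologicalSpace (L [⋀^Fin p]→ₗ[A] M) :=
  TopologicalSpace.induced (evalₗ A L M p) inferInstance

variable [TopologicalSpace M] [IsTopologicalAddGroup M] [ContinuousSMul ℂ M]

instance (p : ℕ) : IsTopologicalAddGroup (L [⋀^Fin p]→ₗ[A] M) :=
  topologicalAddGroup_induced (evalₗ A L M p)

instance (p : ℕ) : ContinuousSMul ℂ (L [⋀^Fin p]→ₗ[A] M) :=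
  continuousSMul_induced (evalₗ A L M p)

/-- The reduced cohomology in degree `p`, that is the kernel of `d` modulo the closure of the image
of `d`. -/
abbrev ReducedCohomology (p : ℕ) : Type _ :=
  cocycles A L M p ⧸ ((coboundaries A L M p).topologicalClosure.submoduleOf (cocycles A L M p))

end Cohomology

section Representations

/-- An irreducible unitary representation of the topological group `G` on a (nonzero, complex)
Hilbert space. -/
structure IrreducibleUnitaryRep (G : Type u) [TopologicalSpace G] [Group G] where
  /-- the Hilbert space -/
  V : Type u
  [normedAddCommGroup : NormedAddCommGroup V]
  [innerProductSpace : InnerProductSpace ℂ V]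
  [completeSpace : CompleteSpace V]
  [nontrivial : Nontrivial V]
  /-- the action by unitary operators -/
  ρ : G →* (V ≃ₗᵢ[ℂ] V)
  continuous_apply : ∀ v, Continuous fun g => ρ g v
  irreducible : ∀ W : Submodule ℂ V, IsClosed (W : Set V) → (∀ g, ∀ w ∈ W, ρ g w ∈ W) →
    W = ⊥ ∨ W = ⊤

attribute [instance] IrreducibleUnitaryRep.normedAddCommGroup
  IrreducibleUnitaryRep.innerProductSpace IrreducibleUnitaryRep.completeSpace
  IrreducibleUnitaryRep.nontrivial

/-- Unitary equivalence of representations. -/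
instance unitaryEquivalence (G : Type u) [TopologicalSpace G] [Group G] :
    Setoid (IrreducibleUnitaryRep G) where
  r π σ := ∃ T : π.V ≃ₗᵢ[ℂ] σ.V, ∀ g v, T (π.ρ g v) = σ.ρ g (T v)
  iseqv :=
    { refl := fun π => ⟨LinearIsometryEquiv.refl ℂ π.V, fun _ _ => rfl⟩
      symm := fun {π σ} ⟨T, hT⟩ => ⟨T.symm, fun g v => by
        apply T.injective
        rw [hT]
        simp⟩
      trans := fun {π σ τ} ⟨T, hT⟩ ⟨S, hS⟩ => ⟨T.trans S, fun g v => by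
        simp [hT, hS]⟩ }

/-- The unitary dual: equivalence classes of irreducible unitary representations. -/
def UnitaryDual (G : Type u) [TopologicalSpace G] [Group G] : Type (u + 1) :=
  Quotient (unitaryEquivalence G)

/-- A fixed representation in the class `π`. -/
def UnitaryDual.rep (π : UnitaryDual G) : IrreducibleUnitaryRep G := Quotient.out π

variable {Γ : Subgroup G}

/-- The measure `μ` on `Γ \ G` is invariant under all right translations by elements of `G`. -/
class IsRightInvariant (μ : Measure (LeftQuotient Γ)) : Prop where
  measurePreserving : ∀ g : G, MeasurePreserving (rightTranslate g) μ μ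

variable (μ : Measure (LeftQuotient Γ)) [IsRightInvariant μ]

/-- The regular representation of `G` on `L²(X)`, `(R_g f)(x) = f(x g)`. -/
def regularRep (g : G) : Lp ℂ 2 μ →ₗᵢ[ℂ] Lp ℂ 2 μ :=
  Lp.compMeasurePreservingₗᵢ ℂ (rightTranslate g) (IsRightInvariant.measurePreserving g)

lemma regularRep_mul (g h : G) (v : Lp ℂ 2 μ) :
    regularRep μ (g * h) v = regularRep μ g (regularRep μ h v) := by
  refine Lp.ext ?_
  have h1 := Lp.coeFn_compMeasurePreserving v
    (IsRightInvariant.measurePreserving (μ := μ) (g * h))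
  have h2 := Lp.coeFn_compMeasurePreserving v (IsRightInvariant.measurePreserving (μ := μ) h)
  have h3 := Lp.coeFn_compMeasurePreserving (regularRep μ h v)
    (IsRightInvariant.measurePreserving (μ := μ) g)
  have h4 := (IsRightInvariant.measurePreserving (μ := μ) g).quasiMeasurePreserving.ae_eq_comp h2
  refine h1.trans ((h3.trans h4).trans (Filter.Eventually.of_forall fun x => ?_)).symm
  refine Quotient.inductionOn x fun x => ?_
  change v (proj Γ (x * g * h)) = v (proj Γ (x * (g * h)))
  rw [mul_assoc]

/-- The space `Hom_G(V_π, L²(X))` of intertwining operators. -/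
def intertwiners (π : IrreducibleUnitaryRep G) : Submodule ℂ (π.V →L[ℂ] Lp ℂ 2 μ) where
  carrier := {T | ∀ g v, T (π.ρ g v) = regularRep μ g (T v)}
  add_mem' hT hS g v := by simp [hT g v, hS g v]
  zero_mem' g v := by simp
  smul_mem' c T hT g v := by simp [hT g v]

/-- The `π`-isotypic component `H(π)` of `L²(X)`. -/
def isotypic (π : UnitaryDual G) : Submodule ℂ (Lp ℂ 2 μ) :=
  (⨆ T ∈ intertwiners μ π.rep, LinearMap.range (T : π.rep.V →ₗ[ℂ] Lp ℂ 2 μ)).topologicalClosure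

lemma regularRep_mem_isotypic (π : UnitaryDual G) (g : G) {v : Lp ℂ 2 μ} (hv : v ∈ isotypic μ π) :
    regularRep μ g v ∈ isotypic μ π := by
  set W := ⨆ T ∈ intertwiners μ π.rep, LinearMap.range (T : π.rep.V →ₗ[ℂ] Lp ℂ 2 μ) with hW
  have h1 : W ≤ W.comap (regularRep μ g).toLinearMap := by
    refine iSup₂_le fun T hT => ?_
    rintro _ ⟨v, rfl⟩
    have h2 : LinearMap.range (T : π.rep.V →ₗ[ℂ] Lp ℂ 2 μ) ≤ W :=
      le_iSup₂_of_le T hT le_rfl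
    exact h2 ⟨π.rep.ρ g v, hT g v⟩
  exact map_mem_closure (regularRep μ g).continuous hv fun x hx => h1 hx

variable (n)

/-- The smooth vectors `H(π)^∞` of `H(π)`: those `v` for which `g ↦ R_g v` is a smooth map from `G`
to the Hilbert space. -/
def smoothVectors (π : UnitaryDual G) : Submodule ℂ (Lp ℂ 2 μ) where
  carrier := {v | v ∈ isotypic μ π ∧ ContMDiff (𝓡 n) 𝓘(ℝ, Lp ℂ 2 μ) ∞ fun g => regularRep μ g v}
  add_mem' hv hw := ⟨add_mem hv.1 hw.1, (hv.2.add hw.2).congr fun g => map_add (regularRep μ g) _ _⟩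
  zero_mem' := ⟨zero_mem _, by simpa using contMDiff_const⟩
  smul_mem' c v hv := ⟨Submodule.smul_mem _ _ hv.1, by
    have h := (((c • ContinuousLinearMap.id ℂ (Lp ℂ 2 μ)) :
      Lp ℂ 2 μ →L[ℂ] Lp ℂ 2 μ).restrictScalars ℝ).contMDiff (n := ∞)
    simpa [Function.comp_def] using h.comp hv.2⟩

/-- The space `H(π)^∞` of smooth vectors. -/
def SmoothVectors (π : UnitaryDual G) : Type u := smoothVectors n μ π

instance (π : UnitaryDual G) : AddCommGroup (SmoothVectors n μ π) :=
  inferInstanceAs (AddCommGroup (smoothVectors n μ π))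
instance (π : UnitaryDual G) : Module ℂ (SmoothVectors n μ π) :=
  inferInstanceAs (Module ℂ (smoothVectors n μ π))

/-- The inclusion `H(π)^∞ → L²(X)`. -/
def toLp (π : UnitaryDual G) : SmoothVectors n μ π →ₗ[ℂ] Lp ℂ 2 μ :=
  (smoothVectors n μ π).subtype

variable {n}

lemma toLp_injective (π : UnitaryDual G) : Function.Injective (toLp n μ π) :=
  Subtype.val_injective

lemma lieDeriv_regularRep (ξ : GroupLieAlgebra (𝓡 n) G) {v : Lp ℂ 2 μ}
    (hv : ContMDiff (𝓡 n) 𝓘(ℝ, Lp ℂ 2 μ) ∞ fun g => regularRep μ g v) (g : G) :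
    regularRep μ g (lieDeriv ξ (fun g => regularRep μ g v) 1) =
      lieDeriv ξ (fun g => regularRep μ g v) g := by
  have h := lieDeriv_clm ((regularRep μ g).toContinuousLinearMap.restrictScalars ℝ) ξ hv 1
  refine h.symm.trans ?_
  unfold lieDeriv
  have e : (fun h => ((regularRep μ g).toContinuousLinearMap.restrictScalars ℝ)
      (regularRep μ (1 * h) v)) = fun h => regularRep μ (g * h) v := by
    funext h
    rw [one_mul, regularRep_mul]
    rfl
  rw [e]
  rfl

lemma lieDeriv_mem_isotypic (π : UnitaryDual G) (ξ : GroupLieAlgebra (𝓡 n) G) {v : Lp ℂ 2 μ}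
    (hm : v ∈ isotypic μ π)
    (hv : ContMDiff (𝓡 n) 𝓘(ℝ, Lp ℂ 2 μ) ∞ fun g => regularRep μ g v) :
    lieDeriv ξ (fun g => regularRep μ g v) 1 ∈ isotypic μ π := by
  have hc : (isotypic μ π).topologicalClosure = isotypic μ π :=
    (Submodule.isClosed_topologicalClosure _).submodule_topologicalClosure_eq
  rw [← hc, ← Submodule.orthogonal_orthogonal_eq_closure, Submodule.mem_orthogonal]
  intro w hw
  have h := lieDeriv_clm ((innerSL ℂ w).restrictScalars ℝ) ξ hv 1
  refine h.symm.trans ?_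
  have h0 : (fun h => (innerSL ℂ w).restrictScalars ℝ (regularRep μ h v)) = fun _ : G => (0 : ℂ) := by
    funext g
    exact (Submodule.mem_orthogonal' _ _).1 hw _ (regularRep_mem_isotypic μ π g hm)
  rw [h0]
  have h1 : HasMFDerivAt (𝓡 n) 𝓘(ℝ, ℂ) (fun _ : G => (0 : ℂ)) 1 0 := hasMFDerivAt_const _ _
  exact congrArg (fun S : EuclideanSpace ℝ (Fin n) →L[ℝ] ℂ => S ξ) h1.mfderiv

/-- The derived action of the Lie algebra on smooth vectors: `ξ v` is the derivative of `g ↦ R_g v`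
at the identity in the direction `ξ`, that is `d/dt R_{exp(t ξ)} v` at `t = 0`. -/
def derivedAction (π : UnitaryDual G) (ξ : GroupLieAlgebra (𝓡 n) G) :
    SmoothVectors n μ π →ₗ[ℂ] SmoothVectors n μ π where
  toFun v := ⟨lieDeriv ξ (fun g => regularRep μ g (toLp n μ π v)) 1,
    lieDeriv_mem_isotypic μ π ξ v.2.1 v.2.2, by
      have h := contMDiff_lieDeriv ξ v.2.2
      exact h.congr fun g => lieDeriv_regularRep μ ξ v.2.2 g⟩
  map_add' v w := Subtype.ext <| by
    refine Eq.trans ?_ (lieDeriv_add_right ξ v.2.2 w.2.2 1)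
    simp
    rfl
  map_smul' c v := Subtype.ext <| by
    refine Eq.trans ?_ (lieDeriv_clm (((c • ContinuousLinearMap.id ℂ (Lp ℂ 2 μ)) :
      Lp ℂ 2 μ →L[ℂ] Lp ℂ 2 μ).restrictScalars ℝ) ξ v.2.2 1)
    simp
    rfl

instance (π : UnitaryDual G) : LieRingModule (GroupLieAlgebra (𝓡 n) G) (SmoothVectors n μ π) where
  bracket ξ v := derivedAction μ π ξ v
  add_lie ξ η v := Subtype.ext <| by
    exact map_add (mfderiv (𝓡 n) 𝓘(ℝ, Lp ℂ 2 μ)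
      (fun h : G => regularRep μ (1 * h) (toLp n μ π v)) 1) ξ η
  lie_add ξ v w := map_add _ v w
  leibniz_lie ξ η v := by
    apply toLp_injective
    rw [map_add, ← sub_eq_iff_eq_add]
    have h : ∀ ξ η : GroupLieAlgebra (𝓡 n) G,
        toLp n μ π (derivedAction μ π ξ (derivedAction μ π η v)) =
        lieDeriv ξ (lieDeriv η fun g => regularRep μ g (toLp n μ π v)) 1 := by
      intro ξ η
      change lieDeriv ξ (fun g => regularRep μ g (lieDeriv η _ 1)) 1 = _
      congr 1
      funext g
      exact lieDeriv_regularRep μ η v.2.2 g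
    have h2 := lieDeriv_bracket ξ η v.2.2 1
    change toLp n μ π (derivedAction μ π ξ (derivedAction μ π η v)) -
      toLp n μ π (derivedAction μ π η (derivedAction μ π ξ v)) = _
    rw [h, h]
    exact h2.symm

instance (π : UnitaryDual G) (𝔭 : LieSubalgebra ℝ (GroupLieAlgebra (𝓡 n) G)) :
    ComplexLinearAction 𝔭 (SmoothVectors n μ π) :=
  ⟨fun ξ c v => (derivedAction μ π (ξ : GroupLieAlgebra (𝓡 n) G)).map_smul c v⟩

/-- The Fréchet topology on `H(π)^∞`, given by the seminorms `v ↦ ‖ξ₁ ⋯ ξₖ v‖`. -/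
instance (π : UnitaryDual G) : TopologicalSpace (SmoothVectors n μ π) :=
  operatorTopology (toLp n μ π) (fun ξ : GroupLieAlgebra (𝓡 n) G => derivedAction μ π ξ)

instance (π : UnitaryDual G) : IsTopologicalAddGroup (SmoothVectors n μ π) :=
  isTopologicalAddGroup_operatorTopology _ _

instance (π : UnitaryDual G) : ContinuousSMul ℂ (SmoothVectors n μ π) :=
  continuousSMul_operatorTopology _ _

end Representations

section Main

variable {Γ : Subgroup G} (𝔭 : LieSubalgebra ℝ (GroupLieAlgebra (𝓡 n) G))

/-- Complex valued leafwise differential forms of degree `p` on `X` for the foliation with tangent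
spaces given by `𝔭`: the alternating maps from leafwise vector fields to functions that are
multilinear over `C^∞(X)`. Their topology (pointwise convergence on vector fields, with values in
`C^∞(X)`) is the `C^∞` topology, since finitely many induced fields span. -/
abbrev LeafwiseForm (Γ : Subgroup G) (p : ℕ) : Type _ :=
  leafwiseFields Γ 𝔭 [⋀^Fin p]→ₗ[SmoothFun n Γ] SmoothFun n Γ

/-- Reduced leafwise cohomology of `X` with complex coefficients. -/
abbrev LeafwiseReducedCohomology (Γ : Subgroup G) (p : ℕ) : Type _ :=
  ReducedCohomology (SmoothFun n Γ) (leafwiseFields Γ 𝔭) (SmoothFun n Γ) p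

/-- The leafwise vector field on `X` induced by an element of `𝔭`. -/
def leafwiseField (Γ : Subgroup G) (ξ : 𝔭) : leafwiseFields Γ 𝔭 :=
  ⟨inducedField Γ (ξ : GroupLieAlgebra (𝓡 n) G), Submodule.subset_span ⟨ξ, rfl⟩⟩

variable (μ : Measure (LeftQuotient Γ)) [IsRightInvariant μ]

/-- Reduced Lie algebra cohomology of `𝔭` with coefficients in `H(π)^∞`. -/
abbrev IsotypicReducedCohomology (π : UnitaryDual G) (p : ℕ) : Type _ :=
  ReducedCohomology ℝ 𝔭 (SmoothVectors n μ π) p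

/-- The canonical class map from cocycles to reduced Lie algebra cohomology. -/
abbrev isotypicClass {π : UnitaryDual G} {p : ℕ} :
    cocycles ℝ 𝔭 (SmoothVectors n μ π) p →ₗ[ℂ] IsotypicReducedCohomology 𝔭 μ π p :=
  Submodule.mkQ _

/-- The canonical class map from closed leafwise forms to reduced leafwise cohomology. -/
abbrev leafwiseClass {p : ℕ} :
    cocycles (SmoothFun n Γ) (leafwiseFields Γ 𝔭) (SmoothFun n Γ) p →ₗ[ℂ]
      LeafwiseReducedCohomology 𝔭 Γ p :=
  Submodule.mkQ _

/-- The leafwise form `β` corresponds to the cochain `α` with values in `H(π)^∞`: evaluated on the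
vector fields induced by `ξ₁, …, ξₚ ∈ 𝔭`, the form `β` gives the smooth function on `X` whose class
in `L²(X)` is `α(ξ₁, …, ξₚ)`. (As `μ` has full support and these fields span the leafwise vector
fields, `β` is uniquely determined by `α`.) -/
def Corresponds {π : UnitaryDual G} {p : ℕ} (α : 𝔭 [⋀^Fin p]→ₗ[ℝ] SmoothVectors n μ π)
    (β : LeafwiseForm 𝔭 Γ p) : Prop :=
  ∀ ξ : Fin p → 𝔭,
    (β fun i => leafwiseField 𝔭 Γ (ξ i) : LeftQuotient Γ → ℂ) =ᵐ[μ] toLp n μ π (α ξ)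

/-- `κ` is the natural map from reduced Lie algebra cohomology with coefficients in `H(π)^∞` to
reduced leafwise cohomology: to every cocycle there corresponds a closed leafwise form, and `κ` maps
the class of the cocycle to the class of the form. These conditions determine `κ`. -/
def IsNaturalMap {π : UnitaryDual G} {p : ℕ}
    (κ : IsotypicReducedCohomology 𝔭 μ π p →L[ℂ] LeafwiseReducedCohomology 𝔭 Γ p) : Prop :=
  ∀ α : cocycles ℝ 𝔭 (SmoothVectors n μ π) p,
    (∃ β : cocycles (SmoothFun n Γ) (leafwiseFields Γ 𝔭) (SmoothFun n Γ) p,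
      Corresponds 𝔭 μ α.1 β.1) ∧
    ∀ β : cocycles (SmoothFun n Γ) (leafwiseFields Γ 𝔭) (SmoothFun n Γ) p,
      Corresponds 𝔭 μ α.1 β.1 → κ (isotypicClass 𝔭 μ α) = leafwiseClass 𝔭 β

open scoped DirectSum in
open Classical in
/-- The map from the algebraic direct sum over the unitary dual induced by maps `κ π`. -/
def directSumMap {p : ℕ} (κ : ∀ π : UnitaryDual G,
      IsotypicReducedCohomology 𝔭 μ π p →L[ℂ] LeafwiseReducedCohomology 𝔭 Γ p) :
    (⨁ π : UnitaryDual G, IsotypicReducedCohomology 𝔭 μ π p) →ₗ[ℂ]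
      LeafwiseReducedCohomology 𝔭 Γ p :=
  DirectSum.toModule ℂ (UnitaryDual G) _ fun π => (κ π : _ →ₗ[ℂ] _)

end Main

end LatticeQuotient

end

set_option linter.unusedSectionVars false

/-! The argument has an algebraic half, which reduces everything to splitting the coefficient module
`C^∞(X)`, and an analytic half, which splits it.

Algebra. The fields induced by a basis of `𝔭` form a basis of the leafwise fields over `C^∞(X)`
(`fieldsBasis`). Restricting a form to induced fields therefore identifies the leafwise complex with
the Chevalley–Eilenberg complex of `𝔭` with values in `C^∞(X)`, continuously in both directions
(`restrictForm`, `extendForm`). On coefficients there are continuous `𝔭`-equivariant maps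
`isotypicToFun : H(π)^∞ → C^∞(X)` and `isotypicOfFun` back. Their composite is the identity for
equal classes and zero for different ones, and every smooth function is the unconditional sum of its
components in the `C^∞` topology (`hasSum_isotypicToFun`). All of this passes to cocycles modulo
closures of coboundaries. The maps back give the splittings, the vanishing of the mixed composites
gives injectivity on the direct sum, and the series gives density and the expansion of classes. The
image of each `naturalMap` is closed, being the fixed set of a continuous idempotent of a Hausdorff
space.

Analysis. A single tool serves twice: weighted averages of right translations over products `γ₁(t₁)
⋯ γₙ(tₙ)` of short curves along the coordinate axes of `G`. The image on `X` of Lebesgue measure on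
a small cube under such a product is at most `C μ`, uniformly in the base point
(`exists_volume_axisProd_le`). Hence these averages map `L²(X)` into `C(X)`
(`IsDominated.exists_lift`).

The first use is a Sobolev lemma. Integration by parts along each curve writes a smooth vector as a
finite sum of averages of its derivatives (`exists_sobolev`). It follows that the smooth vectors of
`L²(X)` are exactly the smooth functions (`smoothClass_surjective`), and that `C^∞` convergence is
controlled by `L²` convergence of derivatives.

The second use is discrete decomposition. An operator that factors through `C(X)` is
Hilbert–Schmidt, hence compact (`isCompactOperator_of_lift`). So every nonzero closed invariant
subspace contains a minimal one (`IsInvariantSubspace.exists_irreducible`), and with Schur's lemma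
`L²(X)` is the Hilbert sum of its isotypic components (`hasSum_isotypicProj`). The isotypic
projections commute with translations, hence with derivatives, and the Sobolev formula turns the
`L²` expansions of the derivatives into `C^∞` convergence. -/

noncomputable section
namespace LatticeQuotient
universe u

/-! ### Topology of the quotient and positivity of the invariant measure. -/

section Basic

variable {G : Type u} [TopologicalSpace G] [Group G] {Γ : Subgroup G}

omit [TopologicalSpace G] in
lemma proj_surjective : Function.Surjective (proj Γ) := Quotient.mk_surjective

lemma isOpenQuotientMap_proj [IsTopologicalGroup G] : IsOpenQuotientMap (proj Γ) where
  surjective := proj_surjective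
  continuous := continuous_quotient_mk'
  isOpenMap := isOpenMap_quotient_mk'_mul (Γ := Γ) (T := G)

lemma continuous_proj : Continuous (proj Γ) := continuous_quotient_mk'

lemma t2Space_leftQuotient [IsTopologicalGroup G] [T2Space G] [LocallyCompactSpace G]
    [DiscreteTopology Γ] : T2Space (LeftQuotient Γ) := by
  have : ProperlyDiscontinuousSMul Γ G :=
    Subgroup.properlyDiscontinuousSMul_of_tendsto_cofinite Γ (Γ.tendsto_coe_cofinite_of_discrete ⟨‹_›⟩)
  exact t2Space_of_properlyDiscontinuousSMul_of_t2Space (Γ := Γ) (T := G)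

lemma secondCountable_leftQuotient [IsTopologicalGroup G] [SecondCountableTopology G] :
    SecondCountableTopology (LeftQuotient Γ) :=
  (isOpenQuotientMap_proj (Γ := Γ)).isQuotientMap.secondCountableTopology
    (isOpenQuotientMap_proj (Γ := Γ)).isOpenMap

omit [TopologicalSpace G] in
lemma rightTranslate_mul (g h : G) (x : LeftQuotient Γ) :
    rightTranslate h (rightTranslate g x) = rightTranslate (g * h) x := by
  obtain ⟨a, rfl⟩ := proj_surjective x
  simp [rightTranslate_proj, mul_assoc]

omit [TopologicalSpace G] in
@[simp] lemma rightTranslate_one (x : LeftQuotient Γ) : rightTranslate (1 : G) x = x := by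
  obtain ⟨a, rfl⟩ := proj_surjective x
  simp [rightTranslate_proj]

lemma continuous_rightTranslate_prod [IsTopologicalGroup G] :
    Continuous fun q : G × LeftQuotient Γ => rightTranslate q.1 q.2 := by
  have h := (IsOpenQuotientMap.id (X := G)).prodMap (isOpenQuotientMap_proj (Γ := Γ))
  rw [h.isQuotientMap.continuous_iff]
  exact continuous_proj.comp (continuous_snd.mul continuous_fst)

lemma isOpenMap_rightTranslate_left [IsTopologicalGroup G] (x : LeftQuotient Γ) :
    IsOpenMap fun g : G => rightTranslate g x := by
  obtain ⟨a, rfl⟩ := proj_surjective x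
  exact (isOpenQuotientMap_proj (Γ := Γ)).isOpenMap.comp (isOpenMap_mul_left a)

omit [TopologicalSpace G] in
lemma exists_rightTranslate_eq (x y : LeftQuotient Γ) : ∃ g : G, rightTranslate g x = y := by
  obtain ⟨a, rfl⟩ := proj_surjective x
  obtain ⟨b, rfl⟩ := proj_surjective y
  exact ⟨a⁻¹ * b, by simp [rightTranslate_proj]⟩

variable (μ : Measure (LeftQuotient Γ)) [IsRightInvariant μ]

lemma measurePreserving_rightTranslate (g : G) :
    MeasurePreserving (rightTranslate g : LeftQuotient Γ → LeftQuotient Γ) μ μ :=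
  IsRightInvariant.measurePreserving g

/-- The translates of a nonempty open set cover `X` by transitivity, finitely many suffice by
compactness, and by invariance they all have the same measure; so that measure cannot be zero. -/
lemma isOpenPosMeasure [IsTopologicalGroup G] [CompactSpace (LeftQuotient Γ)]
    [IsProbabilityMeasure μ] : μ.IsOpenPosMeasure where
  open_pos U hU hne h0 := by
    obtain ⟨x₀, hx₀⟩ := hne
    have hpre : ∀ g : G, μ (rightTranslate g ⁻¹' U) = 0 := fun g => by
      rw [(measurePreserving_rightTranslate μ g).measure_preimage hU.measurableSet.nullMeasurableSet,
        h0]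
    obtain ⟨t, ht⟩ := isCompact_univ.elim_finite_subcover
      (fun g : G => (rightTranslate g ⁻¹' U : Set (LeftQuotient Γ)))
      (fun g => hU.preimage (continuous_rightTranslate g)) fun x _ => by
        obtain ⟨g, hg⟩ := exists_rightTranslate_eq x x₀
        exact Set.mem_iUnion.2 ⟨g, by simpa [hg] using hx₀⟩
    have : μ Set.univ ≤ 0 := (measure_mono ht).trans <| by
      refine (measure_biUnion_finset_le t _).trans ?_
      simp [hpre]
    simp at this

/-- Choose `V` with `V⁻¹ V ⊆ U` and cover `X` by finitely many `y V`. If `x` lies in `y V`, then `y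
V ⊆ x U`, so the least of these finitely many positive measures is a bound uniform in `x`. -/
lemma exists_le_measure_orbit [IsTopologicalGroup G] [CompactSpace (LeftQuotient Γ)]
    [IsProbabilityMeasure μ] {U : Set G} (hU : U ∈ nhds (1 : G)) :
    ∃ c : ENNReal, c ≠ 0 ∧ ∀ x : LeftQuotient Γ, c ≤ μ ((fun g => rightTranslate g x) '' U) := by
  obtain ⟨V, hVo, hV1, hVU⟩ : ∃ V : Set G, IsOpen V ∧ (1 : G) ∈ V ∧ ∀ v ∈ V, ∀ w ∈ V, v⁻¹ * w ∈ U := by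
    have hc : Filter.Tendsto (fun q : G × G => q.1⁻¹ * q.2) (nhds (1, 1)) (nhds 1) := by
      have : Continuous fun q : G × G => q.1⁻¹ * q.2 := by fun_prop
      simpa using this.tendsto (1, 1)
    obtain ⟨u, v, hu, h1, hv, h2, h⟩ := mem_nhds_prod_iff'.1 (hc hU)
    exact ⟨u ∩ v, hu.inter hv, ⟨h1, h2⟩, fun a ha b hb => h (Set.mk_mem_prod ha.1 hb.2)⟩
  have := isOpenPosMeasure μ
  let O : LeftQuotient Γ → Set (LeftQuotient Γ) := fun x => (fun g => rightTranslate g x) '' V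
  have hO : ∀ x, IsOpen (O x) := fun x => isOpenMap_rightTranslate_left x V hVo
  have hxO : ∀ x, x ∈ O x := fun x => ⟨1, hV1, by simp⟩
  obtain ⟨t, ht⟩ := isCompact_univ.elim_finite_subcover O hO fun x _ =>
    Set.mem_iUnion.2 ⟨x, hxO x⟩
  refine ⟨t.inf fun x => μ (O x), ?_, fun x => ?_⟩
  · rw [← pos_iff_ne_zero, Finset.lt_inf_iff (by simp)]
    exact fun x _ => (hO x).measure_pos μ ⟨x, hxO x⟩
  · obtain ⟨y, hy, v, hv, hvx⟩ := Set.mem_iUnion₂.1 (ht (Set.mem_univ x))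
    refine (Finset.inf_le hy).trans (measure_mono ?_)
    rintro _ ⟨w, hw, rfl⟩
    refine ⟨v⁻¹ * w, hVU v hv w hw, ?_⟩
    simp only [← hvx, rightTranslate_mul]
    simp

end Basic

/-! ### Right translations on `C(X)` and `L²(X)`. -/

section Functions

variable {G : Type u} [TopologicalSpace G] [Group G] [IsTopologicalGroup G] {Γ : Subgroup G}

/-- Right translation `w ↦ w(· g)` on `C(X)`. -/
def translateC (Γ : Subgroup G) (g : G) : C(LeftQuotient Γ, ℂ) →ₗ[ℂ] C(LeftQuotient Γ, ℂ) where
  toFun w := w.comp ⟨rightTranslate g, continuous_rightTranslate g⟩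
  map_add' _ _ := rfl
  map_smul' _ _ := rfl

@[simp] lemma translateC_apply (g : G) (w : C(LeftQuotient Γ, ℂ)) (x : LeftQuotient Γ) :
    translateC Γ g w x = w (rightTranslate g x) := rfl

lemma translateC_mul (g h : G) (w : C(LeftQuotient Γ, ℂ)) :
    translateC Γ g (translateC Γ h w) = translateC Γ (g * h) w := by
  ext x
  simp [rightTranslate_mul]

/-- Currying the jointly continuous `(g, x) ↦ w (x g)` gives continuity for the compact-open
topology, which is the sup norm topology once `X` is compact. -/
lemma continuous_translateC (w : C(LeftQuotient Γ, ℂ)) :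
    Continuous fun g : G => translateC Γ g w := by
  let F : C(G × LeftQuotient Γ, ℂ) := ⟨fun q => w (rightTranslate q.1 q.2),
    w.continuous.comp continuous_rightTranslate_prod⟩
  exact F.curry.continuous

variable [CompactSpace (LeftQuotient Γ)]

/-- Right translation as a continuous linear operator on `C(X)`. -/
def translateCL (Γ : Subgroup G) [CompactSpace (LeftQuotient Γ)] (g : G) :
    C(LeftQuotient Γ, ℂ) →L[ℂ] C(LeftQuotient Γ, ℂ) :=
  ⟨translateC Γ g, ContinuousMap.continuous_precomp _⟩

@[simp] lemma translateCL_apply (g : G) (w : C(LeftQuotient Γ, ℂ)) :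
    translateCL Γ g w = translateC Γ g w := rfl

variable (μ : Measure (LeftQuotient Γ)) [IsProbabilityMeasure μ] [IsRightInvariant μ]

/-- The inclusion `C(X) → L²(X)`. -/
abbrev classC [SecondCountableTopology (LeftQuotient Γ)] :
    C(LeftQuotient Γ, ℂ) →L[ℂ] Lp ℂ 2 μ :=
  ContinuousMap.toLp 2 μ ℂ

variable [SecondCountableTopology (LeftQuotient Γ)]

lemma coeFn_classC (w : C(LeftQuotient Γ, ℂ)) : classC μ w =ᵐ[μ] w :=
  ContinuousMap.coeFn_toLp μ w

lemma regularRep_classC (g : G) (w : C(LeftQuotient Γ, ℂ)) :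
    regularRep μ g (classC μ w) = classC μ (translateC Γ g w) := by
  refine Lp.ext ?_
  have h1 := Lp.coeFn_compMeasurePreserving (classC μ w) (measurePreserving_rightTranslate μ g)
  have h2 := (measurePreserving_rightTranslate μ g).quasiMeasurePreserving.ae_eq_comp
    (coeFn_classC μ w)
  exact (h1.trans h2).trans (coeFn_classC μ (translateC Γ g w)).symm

lemma classC_injective : Function.Injective (classC μ) := by
  have := isOpenPosMeasure μ
  exact ContinuousMap.toLp_injective μ

lemma classC_denseRange [T2Space (LeftQuotient Γ)] : DenseRange (classC μ) :=
  ContinuousMap.toLp_denseRange ℂ μ ℂ (by simp)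

omit [IsTopologicalGroup G] [CompactSpace (LeftQuotient Γ)] [IsProbabilityMeasure μ]
  [SecondCountableTopology (LeftQuotient Γ)] in
@[simp] lemma regularRep_one (v : Lp ℂ 2 μ) : regularRep μ (1 : G) v = v := by
  refine Lp.ext ((Lp.coeFn_compMeasurePreserving v (measurePreserving_rightTranslate μ 1)).trans ?_)
  exact Filter.Eventually.of_forall fun x => congrArg v (rightTranslate_one x)

omit [IsTopologicalGroup G] [CompactSpace (LeftQuotient Γ)] [IsProbabilityMeasure μ]
  [SecondCountableTopology (LeftQuotient Γ)] in
lemma inner_regularRep (g : G) (v w : Lp ℂ 2 μ) :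
    inner ℂ (regularRep μ g v) w = inner ℂ v (regularRep μ g⁻¹ w) := by
  rw [← (regularRep μ g⁻¹).inner_map_map, ← regularRep_mul]
  simp

/-- The translations are isometries, so the vectors with continuous orbit form a closed set; it
contains the dense image of `C(X)`. -/
lemma continuous_regularRep [T2Space (LeftQuotient Γ)] (v : Lp ℂ 2 μ) :
    Continuous fun g : G => regularRep μ g v := by
  have hc : IsClosed {v : Lp ℂ 2 μ | Continuous fun g : G => regularRep μ g v} := by
    refine isClosed_of_closure_subset fun v hv => ?_
    rw [Set.mem_ofPred, continuous_iff_continuousAt]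
    intro g₀
    rw [Metric.continuousAt_iff']
    intro ε hε
    obtain ⟨w, hw, hvw⟩ := Metric.mem_closure_iff.1 hv (ε / 3) (by positivity)
    filter_upwards [Metric.continuousAt_iff'.1 (continuous_iff_continuousAt.1 hw g₀) (ε / 3)
      (by positivity)] with g hg
    have h1 : dist (regularRep μ g v) (regularRep μ g w) < ε / 3 := by
      rwa [(regularRep μ g).dist_map]
    have h2 : dist (regularRep μ g₀ w) (regularRep μ g₀ v) < ε / 3 := by
      rwa [(regularRep μ g₀).dist_map, dist_comm]
    have h3 := dist_triangle4 (regularRep μ g v) (regularRep μ g w) (regularRep μ g₀ w)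
      (regularRep μ g₀ v)
    linarith
  have hd : ∀ w, classC μ w ∈ {v : Lp ℂ 2 μ | Continuous fun g : G => regularRep μ g v} := fun w => by
    simp only [Set.mem_ofPred, regularRep_classC]
    exact (classC μ).continuous.comp (continuous_translateC w)
  have := (classC_denseRange μ).induction_on (p := fun v => Continuous fun g : G => regularRep μ g v)
    v hc hd
  exact this

end Functions

/-! ### Coordinates at the identity and products of axis curves. -/

section Coordinates

variable {n : ℕ} {G : Type u} [TopologicalSpace G] [ChartedSpace (EuclideanSpace ℝ (Fin n)) G]
  [Group G]

variable (n G) in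
/-- The inverse of a chart of `G` at the identity, moved so that `0` is mapped to `1`. -/
def coordMap (t : Fin n → ℝ) : G :=
  (extChartAt (𝓡 n) (1 : G)).symm
    (extChartAt (𝓡 n) (1 : G) 1 + (EuclideanSpace.equiv (Fin n) ℝ).symm t)

/-- Coordinates near the identity of `G`, centred at the identity. -/
def coordInv (g : G) : Fin n → ℝ :=
  EuclideanSpace.equiv (Fin n) ℝ (extChartAt (𝓡 n) (1 : G) g - extChartAt (𝓡 n) (1 : G) 1)

@[simp] lemma coordMap_zero : coordMap n G 0 = 1 := by
  simp [coordMap]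

@[simp] lemma coordInv_one : coordInv (n := n) (1 : G) = 0 := by
  simp [coordInv]

lemma eventually_coordInv_coordMap :
    ∀ᶠ t in nhds (0 : Fin n → ℝ), coordInv (coordMap n G t) = t := by
  have hc : ContinuousAt (fun t : Fin n → ℝ => extChartAt (𝓡 n) (1 : G) 1 +
      (EuclideanSpace.equiv (Fin n) ℝ).symm t) 0 := by fun_prop
  have h := hc.eventually_mem (s := (extChartAt (𝓡 n) (1 : G)).target)
    (by rw [map_zero, add_zero]; exact extChartAt_target_mem_nhds (I := 𝓡 n) (1 : G))
  filter_upwards [h] with t ht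
  unfold coordInv coordMap
  rw [(extChartAt (𝓡 n) (1 : G)).right_inv ht, add_sub_cancel_left,
    ContinuousLinearEquiv.apply_symm_apply]

lemma eventually_coordMap_coordInv :
    ∀ᶠ g in nhds (1 : G), coordMap n G (coordInv g) = g := by
  filter_upwards [extChartAt_source_mem_nhds (I := 𝓡 n) (1 : G)] with g hg
  unfold coordInv coordMap
  rw [ContinuousLinearEquiv.symm_apply_apply, add_sub_cancel,
    (extChartAt (𝓡 n) (1 : G)).left_inv hg]

variable [LieGroup (𝓡 n) ∞ G]

lemma contMDiffAt_coordMap :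
    ∀ᶠ t in nhds (0 : Fin n → ℝ), ContMDiffAt 𝓘(ℝ, Fin n → ℝ) (𝓡 n) ∞ (coordMap n G) t := by
  have hc : ContinuousAt (fun t : Fin n → ℝ => extChartAt (𝓡 n) (1 : G) 1 +
      (EuclideanSpace.equiv (Fin n) ℝ).symm t) 0 := by fun_prop
  have h := hc.eventually_mem (s := (extChartAt (𝓡 n) (1 : G)).target)
    (by rw [map_zero, add_zero]; exact extChartAt_target_mem_nhds (I := 𝓡 n) (1 : G))
  filter_upwards [h] with t ht
  have h1 := ((contMDiffOn_extChartAt_symm (I := 𝓡 n) (n := ∞) (1 : G)) _ ht).contMDiffAt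
    ((isOpen_extChartAt_target (1 : G)).mem_nhds ht)
  refine h1.comp t ?_
  rw [contMDiffAt_iff_contDiffAt]
  fun_prop

lemma contMDiffAt_coordInv :
    ∀ᶠ g in nhds (1 : G), ContMDiffAt (𝓡 n) 𝓘(ℝ, Fin n → ℝ) ∞ (coordInv : G → Fin n → ℝ) g := by
  filter_upwards [(chartAt (EuclideanSpace ℝ (Fin n)) (1 : G)).open_source.mem_nhds
    (mem_chart_source _ (1 : G))] with g hg
  have h1 := contMDiffAt_extChartAt' (I := 𝓡 n) (n := ∞) (x := (1 : G)) hg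
  have h2 : ContDiff ℝ ∞ fun z : EuclideanSpace ℝ (Fin n) =>
    EuclideanSpace.equiv (Fin n) ℝ (z - extChartAt (𝓡 n) (1 : G) 1) := by fun_prop
  exact h2.contMDiff.contMDiffAt.comp g h1

variable (n G) in
/-- The curves through the identity in the direction of the coordinate axes. -/
def axisCurve (i : Fin n) (s : ℝ) : G := coordMap n G (Pi.single i s)

@[simp] lemma axisCurve_zero (i : Fin n) : axisCurve n G i 0 = 1 := by simp [axisCurve]

omit [TopologicalSpace G] [ChartedSpace (EuclideanSpace ℝ (Fin n)) G] [LieGroup (𝓡 n) ∞ G] in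
lemma prod_ofFn_eq_of_forall_ne {m : ℕ} (f : Fin m → G) (i : Fin m) (h : ∀ j, j ≠ i → f j = 1) :
    (List.ofFn f).prod = f i := by
  induction m with
  | zero => exact i.elim0
  | succ m ih =>
    rw [List.ofFn_succ, List.prod_cons]
    refine Fin.cases (fun h => ?_) (fun i h => ?_) i h
    · rw [List.prod_eq_one, mul_one]
      intro x hx
      obtain ⟨j, rfl⟩ := (List.mem_ofFn' _ _).1 hx
      exact h _ (Fin.succ_ne_zero j)
    · rw [h 0 (Fin.succ_ne_zero i).symm, one_mul]
      exact ih _ i fun j hj => h _ (by simpa using hj)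

lemma contMDiffAt_prod_ofFn {W : Type*} [NormedAddCommGroup W] [NormedSpace ℝ W] {m : ℕ}
    (f : Fin m → W → G) (t : W)
    (h : ∀ i, ContMDiffAt 𝓘(ℝ, W) (𝓡 n) ∞ (f i) t) :
    ContMDiffAt 𝓘(ℝ, W) (𝓡 n) ∞ (fun t => (List.ofFn fun i => f i t).prod) t := by
  induction m with
  | zero => simpa using contMDiffAt_const
  | succ m ih =>
    simp only [List.ofFn_succ, List.prod_cons]
    exact (h 0).mul (ih _ fun i => h i.succ)

variable (n G) in
/-- The product of the curves along the coordinate axes. -/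
def axisProd (t : Fin n → ℝ) : G := (List.ofFn fun i => axisCurve n G i (t i)).prod

@[simp] lemma axisProd_zero : axisProd n G 0 = 1 := by
  unfold axisProd
  refine List.prod_eq_one fun x hx => ?_
  obtain ⟨j, rfl⟩ := (List.mem_ofFn' _ _).1 hx
  simp

lemma axisProd_single (i : Fin n) (s : ℝ) : axisProd n G (Pi.single i s) = axisCurve n G i s := by
  unfold axisProd
  rw [prod_ofFn_eq_of_forall_ne _ i fun j hj => by simp [hj]]
  simp

lemma contMDiffAt_axisProd :
    ∀ᶠ t in nhds (0 : Fin n → ℝ), ContMDiffAt 𝓘(ℝ, Fin n → ℝ) (𝓡 n) ∞ (axisProd n G) t := by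
  have h2 : ∀ i : Fin n, ContDiff ℝ ∞ fun t : Fin n → ℝ => (Pi.single i (t i) : Fin n → ℝ) := by
    intro i
    refine contDiff_pi.2 fun j => ?_
    by_cases hj : j = i
    · subst hj; simpa using contDiff_apply ℝ ℝ j
    · simpa [hj] using contDiff_const
  have h3 : ∀ i : Fin n, ∀ᶠ t in nhds (0 : Fin n → ℝ),
      ContMDiffAt 𝓘(ℝ, Fin n → ℝ) (𝓡 n) ∞ (coordMap n G) (Pi.single i (t i)) := by
    intro i
    have h := (h2 i).continuous.tendsto 0
    simp only [Pi.zero_apply, Pi.single_zero] at h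
    exact h.eventually contMDiffAt_coordMap
  filter_upwards [Filter.eventually_all.2 h3] with t ht
  exact contMDiffAt_prod_ofFn _ _ fun i => (ht i).comp t (h2 i).contMDiff.contMDiffAt

variable (n G) in
/-- The product `coordMap s ⁻¹ * axisProd t` in coordinates. -/
def shiftedProd (q : (Fin n → ℝ) × (Fin n → ℝ)) : Fin n → ℝ :=
  coordInv ((coordMap n G q.1)⁻¹ * axisProd n G q.2)

lemma contDiffAt_shiftedProd : ContDiffAt ℝ ∞ (shiftedProd n G) 0 := by
  rw [← contMDiffAt_iff_contDiffAt]
  have h1 : ContMDiffAt 𝓘(ℝ, (Fin n → ℝ) × (Fin n → ℝ)) (𝓡 n) ∞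
      (fun q : (Fin n → ℝ) × (Fin n → ℝ) => coordMap n G q.1) 0 :=
    ContMDiffAt.comp (g := coordMap n G) (f := Prod.fst) (0 : (Fin n → ℝ) × (Fin n → ℝ))
      contMDiffAt_coordMap.self_of_nhds contDiff_fst.contMDiff.contMDiffAt
  have h2 : ContMDiffAt 𝓘(ℝ, (Fin n → ℝ) × (Fin n → ℝ)) (𝓡 n) ∞
      (fun q : (Fin n → ℝ) × (Fin n → ℝ) => axisProd n G q.2) 0 :=
    ContMDiffAt.comp (g := axisProd n G) (f := Prod.snd) (0 : (Fin n → ℝ) × (Fin n → ℝ))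
      contMDiffAt_axisProd.self_of_nhds contDiff_snd.contMDiff.contMDiffAt
  have h3 := h1.inv.mul h2
  refine ContMDiffAt.comp (g := (coordInv : G → Fin n → ℝ))
    (f := fun q : (Fin n → ℝ) × (Fin n → ℝ) => (coordMap n G q.1)⁻¹ * axisProd n G q.2) _ ?_ h3
  simpa using contMDiffAt_coordInv.self_of_nhds

/-- On a coordinate axis only one factor of `axisProd` differs from `1`, so there it agrees with
`coordMap`, and `coordInv ∘ coordMap` is the identity near `0`. Checking the axes determines the
derivative. -/
lemma fderiv_shiftedProd (v : Fin n → ℝ) : fderiv ℝ (shiftedProd n G) 0 (0, v) = v := by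
  have hd : HasFDerivAt (shiftedProd n G) (fderiv ℝ (shiftedProd n G) 0) 0 :=
    (contDiffAt_shiftedProd.differentiableAt (by simp)).hasFDerivAt
  suffices h : (fderiv ℝ (shiftedProd n G) 0).comp (ContinuousLinearMap.inr ℝ _ _) =
      ContinuousLinearMap.id ℝ (Fin n → ℝ) from congrArg (fun T => T v) h
  have hbasis : ∀ i : Fin n, fderiv ℝ (shiftedProd n G) 0 (0, Pi.single i 1) = Pi.single i 1 := by
    intro i
    let c : ℝ → (Fin n → ℝ) × (Fin n → ℝ) := fun s => (0, Pi.single i s)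
    have hc : HasDerivAt c (0, Pi.single i 1) 0 := by
      have h1 : c = fun s : ℝ => s • ((0, Pi.single i 1) : (Fin n → ℝ) × (Fin n → ℝ)) := by
        funext s
        simp [c, ← Pi.single_smul']
      rw [h1]
      simpa using (hasDerivAt_id (0 : ℝ)).smul_const
        ((0, Pi.single i 1) : (Fin n → ℝ) × (Fin n → ℝ))
    have hc0 : c 0 = 0 := by simp [c]
    have h1 : HasDerivAt (fun s => shiftedProd n G (c s))
        (fderiv ℝ (shiftedProd n G) 0 (0, Pi.single i 1)) 0 := by
      have hd' := hd
      rw [← hc0] at hd'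
      have h2 := hd'.comp_hasDerivAt (0 : ℝ) hc
      rwa [hc0] at h2
    have hs : HasDerivAt (fun s : ℝ => (Pi.single i s : Fin n → ℝ)) (Pi.single i 1) 0 := by
      have h1 : (fun s : ℝ => (Pi.single i s : Fin n → ℝ)) =
          fun s : ℝ => s • (Pi.single i 1 : Fin n → ℝ) := by
        funext s
        simp [← Pi.single_smul']
      rw [h1]
      simpa using (hasDerivAt_id (0 : ℝ)).smul_const (Pi.single i 1 : Fin n → ℝ)
    have he : (fun s => shiftedProd n G (c s)) =ᶠ[nhds 0] fun s => Pi.single i s := by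
      have hcont : Filter.Tendsto (fun s : ℝ => (Pi.single i s : Fin n → ℝ)) (nhds 0) (nhds 0) := by
        simpa using hs.continuousAt.tendsto
      filter_upwards [hcont.eventually (eventually_coordInv_coordMap (G := G))] with s hs
      simpa [shiftedProd, c, axisProd_single, axisCurve] using hs
    exact h1.unique (hs.congr_of_eventuallyEq he)
  refine ContinuousLinearMap.coe_injective ((Pi.basisFun ℝ (Fin n)).ext fun i => ?_)
  simpa using hbasis i

end Coordinates

/-! ### Averages over products of axis curves are dominated by `μ`. -/

section Domination

-- Lebesgue measure for the sup norm is the `n`-dimensional Hausdorff measure, so neither `f` nor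
-- `S` has to be measurable.
open Measure in
lemma volume_le_of_antilipschitzOn {n : ℕ} {f : (Fin n → ℝ) → (Fin n → ℝ)} {S : Set (Fin n → ℝ)}
    {K : NNReal} (hf : ∀ s ∈ S, ∀ t ∈ S, dist s t ≤ K * dist (f s) (f t)) :
    volume S ≤ (K : ENNReal) ^ n * volume (f '' S) := by
  have h1 : AntilipschitzWith K (fun s : S => f s) :=
    AntilipschitzWith.of_le_mul_dist fun s t => hf s s.2 t t.2
  have h2 := h1.le_hausdorffMeasure_image (d := n) (by positivity) Set.univ
  have h3 : (fun s : S => f s) '' Set.univ = f '' S := by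
    ext; simp
  have h4 := (isometry_subtype_coe (s := S)).hausdorffMeasure_image (d := n) (Or.inl (by positivity))
    Set.univ
  have h5 : (μH[(n : ℝ)] : Measure (Fin n → ℝ)) = volume := by
    simpa using hausdorffMeasure_pi_real (ι := Fin n)
  rw [h3, ← h4, h5] at h2
  simpa using h2

variable {n : ℕ} {G : Type u} [TopologicalSpace G] [ChartedSpace (EuclideanSpace ℝ (Fin n)) G]
  [Group G] [LieGroup (𝓡 n) ∞ G] [IsTopologicalGroup G] [SecondCountableTopology G]
  {Γ : Subgroup G} [CompactSpace (LeftQuotient Γ)]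

-- The change of variables behind the comparison of measures: for fixed small `s`, the map `t ↦
-- shiftedProd (s, t)` shrinks distances at most by the factor `2`, because its derivative in `t` is
-- close to the identity.
variable (n) in
lemma exists_shiftedProd_bounds (G : Type u) [TopologicalSpace G]
    [ChartedSpace (EuclideanSpace ℝ (Fin n)) G]
    [Group G] [LieGroup (𝓡 n) ∞ G] [IsTopologicalGroup G] :
    ∃ r > 0, ∃ δ > 0, ContinuousOn (coordMap n G) (Metric.ball 0 r) ∧
      (∀ s ∈ Metric.ball (0 : Fin n → ℝ) δ, ∀ t ∈ Metric.ball (0 : Fin n → ℝ) δ,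
        shiftedProd n G (s, t) ∈ Metric.ball 0 r ∧
        coordMap n G s * coordMap n G (shiftedProd n G (s, t)) = axisProd n G t ∧
        ∀ t' ∈ Metric.ball (0 : Fin n → ℝ) δ,
          dist t t' ≤ 2 * dist (shiftedProd n G (s, t)) (shiftedProd n G (s, t'))) := by
  obtain ⟨r, hr, hr1⟩ := Metric.eventually_nhds_iff_ball.1 (contMDiffAt_coordMap (n := n) (G := G))
  refine ⟨r, hr, ?_⟩
  have hcd := contDiffAt_shiftedProd (n := n) (G := G)
  have h0 : shiftedProd n G 0 = 0 := by simp [shiftedProd]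
  have e1 : ∀ᶠ q in nhds (0 : (Fin n → ℝ) × (Fin n → ℝ)), shiftedProd n G q ∈ Metric.ball 0 r := by
    refine hcd.continuousAt.eventually_mem ?_
    rw [h0]
    exact Metric.ball_mem_nhds _ hr
  have e2 : ∀ᶠ q in nhds (0 : (Fin n → ℝ) × (Fin n → ℝ)),
      coordMap n G q.1 * coordMap n G (shiftedProd n G q) = axisProd n G q.2 := by
    have hc : Filter.Tendsto (fun q : (Fin n → ℝ) × (Fin n → ℝ) =>
        (coordMap n G q.1)⁻¹ * axisProd n G q.2) (nhds 0) (nhds 1) := by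
      have c1 : ContinuousAt (fun q : (Fin n → ℝ) × (Fin n → ℝ) => coordMap n G q.1) 0 :=
        ContinuousAt.comp (g := coordMap n G) (f := Prod.fst)
          contMDiffAt_coordMap.self_of_nhds.continuousAt continuousAt_fst
      have c2 : ContinuousAt (fun q : (Fin n → ℝ) × (Fin n → ℝ) => axisProd n G q.2) 0 :=
        ContinuousAt.comp (g := axisProd n G) (f := Prod.snd)
          contMDiffAt_axisProd.self_of_nhds.continuousAt continuousAt_snd
      have h : Filter.Tendsto (fun q : (Fin n → ℝ) × (Fin n → ℝ) =>
        (coordMap n G q.1)⁻¹ * axisProd n G q.2) (nhds 0) _ := (c1.inv.mul c2).tendsto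
      simpa using h
    filter_upwards [hc.eventually (eventually_coordMap_coordInv (n := n) (G := G))] with q hq
    unfold shiftedProd
    rw [hq]
    simp
  have hst := hcd.hasStrictFDerivAt (by simp)
  -- An error of at most half of `‖t - t'‖` against the identity leaves `‖t - t'‖ ≤ 2 ‖difference of
  -- the values‖`.
  obtain ⟨s, hs, hsa⟩ := hst.approximates_deriv_on_nhds (c := 1 / 2) (Or.inr (by norm_num))
  obtain ⟨δ, hδ, hδ1⟩ := Metric.eventually_nhds_iff_ball.1 (e1.and (e2.and hs))
  have hmem : ∀ s ∈ Metric.ball (0 : Fin n → ℝ) δ, ∀ t ∈ Metric.ball (0 : Fin n → ℝ) δ,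
      (s, t) ∈ Metric.ball (0 : (Fin n → ℝ) × (Fin n → ℝ)) δ := fun s hs t ht => by
    rw [Metric.mem_ball] at *
    exact (Prod.dist_eq ..).trans_lt (max_lt hs ht)
  refine ⟨δ, hδ, fun t ht => (hr1 t ht).continuousAt.continuousWithinAt, fun s hs t ht => ?_⟩
  obtain ⟨m1, m2, m3⟩ := hδ1 _ (hmem s hs t ht)
  refine ⟨m1, m2, fun t' ht' => ?_⟩
  have h1 := hsa _ m3 _ (hδ1 _ (hmem s hs t' ht')).2.2
  have h2 : ((s, t) - (s, t') : (Fin n → ℝ) × (Fin n → ℝ)) = (0, t - t') := by simp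
  rw [h2, fderiv_shiftedProd] at h1
  have h3 : ‖((0 : Fin n → ℝ), t - t')‖ = ‖t - t'‖ := by simp [Prod.norm_def]
  rw [h3] at h1
  have h4 := norm_sub_norm_le (t - t') (shiftedProd n G (s, t) - shiftedProd n G (s, t'))
  rw [norm_sub_rev _ (t - t')] at h1
  rw [dist_eq_norm, dist_eq_norm]
  norm_num at h1
  linarith [norm_nonneg (t - t')]

variable (μ : Measure (LeftQuotient Γ)) [IsProbabilityMeasure μ] [IsRightInvariant μ]

-- Let `N y` be the volume of the small coordinates `q` with `y · coordMap q ∈ A`. By Fubini and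
-- invariance, `∫ N dμ` is a constant times `μ A`. For all `y` in `x · coordMap (ball 0 δ)`, a set
-- of measure at least `c`, the volume to be estimated is at most `2ⁿ N y`; Markov's inequality
-- concludes. No Haar measure on `G` enters.
variable (n) in
lemma exists_volume_axisProd_le :
    ∃ ε > 0, ContinuousOn (axisProd n G) (Metric.ball 0 ε) ∧
      ∃ C : ENNReal, C ≠ ⊤ ∧ ∀ (x : LeftQuotient Γ) (A : Set (LeftQuotient Γ)), MeasurableSet A →
      volume (Metric.ball (0 : Fin n → ℝ) ε ∩ {t | rightTranslate (axisProd n G t) x ∈ A}) ≤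
        C * μ A := by
  classical
  obtain ⟨r, hr, δ, hδ, hcont, hb⟩ := exists_shiftedProd_bounds n G
  have : SecondCountableTopology (LeftQuotient Γ) := secondCountable_leftQuotient
  borelize G
  have hU : coordMap n G '' Metric.ball 0 δ ∈ nhds (1 : G) := by
    have h1 : ∀ᶠ g in nhds (1 : G), coordInv g ∈ Metric.ball (0 : Fin n → ℝ) δ := by
      refine (contMDiffAt_coordInv (n := n) (G := G)).self_of_nhds.continuousAt.eventually_mem ?_
      rw [coordInv_one]
      exact Metric.ball_mem_nhds _ hδ
    filter_upwards [h1, eventually_coordMap_coordInv (n := n) (G := G)] with g h1 h2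
    exact ⟨_, h1, h2⟩
  obtain ⟨c, hc0, hc⟩ := exists_le_measure_orbit μ hU
  have hc1 : c ≠ ⊤ := by
    intro h
    obtain ⟨x, -⟩ := proj_surjective (Γ := Γ) (proj Γ 1) |>.imp fun _ _ => trivial
    have := (hc (proj Γ 1)).trans prob_le_one
    rw [h] at this
    simp at this
  obtain ⟨ε, hε, hεδ, hεc⟩ : ∃ ε > 0, ε ≤ δ ∧ ContinuousOn (axisProd n G) (Metric.ball 0 ε) := by
    obtain ⟨ε, hε, h⟩ := Metric.eventually_nhds_iff_ball.1 (contMDiffAt_axisProd (n := n) (G := G))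
    exact ⟨min ε δ, by positivity, min_le_right _ _, fun t ht =>
      (h t (Metric.ball_subset_ball (min_le_left _ _) ht)).continuousAt.continuousWithinAt⟩
  refine ⟨ε, hε, hεc, c⁻¹ * (2 ^ n * volume (Metric.ball (0 : Fin n → ℝ) r)), ?_, fun x A hA => ?_⟩
  · exact ENNReal.mul_ne_top (ENNReal.inv_ne_top.2 hc0)
      (ENNReal.mul_ne_top (by simp) measure_ball_lt_top.ne)
  set S := Metric.ball (0 : Fin n → ℝ) ε ∩ {t | rightTranslate (axisProd n G t) x ∈ A} with hS
  -- Continuity of `coordMap` is available only on the ball; the constant `1` outside makes the map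
  -- measurable everywhere.
  let Φ : (Fin n → ℝ) → G := (Metric.ball 0 r).piecewise (coordMap n G) fun _ => 1
  have hΦ : Measurable Φ := by
    classical
    exact hcont.measurable_piecewise (g := fun _ => 1) continuousOn_const
      measurableSet_ball
  let T : Set (LeftQuotient Γ × (Fin n → ℝ)) :=
    {q | q.2 ∈ Metric.ball 0 r ∧ rightTranslate (Φ q.2) q.1 ∈ A}
  have hT : MeasurableSet T := by
    have h1 : Measurable fun q : LeftQuotient Γ × (Fin n → ℝ) => rightTranslate (Φ q.2) q.1 :=
      continuous_rightTranslate_prod.measurable.comp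
        ((hΦ.comp measurable_snd).prodMk measurable_fst)
    exact (measurable_snd measurableSet_ball).inter (h1 hA)
  let N : LeftQuotient Γ → ENNReal := fun y => volume (Prod.mk y ⁻¹' T)
  have hN : ∫⁻ y, N y ∂μ = volume (Metric.ball (0 : Fin n → ℝ) r) * μ A := by
    have h1 := Measure.prod_apply (μ := μ) (ν := (volume : Measure (Fin n → ℝ))) hT
    have h2 := Measure.prod_apply_symm (μ := μ) (ν := (volume : Measure (Fin n → ℝ))) hT
    change ∫⁻ y, volume (Prod.mk y ⁻¹' T) ∂μ = _
    rw [← h1, h2]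
    have h3 : ∀ q : Fin n → ℝ, μ ((fun y => (y, q)) ⁻¹' T) =
        (Metric.ball (0 : Fin n → ℝ) r).indicator (fun _ => μ A) q := by
      intro q
      by_cases hq : q ∈ Metric.ball (0 : Fin n → ℝ) r
      · rw [Set.indicator_of_mem hq]
        rw [← (measurePreserving_rightTranslate μ (Φ q)).measure_preimage hA.nullMeasurableSet]
        congr 1
        ext y
        simp only [T, Set.mem_preimage, Set.mem_ofPred]
        exact ⟨fun h => h.2, fun h => ⟨hq, h⟩⟩
      · rw [Set.indicator_of_notMem hq]
        convert measure_empty (μ := μ)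
        ext y
        simp only [T, Set.mem_preimage, Set.mem_ofPred, Set.mem_empty_iff_false, iff_false]
        exact fun h => hq h.1
    simp_rw [h3]
    rw [lintegral_indicator measurableSet_ball, lintegral_const, Measure.restrict_apply_univ, mul_comm]
  -- Seen from `y = x · coordMap s`, the point `x · axisProd t` has the coordinates `shiftedProd (s,
  -- t)`.
  have hSN : ∀ y ∈ (fun g => rightTranslate g x) '' (coordMap n G '' Metric.ball 0 δ),
      volume S ≤ 2 ^ n * N y := by
    rintro _ ⟨_, ⟨s, hs, rfl⟩, rfl⟩
    have h1 : volume S ≤ ((2 : NNReal) : ENNReal) ^ n *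
        volume ((fun t => shiftedProd n G (s, t)) '' S) := by
      refine volume_le_of_antilipschitzOn fun t ht t' ht' => ?_
      exact (hb s hs t (Metric.ball_subset_ball hεδ ht.1)).2.2 t' (Metric.ball_subset_ball hεδ ht'.1)
    refine h1.trans (mul_le_mul_right (measure_mono ?_) _)
    rintro _ ⟨t, ht, rfl⟩
    obtain ⟨m1, m2, -⟩ := hb s hs t (Metric.ball_subset_ball hεδ ht.1)
    refine ⟨m1, ?_⟩
    have h2 : Φ (shiftedProd n G (s, t)) = coordMap n G (shiftedProd n G (s, t)) := Set.piecewise_eq_of_mem _ _ _ m1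
    change rightTranslate (Φ (shiftedProd n G (s, t))) _ ∈ A
    rw [h2, rightTranslate_mul, m2]
    exact ht.2
  have hfin : c * volume S ≤ 2 ^ n * (volume (Metric.ball (0 : Fin n → ℝ) r) * μ A) := by
    calc c * volume S ≤ μ ((fun g => rightTranslate g x) '' (coordMap n G '' Metric.ball 0 δ)) *
          volume S := mul_le_mul_left (hc x) _
      _ ≤ μ {y | volume S ≤ 2 ^ n * N y} * volume S :=
          mul_le_mul_left (measure_mono hSN) _
      _ = volume S * μ {y | volume S ≤ 2 ^ n * N y} := mul_comm _ _
      _ ≤ ∫⁻ y, 2 ^ n * N y ∂μ := mul_meas_ge_le_lintegral₀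
          ((measurable_measure_prodMk_left hT).const_mul _).aemeasurable _
      _ = _ := by rw [lintegral_const_mul _ (measurable_measure_prodMk_left hT), hN]
  calc volume S = c⁻¹ * (c * volume S) := by rw [← mul_assoc, ENNReal.inv_mul_cancel hc0 hc1, one_mul]
    _ ≤ c⁻¹ * (2 ^ n * (volume (Metric.ball (0 : Fin n → ℝ) r) * μ A)) := mul_le_mul_right hfin _
    _ = _ := by ring

end Domination

/-! ### Derivatives in coordinates through left invariant fields. -/

section Frame

variable {n : ℕ} {G : Type u} [TopologicalSpace G] [ChartedSpace (EuclideanSpace ℝ (Fin n)) G]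
  [Group G] [LieGroup (𝓡 n) ∞ G]
  {F' : Type*} [NormedAddCommGroup F'] [NormedSpace ℝ F']

/-- The derivatives of `F` along left invariant fields, as a linear function of the field. -/
def lieDerivL (F : G → F') (g : G) : EuclideanSpace ℝ (Fin n) →L[ℝ] F' :=
  mfderiv (𝓡 n) 𝓘(ℝ, F') (fun h => F (g * h)) 1

lemma lieDeriv_translate (ξ : GroupLieAlgebra (𝓡 n) G) (F : G → F') (a g : G) :
    lieDeriv ξ (fun h => F (a * h)) g = lieDeriv ξ F (a * g) := by
  have h : (fun h => F (a * (g * h))) = fun h => F (a * g * h) := by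
    funext h
    rw [mul_assoc]
  unfold lieDeriv
  rw [h]
  rfl

variable (n G) in
/-- The standard basis of the Lie algebra. -/
def stdVec (j : Fin n) : GroupLieAlgebra (𝓡 n) G := (EuclideanSpace.single j (1 : ℝ) :)

lemma lieDerivL_eq_sum (F : G → F') (g : G) (ξ : EuclideanSpace ℝ (Fin n)) :
    lieDerivL F g ξ = ∑ j, ξ j • lieDeriv (stdVec n G j) F g := by
  have h : ξ = ∑ j, ξ j • (EuclideanSpace.single j (1 : ℝ)) := by
    ext i
    simp [Pi.single_apply]
  conv_lhs => rw [h]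
  simp only [map_sum, map_smul]
  rfl

variable (n G) in
/-- The quotient `coordMap t ⁻¹ * coordMap s` in coordinates. -/
def coordDiv (q : (Fin n → ℝ) × (Fin n → ℝ)) : Fin n → ℝ :=
  coordInv ((coordMap n G q.1)⁻¹ * coordMap n G q.2)

variable (n G) in
/-- The Maurer–Cartan form in coordinates. -/
def mcForm (t : Fin n → ℝ) : (Fin n → ℝ) →L[ℝ] EuclideanSpace ℝ (Fin n) :=
  (mfderiv 𝓘(ℝ, Fin n → ℝ) (𝓡 n) (coordMap n G) 0 :
    (Fin n → ℝ) →L[ℝ] EuclideanSpace ℝ (Fin n)).comp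
    ((fderiv ℝ (coordDiv n G) (t, t)).comp (ContinuousLinearMap.inr ℝ _ _))

variable [IsTopologicalGroup G]

lemma contDiffAt_coordDiv_of {t : Fin n → ℝ}
    (ht : ContMDiffAt 𝓘(ℝ, Fin n → ℝ) (𝓡 n) ∞ (coordMap n G) t) :
    ContDiffAt ℝ ∞ (coordDiv n G) (t, t) := by
  rw [← contMDiffAt_iff_contDiffAt]
  have h1 : ContMDiffAt 𝓘(ℝ, (Fin n → ℝ) × (Fin n → ℝ)) (𝓡 n) ∞
      (fun q : (Fin n → ℝ) × (Fin n → ℝ) => coordMap n G q.1) (t, t) :=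
    ContMDiffAt.comp (g := coordMap n G) (f := Prod.fst) ((t, t) : (Fin n → ℝ) × (Fin n → ℝ))
      ht contDiff_fst.contMDiff.contMDiffAt
  have h2 : ContMDiffAt 𝓘(ℝ, (Fin n → ℝ) × (Fin n → ℝ)) (𝓡 n) ∞
      (fun q : (Fin n → ℝ) × (Fin n → ℝ) => coordMap n G q.2) (t, t) :=
    ContMDiffAt.comp (g := coordMap n G) (f := Prod.snd) ((t, t) : (Fin n → ℝ) × (Fin n → ℝ))
      ht contDiff_snd.contMDiff.contMDiffAt
  refine ContMDiffAt.comp (g := (coordInv : G → Fin n → ℝ))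
    (f := fun q : (Fin n → ℝ) × (Fin n → ℝ) => (coordMap n G q.1)⁻¹ * coordMap n G q.2) _ ?_
    (h1.inv.mul h2)
  simpa using contMDiffAt_coordInv.self_of_nhds

lemma contDiffAt_mcForm {t : Fin n → ℝ}
    (ht : ContMDiffAt 𝓘(ℝ, Fin n → ℝ) (𝓡 n) ∞ (coordMap n G) t) :
    ContDiffAt ℝ ∞ (mcForm n G) t := by
  have h1 : ContDiffAt ℝ ∞ (fderiv ℝ (coordDiv n G)) (t, t) :=
    (contDiffAt_coordDiv_of ht).fderiv_right (by simp)
  have h2 : ContDiffAt ℝ ∞ (fun t : Fin n → ℝ => fderiv ℝ (coordDiv n G) (t, t)) t :=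
    ContDiffAt.comp (f := fun t : Fin n → ℝ => (t, t)) t h1 (by fun_prop)
  unfold mcForm
  exact contDiffAt_const.clm_comp (h2.clm_comp contDiffAt_const)

/-- Near `t` one has `coordMap s = coordMap t * coordMap (coordDiv (t, s))`. Only the right factor
varies, near the identity, where differentiation gives left invariant derivatives. -/
lemma hasFDerivAt_comp_coordMap {u : G → F'} (hu : ContMDiff (𝓡 n) 𝓘(ℝ, F') ∞ u) {t : Fin n → ℝ}
    (ht : ContMDiffAt 𝓘(ℝ, Fin n → ℝ) (𝓡 n) ∞ (coordMap n G) t) :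
    HasFDerivAt (fun s => u (coordMap n G s))
      ((lieDerivL u (coordMap n G t)).comp (mcForm n G t)) t := by
  have h0 : coordDiv n G (t, t) = 0 := by simp [coordDiv]
  have e : (fun s => u (coordMap n G s)) =ᶠ[nhds t]
      fun s => u (coordMap n G t * coordMap n G (coordDiv n G (t, s))) := by
    have hc : Filter.Tendsto (fun s => (coordMap n G t)⁻¹ * coordMap n G s) (nhds t) (nhds 1) := by
      have : Filter.Tendsto (fun s => (coordMap n G t)⁻¹ * coordMap n G s) (nhds t) _ :=
        (continuousAt_const.mul ht.continuousAt).tendsto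
      simpa using this
    filter_upwards [hc.eventually (eventually_coordMap_coordInv (n := n))] with s hs
    unfold coordDiv
    rw [hs, mul_inv_cancel_left]
  have h1 : HasFDerivAt (fun s => coordDiv n G (t, s))
      ((fderiv ℝ (coordDiv n G) (t, t)).comp (ContinuousLinearMap.inr ℝ _ _)) t := by
    have := ((contDiffAt_coordDiv_of ht).differentiableAt (by simp)).hasFDerivAt
    exact this.comp t (hasFDerivAt_prodMk_right t t)
  have h2 : HasFDerivAt (fun r => u (coordMap n G t * coordMap n G r))
      ((lieDerivL u (coordMap n G t)).comp
        (mfderiv 𝓘(ℝ, Fin n → ℝ) (𝓡 n) (coordMap n G) 0 :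
          (Fin n → ℝ) →L[ℝ] EuclideanSpace ℝ (Fin n))) 0 := by
    have a1 := (mdifferentiableAt_translate hu (coordMap n G t)).hasMFDerivAt
    rw [← coordMap_zero (n := n) (G := G)] at a1
    have a2 := (contMDiffAt_coordMap (n := n) (G := G)).self_of_nhds.mdifferentiableAt
      (by simp) |>.hasMFDerivAt
    have a3 := a1.comp (0 : Fin n → ℝ) a2
    have a4 := hasMFDerivAt_iff_hasFDerivAt.1 a3
    have a5 : ∀ x : G, x = 1 → (mfderiv (𝓡 n) 𝓘(ℝ, F') (fun h => u (coordMap n G t * h)) x :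
        EuclideanSpace ℝ (Fin n) →L[ℝ] F') = lieDerivL u (coordMap n G t) := by
      rintro _ rfl; rfl
    rw [← a5 _ (coordMap_zero (n := n) (G := G))]
    exact a4
  have h2' : HasFDerivAt (fun r => u (coordMap n G t * coordMap n G r))
      ((lieDerivL u (coordMap n G t)).comp
        (mfderiv 𝓘(ℝ, Fin n → ℝ) (𝓡 n) (coordMap n G) 0 :
          (Fin n → ℝ) →L[ℝ] EuclideanSpace ℝ (Fin n))) (coordDiv n G (t, t)) := by
    rw [h0]
    exact h2
  have h3 := (h2'.comp t h1).congr_of_eventuallyEq e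
  exact h3

variable (n G) in
/-- The velocity of the curves along the axes, moved to the identity. -/
def axisVel (i : Fin n) (s : ℝ) : EuclideanSpace ℝ (Fin n) :=
  mcForm n G (Pi.single i s) (Pi.single i 1)

lemma hasDerivAt_single (i : Fin n) (s : ℝ) :
    HasDerivAt (fun s : ℝ => (Pi.single i s : Fin n → ℝ)) (Pi.single i 1) s := by
  have h1 : (fun s : ℝ => (Pi.single i s : Fin n → ℝ)) =
      fun s : ℝ => s • (Pi.single i 1 : Fin n → ℝ) := by
    funext s
    simp [← Pi.single_smul']
  rw [h1]
  simpa using (hasDerivAt_id s).smul_const (Pi.single i 1 : Fin n → ℝ)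

-- The target `F'` is quantified after `ε`, so that one `ε` serves all functions. The use is for
-- orbit maps into `Lp ℂ 2 μ`, which lives in the universe of `G`.
variable (n) in
lemma exists_axisCurve_bounds (G : Type u) [TopologicalSpace G]
    [ChartedSpace (EuclideanSpace ℝ (Fin n)) G] [Group G] [LieGroup (𝓡 n) ∞ G]
    [IsTopologicalGroup G] : ∃ ε > 0, ∀ i : Fin n, ∀ s ∈ Metric.ball (0 : ℝ) ε,
      ContinuousAt (axisCurve n G i) s ∧ ContinuousAt (axisVel n G i) s ∧
      ∀ (F' : Type u) [NormedAddCommGroup F'] [NormedSpace ℝ F'] (u : G → F'),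
        ContMDiff (𝓡 n) 𝓘(ℝ, F') ∞ u →
        HasDerivAt (fun s => u (axisCurve n G i s))
          (lieDerivL u (axisCurve n G i s) (axisVel n G i s)) s := by
  obtain ⟨r, hr, h⟩ := Metric.eventually_nhds_iff_ball.1 (contMDiffAt_coordMap (n := n) (G := G))
  refine ⟨r, hr, fun i s hs => ?_⟩
  have hs' : (Pi.single i s : Fin n → ℝ) ∈ Metric.ball 0 r := by
    rw [mem_ball_zero_iff] at hs ⊢
    refine (pi_norm_lt_iff hr).2 fun j => ?_
    by_cases hj : j = i
    · subst hj; simpa using hs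
    · simpa [hj] using hr
  have ht := h _ hs'
  have hc := (hasDerivAt_single i s).continuousAt
  refine ⟨ContinuousAt.comp (g := coordMap n G) ht.continuousAt hc, ?_, fun F' _ _ u hu => ?_⟩
  · have h1 : ContinuousAt (fun s : ℝ => mcForm n G (Pi.single i s)) s :=
      ContinuousAt.comp (g := mcForm n G) (contDiffAt_mcForm ht).continuousAt hc
    exact h1.clm_apply continuousAt_const
  · exact (hasFDerivAt_comp_coordMap hu ht).comp_hasDerivAt s (hasDerivAt_single i s)

end Frame

/-! ### Orbits of smooth functions are smooth maps into `C(X)`. -/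

section OrbitMap

/-- By the mean value inequality, the first order error at each point `x` is bounded by the
oscillation of `D` near `t` in operator norm. This bound is uniform in `x`, which turns pointwise
derivatives into a Fréchet derivative for the sup norm. -/
lemma hasFDerivAt_of_forall_eval {X W : Type*} [TopologicalSpace X] [CompactSpace X]
    [NormedAddCommGroup W] [NormedSpace ℝ W] {u : W → C(X, ℂ)} {D : W → W →L[ℝ] C(X, ℂ)} {t : W}
    (hD : ContinuousAt D t)
    (h : ∀ᶠ s in nhds t, ∀ x, HasFDerivAt (fun s => u s x)
      (((ContinuousMap.evalCLM ℂ x).restrictScalars ℝ).comp (D s)) s) :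
    HasFDerivAt u (D t) t := by
  rw [hasFDerivAt_iff_isLittleO, Asymptotics.isLittleO_iff]
  intro c hc
  have h1 : ∀ᶠ s in nhds t, ‖D s - D t‖ ≤ c := by
    filter_upwards [Metric.continuousAt_iff'.1 hD c hc] with s hs
    rw [← dist_eq_norm]
    exact hs.le
  obtain ⟨r, hr, hb⟩ := Metric.eventually_nhds_iff_ball.1 (h.and h1)
  filter_upwards [Metric.ball_mem_nhds t hr] with s hs
  rw [ContinuousMap.norm_le _ (by positivity)]
  intro x
  refine (convex_ball t r).norm_image_sub_le_of_norm_hasFDerivWithin_le'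
    (f := fun s => u s x) (f' := fun s => ((ContinuousMap.evalCLM ℂ x).restrictScalars ℝ).comp (D s))
    (φ := ((ContinuousMap.evalCLM ℂ x).restrictScalars ℝ).comp (D t))
    (fun z hz => ((hb z hz).1 x).hasFDerivWithinAt) (fun z hz => ?_) (Metric.mem_ball_self hr) hs
  refine ContinuousLinearMap.opNorm_le_bound _ hc.le fun w => ?_
  calc ‖(D z w) x - (D t w) x‖ = ‖((D z - D t) w) x‖ := rfl
    _ ≤ ‖(D z - D t) w‖ := ContinuousMap.norm_coe_le_norm _ _
    _ ≤ c * ‖w‖ := (D z - D t).le_of_opNorm_le (hb z hz).2 w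

variable {n : ℕ} {G : Type u} [TopologicalSpace G] [ChartedSpace (EuclideanSpace ℝ (Fin n)) G]
  [Group G] [LieGroup (𝓡 n) ∞ G] [IsTopologicalGroup G] {Γ : Subgroup G}
  [CompactSpace (LeftQuotient Γ)]

/-- The orbit of a smooth function under right translation. -/
def orbitC (f : SmoothFun n Γ) (g : G) : C(LeftQuotient Γ, ℂ) :=
  translateC Γ g (toContinuousMap Γ f)

lemma continuous_orbitC (f : SmoothFun n Γ) : Continuous (orbitC f) := continuous_translateC _

lemma contMDiff_mul_proj (f : SmoothFun n Γ) (a : G) :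
    ContMDiff (𝓡 n) 𝓘(ℝ, ℂ) ∞ fun h => f (proj Γ (a * h)) :=
  f.contMDiff.comp (contMDiff_mul_left (I := 𝓡 n) (n := ∞) (a := a))

/-- The derivative of the orbit map in coordinates. -/
def orbitDeriv (f : SmoothFun n Γ) (t : Fin n → ℝ) : (Fin n → ℝ) →L[ℝ] C(LeftQuotient Γ, ℂ) :=
  ∑ j, ((EuclideanSpace.proj j : EuclideanSpace ℝ (Fin n) →L[ℝ] ℝ).comp (mcForm n G t)).smulRight
    (orbitC (smoothDeriv (stdVec n G j) f) (coordMap n G t))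

lemma hasFDerivAt_orbitC (f : SmoothFun n Γ) {r : ℝ}
    (hr : ∀ t ∈ Metric.ball (0 : Fin n → ℝ) r,
      ContMDiffAt 𝓘(ℝ, Fin n → ℝ) (𝓡 n) ∞ (coordMap n G) t) {t : Fin n → ℝ}
    (ht : t ∈ Metric.ball 0 r) :
    HasFDerivAt (fun s => orbitC f (coordMap n G s)) (orbitDeriv f t) t := by
  refine hasFDerivAt_of_forall_eval ?_ ?_
  · unfold orbitDeriv
    refine tendsto_finsetSum _ fun j _ => ?_
    have h1 : ContinuousAt (fun t => (EuclideanSpace.proj j : EuclideanSpace ℝ (Fin n) →L[ℝ] ℝ).comp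
        (mcForm n G t)) t := continuousAt_const.clm_comp (contDiffAt_mcForm (hr t ht)).continuousAt
    have h2 : ContinuousAt (fun t => orbitC (smoothDeriv (stdVec n G j) f) (coordMap n G t)) t :=
      (continuous_orbitC _).continuousAt.comp (hr t ht).continuousAt
    exact ((ContinuousLinearMap.smulRightL ℝ (Fin n → ℝ) C(LeftQuotient Γ, ℂ)).continuous.continuousAt.comp
      h1).clm_apply h2
  · filter_upwards [Metric.isOpen_ball.mem_nhds ht] with s hs x
    obtain ⟨a, rfl⟩ := proj_surjective x
    have h := hasFDerivAt_comp_coordMap (contMDiff_mul_proj f a) (hr s hs)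
    refine HasFDerivAt.congr_fderiv h ?_
    ext1 w
    rw [ContinuousLinearMap.comp_apply, lieDerivL_eq_sum]
    simp only [lieDeriv_translate _ (fun h => f (proj Γ h))]
    simp [orbitDeriv, orbitC, rightTranslate_proj]
    rfl

/-- The derivative of the orbit of `f` combines, with smooth coefficients from `mcForm`, the orbits
of the derivatives of `f` along a basis. Induction on `k` for all `f` at once therefore gains one
order at each step. -/
lemma contDiffOn_orbitC {r : ℝ} (hr : ∀ t ∈ Metric.ball (0 : Fin n → ℝ) r,
      ContMDiffAt 𝓘(ℝ, Fin n → ℝ) (𝓡 n) ∞ (coordMap n G) t) (k : ℕ) :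
    ∀ f : SmoothFun n Γ, ContDiffOn ℝ k (fun s => orbitC f (coordMap n G s)) (Metric.ball 0 r) := by
  induction k with
  | zero =>
    intro f
    rw [Nat.cast_zero, contDiffOn_zero]
    exact fun t ht => (hasFDerivAt_orbitC f hr ht).continuousAt.continuousWithinAt
  | succ k ih =>
    intro f
    rw [Nat.cast_succ, contDiffOn_succ_iff_fderiv_of_isOpen Metric.isOpen_ball]
    refine ⟨fun t ht => (hasFDerivAt_orbitC f hr ht).differentiableAt.differentiableWithinAt,
      by simp, ?_⟩
    refine ContDiffOn.congr (f := orbitDeriv f) ?_ fun t ht => (hasFDerivAt_orbitC f hr ht).fderiv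
    unfold orbitDeriv
    refine ContDiffOn.sum fun j _ => ?_
    have h1 : ContDiffOn ℝ k (fun t => (EuclideanSpace.proj j : EuclideanSpace ℝ (Fin n) →L[ℝ] ℝ).comp
        (mcForm n G t)) (Metric.ball 0 r) := fun t ht =>
      (contDiffAt_const.clm_comp ((contDiffAt_mcForm (hr t ht)).of_le
        (by exact_mod_cast le_top))).contDiffWithinAt
    exact ((ContinuousLinearMap.smulRightL ℝ (Fin n → ℝ) C(LeftQuotient Γ, ℂ)).contDiff.comp_contDiffOn
      h1).clm_apply (ih _)

/-- Coordinates give smoothness near `1`. At `g` it follows from `orbitC f h = R_g (orbitC f (g⁻¹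
h))`, as `R_g` is a bounded operator. -/
lemma contMDiff_orbitC (f : SmoothFun n Γ) :
    ContMDiff (𝓡 n) 𝓘(ℝ, C(LeftQuotient Γ, ℂ)) ∞ (orbitC f) := by
  have h1 : ContMDiffAt (𝓡 n) 𝓘(ℝ, C(LeftQuotient Γ, ℂ)) ∞ (orbitC f) 1 := by
    obtain ⟨r, hr, h⟩ := Metric.eventually_nhds_iff_ball.1 (contMDiffAt_coordMap (n := n) (G := G))
    have h2 : ContDiffAt ℝ ∞ (fun s => orbitC f (coordMap n G s)) 0 :=
      (contDiffOn_infty.2 fun k => contDiffOn_orbitC h k f).contDiffAt (Metric.ball_mem_nhds _ hr)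
    have h3 := h2.contMDiffAt
    rw [← coordInv_one (n := n) (G := G)] at h3
    refine (ContMDiffAt.comp (1 : G) h3 contMDiffAt_coordInv.self_of_nhds).congr_of_eventuallyEq ?_
    filter_upwards [eventually_coordMap_coordInv (n := n) (G := G)] with g hg
    simp only [Function.comp_apply, hg]
  intro g
  have h2 : orbitC f = fun h => (translateCL Γ g).restrictScalars ℝ (orbitC f (g⁻¹ * h)) := by
    funext h
    simp [orbitC, translateC_mul]
  rw [h2]
  refine ((translateCL Γ g).restrictScalars ℝ).contMDiff.contMDiffAt.comp g ?_
  rw [← inv_mul_cancel g] at h1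
  exact h1.comp g (contMDiff_mul_left (I := 𝓡 n) (n := ∞)).contMDiffAt

lemma lieDeriv_orbitC (ξ : GroupLieAlgebra (𝓡 n) G) (f : SmoothFun n Γ) (g : G) :
    lieDeriv ξ (orbitC f) g = orbitC (smoothDeriv ξ f) g := by
  ext x
  obtain ⟨a, rfl⟩ := proj_surjective x
  have h := lieDeriv_clm ((ContinuousMap.evalCLM ℂ (proj Γ a)).restrictScalars ℝ) ξ
    (contMDiff_orbitC f) g
  refine h.symm.trans ?_
  exact lieDeriv_translate ξ (fun h => f (proj Γ h)) a g

end OrbitMap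

/-! ### Averages of strongly continuous families of contractions. -/

section Average

variable {V W : Type*} [NormedAddCommGroup V] [NormedSpace ℝ V] [NormedSpace ℂ V]
  [IsScalarTower ℝ ℂ V] [CompleteSpace V]
  [NormedAddCommGroup W] [NormedSpace ℝ W] [NormedSpace ℂ W] [IsScalarTower ℝ ℂ W] [CompleteSpace W]

/-- The average `∫₀^ε k(t) A(t) v dt` of a strongly continuous family of contractions. -/
def avgOp (A : ℝ → V →L[ℂ] V) (k : ℝ → ℝ) (ε : ℝ) (hA : ∀ v, Continuous fun t => A t v)
    (h1 : ∀ t v, ‖A t v‖ ≤ ‖v‖) (hk : Continuous k) : V →L[ℂ] V :=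
  LinearMap.mkContinuous
    { toFun := fun v => ∫ t in (0 : ℝ)..ε, k t • A t v
      map_add' := fun v w => by
        simp only [map_add, smul_add]
        exact intervalIntegral.integral_add ((hk.smul (hA v)).intervalIntegrable _ _)
          ((hk.smul (hA w)).intervalIntegrable _ _)
      map_smul' := fun c v => by
        simp only [map_smul, RingHom.id_apply, smul_comm _ c]
        exact intervalIntegral.integral_smul c _ }
    (abs (∫ t in (0 : ℝ)..ε, abs (k t))) fun v => by
      have h2 : ∀ t, ‖k t • A t v‖ ≤ |k t| * ‖v‖ := fun t => by
        rw [norm_smul, Real.norm_eq_abs]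
        exact mul_le_mul_of_nonneg_left (h1 t v) (abs_nonneg _)
      refine (intervalIntegral.norm_integral_le_abs_of_norm_le
        (Filter.Eventually.of_forall fun t => h2 t)
        ((hk.abs.mul continuous_const).intervalIntegrable _ _)).trans ?_
      rw [intervalIntegral.integral_mul_const, abs_mul, abs_norm]

lemma avgOp_apply (A : ℝ → V →L[ℂ] V) (k : ℝ → ℝ) (ε : ℝ) (hA : ∀ v, Continuous fun t => A t v)
    (h1 : ∀ t v, ‖A t v‖ ≤ ‖v‖) (hk : Continuous k) (v : V) :
    avgOp A k ε hA h1 hk v = ∫ t in (0 : ℝ)..ε, k t • A t v := rfl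

lemma avgOp_intertwine (A : ℝ → V →L[ℂ] V) (B : ℝ → W →L[ℂ] W) (T : V →L[ℂ] W)
    (hT : ∀ t v, T (A t v) = B t (T v)) (k : ℝ → ℝ) (ε : ℝ)
    (hA : ∀ v, Continuous fun t => A t v) (h1 : ∀ t v, ‖A t v‖ ≤ ‖v‖)
    (hB : ∀ v, Continuous fun t => B t v) (h2 : ∀ t v, ‖B t v‖ ≤ ‖v‖) (hk : Continuous k) (v : V) :
    T (avgOp A k ε hA h1 hk v) = avgOp B k ε hB h2 hk (T v) := by
  rw [avgOp_apply, avgOp_apply]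
  have hi : Continuous fun t => k t • A t v := hk.smul (hA v)
  have := (T.restrictScalars ℝ).intervalIntegral_comp_comm
    (hi.intervalIntegrable (μ := volume) 0 ε)
  refine this.symm.trans ?_
  congr 1
  funext t
  simp [hT]

/-- The orthogonal projection onto `H` commutes with the integral and fixes the integrand, hence it
fixes the integral. -/
lemma intervalIntegral_mem_of_forall_mem {E : Type*} [NormedAddCommGroup E] [InnerProductSpace ℂ E]
    [NormedSpace ℝ E] [IsScalarTower ℝ ℂ E] [CompleteSpace E] {H : Submodule ℂ E}
    (hH : IsClosed (H : Set E)) {f : ℝ → E} (hf : Continuous f) (a b : ℝ) (h : ∀ t, f t ∈ H) :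
    ∫ t in a..b, f t ∈ H := by
  have : CompleteSpace H := hH.completeSpace_coe
  obtain ⟨P, hP⟩ : ∃ P : E →L[ℂ] E, ∀ v, P v = v ↔ v ∈ H :=
    ⟨H.starProjection, fun v => Submodule.starProjection_eq_self_iff⟩
  have h2 := (P.restrictScalars ℝ).intervalIntegral_comp_comm
    (hf.intervalIntegrable (μ := volume) a b)
  simp only [ContinuousLinearMap.coe_restrictScalars', (hP _).2 (h _)] at h2
  exact (hP _).1 h2.symm

end Average

/-! ### Averages along curves map `L²(X)` to `C(X)`. -/

section Smoothing

variable {n : ℕ} {G : Type u} [TopologicalSpace G] [Group G]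
  [IsTopologicalGroup G] {Γ : Subgroup G} [CompactSpace (LeftQuotient Γ)]

lemma norm_translateCL_le (g : G) (w : C(LeftQuotient Γ, ℂ)) : ‖translateCL Γ g w‖ ≤ ‖w‖ := by
  rw [ContinuousMap.norm_le _ (norm_nonneg _)]
  exact fun x => w.norm_coe_le_norm _

/-- The average of right translations along a curve, on `C(X)`. -/
def avgC (Γ : Subgroup G) [CompactSpace (LeftQuotient Γ)] {γ : ℝ → G} (hγ : Continuous γ)
    {k : ℝ → ℝ} (hk : Continuous k) (ε : ℝ) :
    C(LeftQuotient Γ, ℂ) →L[ℂ] C(LeftQuotient Γ, ℂ) :=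
  avgOp (fun t => translateCL Γ (γ t)) k ε (fun v => (continuous_translateC v).comp hγ)
    (fun _ _ => norm_translateCL_le _ _) hk

variable [T2Space (LeftQuotient Γ)] [SecondCountableTopology (LeftQuotient Γ)]
  (μ : Measure (LeftQuotient Γ)) [IsProbabilityMeasure μ] [IsRightInvariant μ]

/-- The average of right translations along a curve, on `L²(X)`. -/
def avgL {γ : ℝ → G} (hγ : Continuous γ) {k : ℝ → ℝ} (hk : Continuous k) (ε : ℝ) :
    Lp ℂ 2 μ →L[ℂ] Lp ℂ 2 μ :=
  avgOp (fun t => (regularRep μ (γ t)).toContinuousLinearMap) k ε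
    (fun v => (continuous_regularRep μ v).comp hγ)
    (fun _ _ => ((regularRep μ _).norm_map _).le) hk

lemma avgL_apply {γ : ℝ → G} (hγ : Continuous γ) {k : ℝ → ℝ} (hk : Continuous k) (ε : ℝ)
    (v : Lp ℂ 2 μ) : avgL μ hγ hk ε v = ∫ t in (0 : ℝ)..ε, k t • regularRep μ (γ t) v := rfl

lemma avgL_classC {γ : ℝ → G} (hγ : Continuous γ) {k : ℝ → ℝ} (hk : Continuous k) (ε : ℝ)
    (w : C(LeftQuotient Γ, ℂ)) : avgL μ hγ hk ε (classC μ w) = classC μ (avgC Γ hγ hk ε w) :=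
  (avgOp_intertwine _ _ (classC μ) (fun t v => (regularRep_classC μ (γ t) v).symm) k ε _ _ _ _ hk
    w).symm

lemma avgC_apply {γ : ℝ → G} (hγ : Continuous γ) {k : ℝ → ℝ} (hk : Continuous k) (ε : ℝ)
    (w : C(LeftQuotient Γ, ℂ)) (x : LeftQuotient Γ) :
    avgC Γ hγ hk ε w x = ∫ t in (0 : ℝ)..ε, k t • w (rightTranslate (γ t) x) := by
  have hi : Continuous fun t => k t • translateC Γ (γ t) w :=
    hk.smul ((continuous_translateC w).comp hγ)
  have h := ((ContinuousMap.evalCLM ℂ x).restrictScalars ℝ).intervalIntegral_comp_comm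
    (hi.intervalIntegrable (μ := volume) 0 ε)
  exact h.symm

/-- The product of the points at the times `t i` of the curves `γ i`. -/
def curveProd {m : ℕ} (γ : Fin m → ℝ → G) (t : Fin m → ℝ) : G :=
  (List.ofFn fun i => γ i (t i)).prod

lemma curveProd_cons {m : ℕ} (γ : Fin (m + 1) → ℝ → G) (s : ℝ) (t : Fin m → ℝ) :
    curveProd γ (Fin.cons s t) = γ 0 s * curveProd (fun i => γ i.succ) t := by
  simp [curveProd, List.ofFn_succ]

lemma continuous_curveProd {m : ℕ} {γ : Fin m → ℝ → G} (hγ : ∀ i, Continuous (γ i)) :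
    Continuous (curveProd γ) := by
  induction m with
  | zero => exact continuous_of_const fun _ _ => by simp [curveProd]
  | succ m ih =>
    have h : curveProd γ = fun t => γ 0 (t 0) * curveProd (fun i => γ i.succ) (fun i => t i.succ) := by
      funext t
      simp [curveProd, List.ofFn_succ]
    rw [h]
    exact ((hγ 0).comp (continuous_apply 0)).mul
      ((ih fun i => hγ i.succ).comp (continuous_pi fun i => continuous_apply _))

/-- The half open cube of side `ε` at the origin. -/
def cube (m : ℕ) (ε : ℝ) : Set (Fin m → ℝ) := Set.univ.pi fun _ => Set.Ioc 0 ε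

lemma measurableSet_cube (m : ℕ) (ε : ℝ) : MeasurableSet (cube m ε) :=
  MeasurableSet.univ_pi fun _ => measurableSet_Ioc

/-- Tonelli, with the first coordinate split off to match the recursion `curveProd_cons`. -/
lemma lintegral_cube_succ {m : ℕ} {ε : ℝ} {F : (Fin (m + 1) → ℝ) → ENNReal} (hF : Measurable F) :
    ∫⁻ t in cube (m + 1) ε, F t = ∫⁻ s in Set.Ioc 0 ε, ∫⁻ t in cube m ε, F (Fin.cons s t) := by
  have h1 := (volume_preserving_piFinSuccAbove (fun _ : Fin (m + 1) => ℝ) 0).symm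
  have h2 : Measurable fun z => (cube (m + 1) ε).indicator F
      ((MeasurableEquiv.piFinSuccAbove (fun _ : Fin (m + 1) => ℝ) 0).symm z) :=
    (hF.indicator (measurableSet_cube _ _)).comp h1.measurable
  rw [← lintegral_indicator (measurableSet_cube _ _), ← h1.lintegral_comp
    (hF.indicator (measurableSet_cube _ _)), Measure.volume_eq_prod, lintegral_prod _
    h2.aemeasurable, ← lintegral_indicator measurableSet_Ioc]
  congr 1
  funext s
  have hc : ∀ t : Fin m → ℝ, (MeasurableEquiv.piFinSuccAbove (fun _ : Fin (m + 1) => ℝ) 0).symm (s, t)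
      = Fin.cons s t := fun t => by
    simp [MeasurableEquiv.piFinSuccAbove, Fin.insertNthEquiv]
  have hmem : ∀ t : Fin m → ℝ, (Fin.cons s t : Fin (m + 1) → ℝ) ∈ cube (m + 1) ε ↔
      s ∈ Set.Ioc 0 ε ∧ t ∈ cube m ε := fun t => by
    simp only [cube, Set.mem_univ_pi]
    rw [Fin.forall_fin_succ]
    simp
  by_cases hs : s ∈ Set.Ioc 0 ε
  · rw [Set.indicator_of_mem hs, ← lintegral_indicator (measurableSet_cube _ _)]
    congr 1
    funext t
    rw [hc]
    by_cases ht : t ∈ cube m ε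
    · rw [Set.indicator_of_mem ht, Set.indicator_of_mem ((hmem t).2 ⟨hs, ht⟩)]
    · rw [Set.indicator_of_notMem ht, Set.indicator_of_notMem fun h => ht ((hmem t).1 h).2]
  · rw [Set.indicator_of_notMem hs]
    refine (lintegral_congr fun t => ?_).trans lintegral_zero
    rw [hc, Set.indicator_of_notMem fun h => hs ((hmem t).1 h).1]

/-- Operators on `L²(X)` which act on `C(X)` and are there dominated by averages of right
translations by the products of the curves `γ i`. -/
def IsDominated {m : ℕ} (γ : Fin m → ℝ → G) (ε : ℝ) (S : Lp ℂ 2 μ →L[ℂ] Lp ℂ 2 μ) : Prop :=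
  ∃ S' : C(LeftQuotient Γ, ℂ) →L[ℂ] C(LeftQuotient Γ, ℂ),
    (∀ w, S (classC μ w) = classC μ (S' w)) ∧ ∃ K : ENNReal, K ≠ ⊤ ∧ ∀ w x,
      ‖S' w x‖ₑ ≤ K * ∫⁻ t in cube m ε, ‖w (rightTranslate (curveProd γ t) x)‖ₑ

/-- Without curves the cube is one point of mass one. This starts the inductions over the number of
curves. -/
lemma isDominated_id (γ : Fin 0 → ℝ → G) (ε : ℝ) :
    IsDominated μ γ ε (ContinuousLinearMap.id ℂ _) := by
  refine ⟨ContinuousLinearMap.id ℂ _, fun _ => rfl, 1, by simp, fun w x => ?_⟩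
  have h : (volume : Measure (Fin 0 → ℝ)) (cube 0 ε) = 1 := by
    rw [cube, volume_pi_pi]
    simp
  have h2 : ∀ t, curveProd γ t = 1 := fun t => by simp [curveProd]
  simp only [h2, rightTranslate_one, lintegral_const, Measure.restrict_apply_univ, h]
  simp

/-- Averaging along `γ 0` evaluates the bound for `S` at the points `x · γ 0 s`. Tonelli merges the
two integrals, and the maximum of `|k|` on `[0, ε]` goes into the constant. -/
lemma IsDominated.avgL_comp {m : ℕ} {γ : Fin (m + 1) → ℝ → G} (hγ : ∀ i, Continuous (γ i)) {ε : ℝ}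
    (hε : 0 ≤ ε) {S : Lp ℂ 2 μ →L[ℂ] Lp ℂ 2 μ} (hS : IsDominated μ (fun i => γ i.succ) ε S)
    {k : ℝ → ℝ} (hk : Continuous k) :
    IsDominated μ γ ε ((avgL μ (hγ 0) hk ε).comp S) := by
  obtain ⟨S', hS', K, hK, hb⟩ := hS
  obtain ⟨B, hB⟩ := isCompact_Icc.exists_bound_of_continuousOn (s := Set.Icc 0 ε) hk.continuousOn
  have hB0 : 0 ≤ B := (norm_nonneg _).trans (hB 0 ⟨le_rfl, hε⟩)
  refine ⟨(avgC Γ (hγ 0) hk ε).comp S', fun w => ?_, ENNReal.ofReal B * K,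
    ENNReal.mul_ne_top ENNReal.ofReal_ne_top hK, fun w x => ?_⟩
  · simp only [ContinuousLinearMap.comp_apply, hS', avgL_classC]
  · have hm : Measurable fun t : Fin (m + 1) → ℝ => ‖w (rightTranslate (curveProd γ t) x)‖ₑ := by
      refine Continuous.measurable ?_
      exact (w.continuous.comp (continuous_rightTranslate_prod.comp
        ((continuous_curveProd hγ).prodMk continuous_const))).enorm
    rw [ContinuousLinearMap.comp_apply, avgC_apply, lintegral_cube_succ hm,
      intervalIntegral.integral_of_le hε]
    refine (enorm_integral_le_lintegral_enorm _).trans ?_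
    rw [mul_assoc, ← lintegral_const_mul' _ _ hK, ← lintegral_const_mul' _ _ ENNReal.ofReal_ne_top]
    refine setLIntegral_mono' measurableSet_Ioc fun s hs => ?_
    rw [enorm_smul]
    refine mul_le_mul' ?_ ?_
    · rw [← ofReal_norm]
      exact ENNReal.ofReal_le_ofReal (hB s ⟨hs.1.le, hs.2⟩)
    · simpa only [curveProd_cons, rightTranslate_mul] using hb w (rightTranslate (γ 0 s) x)

/-- An operator dominated by averages which are bounded by the measure `μ` maps `L²(X)` to `C(X)`. -/
lemma IsDominated.exists_lift {m : ℕ} {γ : Fin m → ℝ → G} (hγ : ∀ i, Continuous (γ i)) {ε : ℝ}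
    {C : ENNReal} (hC : C ≠ ⊤) (hle : ∀ (x : LeftQuotient Γ) (A : Set (LeftQuotient Γ)),
      MeasurableSet A → volume (cube m ε ∩ {t | rightTranslate (curveProd γ t) x ∈ A}) ≤ C * μ A)
    {S : Lp ℂ 2 μ →L[ℂ] Lp ℂ 2 μ} (hS : IsDominated μ γ ε S) :
    ∃ S' : Lp ℂ 2 μ →L[ℂ] C(LeftQuotient Γ, ℂ), ∀ v, classC μ (S' v) = S v := by
  obtain ⟨S', hS', K, hK, hb⟩ := hS
  have hct : ∀ x : LeftQuotient Γ, Continuous fun t => rightTranslate (curveProd γ t) x := fun x =>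
    continuous_rightTranslate_prod.comp ((continuous_curveProd hγ).prodMk continuous_const)
  have hmap : ∀ x : LeftQuotient Γ, ((volume.restrict (cube m ε)).map
      fun t => rightTranslate (curveProd γ t) x) ≤ C • μ := fun x =>
    Measure.le_iff.2 fun A hA => by
      rw [Measure.map_apply (hct x).measurable hA,
        Measure.restrict_apply ((hct x).measurable hA), Set.inter_comm]
      exact hle x A hA
  -- Domination, then the comparison of measures, then `L¹ ≤ L²` for a probability measure: on
  -- `C(X)` the operator is bounded from the `L²` norm to the sup norm, and so extends by density.
  have hnorm : ∀ w, ‖S' w‖ ≤ (K * C).toReal * ‖classC μ w‖ := by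
    intro w
    rw [ContinuousMap.norm_le _ (by positivity)]
    intro x
    have h1 : ∫⁻ t in cube m ε, ‖w (rightTranslate (curveProd γ t) x)‖ₑ ≤ C * ∫⁻ y, ‖w y‖ₑ ∂μ := by
      rw [← lintegral_map (f := fun y => ‖w y‖ₑ) w.continuous.enorm.measurable (hct x).measurable,
        ← smul_eq_mul, ← lintegral_smul_measure]
      exact lintegral_mono' (hmap x) le_rfl
    have h2 : ∫⁻ y, ‖w y‖ₑ ∂μ ≤ ‖classC μ w‖ₑ := by
      rw [← eLpNorm_one_eq_lintegral_enorm, Lp.enorm_def, eLpNorm_congr_ae (coeFn_classC μ w)]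
      exact eLpNorm_le_eLpNorm_of_exponent_le (by norm_num) w.continuous.aestronglyMeasurable
    have h3 : ‖S' w x‖ₑ ≤ K * C * ‖classC μ w‖ₑ := by
      refine (hb w x).trans ?_
      rw [mul_assoc]
      exact mul_le_mul_right (h1.trans (mul_le_mul_right h2 _)) _
    have h4 := ENNReal.toReal_mono (ENNReal.mul_ne_top (ENNReal.mul_ne_top hK hC) (by simp)) h3
    simpa using h4
  refine ⟨S'.toLinearMap.extendOfNorm (classC μ).toLinearMap, fun v => ?_⟩
  have hd : DenseRange (classC μ).toLinearMap := classC_denseRange μ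
  refine hd.induction_on v (isClosed_eq ?_ S.continuous) fun w => ?_
  · exact (classC μ).continuous.comp (ContinuousLinearMap.continuous _)
  · rw [LinearMap.extendOfNorm_eq hd ⟨_, hnorm⟩]
    exact (hS' w).symm

/-- With the weight `k t = Re ⟪v, R_{γ t} v⟫` the real part of the pairing of `v` with its average
is `∫ k²`. This is positive because `k 0 = ‖v‖²`, so no approximate identity is needed. -/
lemma exists_avgL_ne_zero {γ : ℝ → G} (hγ : Continuous γ) (h0 : γ 0 = 1) {ε : ℝ} (hε : 0 < ε)
    {v : Lp ℂ 2 μ} (hv : v ≠ 0) : ∃ (k : ℝ → ℝ) (hk : Continuous k), avgL μ hγ hk ε v ≠ 0 := by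
  have hc : Continuous fun t => regularRep μ (γ t) v := (continuous_regularRep μ v).comp hγ
  let k : ℝ → ℝ := fun t => (inner ℂ v (regularRep μ (γ t) v)).re
  have hk : Continuous k := Complex.continuous_re.comp (continuous_const.inner hc)
  refine ⟨k, hk, fun h => ?_⟩
  let L : Lp ℂ 2 μ →L[ℝ] ℝ := Complex.reCLM.comp ((innerSL ℂ v).restrictScalars ℝ)
  have hi : Continuous fun t => k t • regularRep μ (γ t) v := hk.smul hc
  have h1 := L.intervalIntegral_comp_comm (hi.intervalIntegrable (μ := volume) 0 ε)
  rw [← avgL_apply μ hγ hk ε v, h, map_zero] at h1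
  have h2 : ∀ t, L (k t • regularRep μ (γ t) v) = k t ^ 2 := fun t => by
    rw [map_smul, sq, smul_eq_mul]
    rfl
  simp_rw [h2] at h1
  have h3 : 0 < ∫ t in (0 : ℝ)..ε, k t ^ 2 := by
    refine intervalIntegral.integral_pos hε (hk.pow 2).continuousOn (fun _ _ => sq_nonneg _)
      ⟨0, ⟨le_rfl, hε.le⟩, ?_⟩
    have : k 0 = ‖v‖ ^ 2 := by
      simp only [k, h0, regularRep_one]
      rw [inner_self_eq_norm_sq_to_K]
      norm_cast
    rw [this]
    have := norm_pos_iff.2 hv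
    positivity
  exact h3.ne' h1

/-- The weights are chosen one after another, each adapted to the nonzero vector produced so far.
Closed invariant subspaces are preserved because they contain integrals of translates of their
elements. -/
lemma exists_isDominated_ne_zero {m : ℕ} {γ : Fin m → ℝ → G} (hγ : ∀ i, Continuous (γ i))
    (h0 : ∀ i, γ i 0 = 1) {ε : ℝ} (hε : 0 < ε) {v : Lp ℂ 2 μ} (hv : v ≠ 0) :
    ∃ S : Lp ℂ 2 μ →L[ℂ] Lp ℂ 2 μ, IsDominated μ γ ε S ∧ S v ≠ 0 ∧
      ∀ H : Submodule ℂ (Lp ℂ 2 μ), IsClosed (H : Set (Lp ℂ 2 μ)) →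
        (∀ g : G, ∀ w ∈ H, regularRep μ g w ∈ H) → ∀ w ∈ H, S w ∈ H := by
  induction m with
  | zero => exact ⟨_, isDominated_id μ γ ε, hv, fun _ _ _ _ h => h⟩
  | succ m ih =>
    obtain ⟨S, hS, hSv, hSH⟩ := ih (fun i => hγ i.succ) fun i => h0 i.succ
    obtain ⟨k, hk, hne⟩ := exists_avgL_ne_zero μ (hγ 0) (h0 0) hε hSv
    refine ⟨_, hS.avgL_comp μ hγ hε.le hk, hne, fun H hH hinv w hw => ?_⟩
    have h1 : Continuous fun t => regularRep μ (γ 0 t) (S w) :=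
      (continuous_regularRep μ _).comp (hγ 0)
    rw [ContinuousLinearMap.comp_apply, avgL_apply]
    exact intervalIntegral_mem_of_forall_mem hH (hk.smul h1) 0 ε fun t =>
      (H.restrictScalars ℝ).smul_mem _ (hinv _ _ (hSH H hH hinv w hw))

end Smoothing

/-! ### The curves used for averaging. -/

section Curves

variable {n : ℕ} {G : Type u} [TopologicalSpace G] [ChartedSpace (EuclideanSpace ℝ (Fin n)) G]
  [Group G] [LieGroup (𝓡 n) ∞ G] [IsTopologicalGroup G] [SecondCountableTopology G]
  {Γ : Subgroup G} [CompactSpace (LeftQuotient Γ)]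
  (μ : Measure (LeftQuotient Γ)) [IsProbabilityMeasure μ] [IsRightInvariant μ]

variable (n) in
/-- There are curves through the identity such that right translations along their products are
bounded by the measure `μ`. -/
lemma exists_curves : ∃ ε > 0, ∃ (γ : Fin n → ℝ → G) (a : Fin n → ℝ → EuclideanSpace ℝ (Fin n)),
    (∀ i, Continuous (γ i)) ∧ (∀ i, γ i 0 = 1) ∧ (∀ i, Continuous (a i)) ∧
    (∀ i, ∀ s ∈ Set.Ioo 0 ε, ∀ (F' : Type u) [NormedAddCommGroup F'] [NormedSpace ℝ F'] (u : G → F'),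
        ContMDiff (𝓡 n) 𝓘(ℝ, F') ∞ u →
        HasDerivAt (fun s => u (γ i s)) (lieDerivL u (γ i s) (a i s)) s) ∧
    ∃ C : ENNReal, C ≠ ⊤ ∧ ∀ (x : LeftQuotient Γ) (A : Set (LeftQuotient Γ)), MeasurableSet A →
      volume (cube n ε ∩ {t | rightTranslate (curveProd γ t) x ∈ A}) ≤ C * μ A := by
  obtain ⟨ε₁, hε₁, h1⟩ := exists_axisCurve_bounds n G
  obtain ⟨ε₂, hε₂, -, C, hC, h2⟩ := exists_volume_axisProd_le n μ
  obtain ⟨ε, hε, hεε₁, hεε₂⟩ : ∃ ε > 0, ε < ε₁ ∧ ε < ε₂ :=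
    ⟨min ε₁ ε₂ / 2, by positivity, by linarith [min_le_left ε₁ ε₂, lt_min hε₁ hε₂],
      by linarith [min_le_right ε₁ ε₂, lt_min hε₁ hε₂]⟩
  -- The axis curves are controlled only near `0`. Clamping the parameter to `[0, ε]` makes them
  -- continuous on the whole line and changes nothing over the cube.
  let c : ℝ → ℝ := fun s => max 0 (min s ε)
  have hc : Continuous c := by fun_prop
  have hcmem : ∀ s, c s ∈ Metric.ball (0 : ℝ) ε₁ := fun s => by
    rw [mem_ball_zero_iff, Real.norm_eq_abs, abs_of_nonneg (le_max_left _ _)]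
    exact (max_le hε.le (min_le_right _ _)).trans_lt hεε₁
  have hceq : ∀ s ∈ Set.Icc 0 ε, c s = s := fun s hs => by
    simp only [c, min_eq_left hs.2, max_eq_right hs.1]
  refine ⟨ε, hε, fun i s => axisCurve n G i (c s), fun i s => axisVel n G i (c s), fun i => ?_,
    fun i => ?_, fun i => ?_, fun i s hs F' _ _ u hu => ?_, C, hC, fun x A hA => ?_⟩
  · exact continuous_iff_continuousAt.2 fun s =>
      ContinuousAt.comp (g := axisCurve n G i) (h1 i _ (hcmem s)).1 hc.continuousAt
  · beta_reduce
    rw [hceq 0 ⟨le_rfl, hε.le⟩, axisCurve_zero]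
  · exact continuous_iff_continuousAt.2 fun s =>
      ContinuousAt.comp (g := axisVel n G i) (h1 i _ (hcmem s)).2.1 hc.continuousAt
  · have h3 := (h1 i _ (hcmem s)).2.2 F' u hu
    beta_reduce
    rw [hceq s ⟨hs.1.le, hs.2.le⟩] at h3 ⊢
    refine h3.congr_of_eventuallyEq ?_
    filter_upwards [Ioo_mem_nhds hs.1 hs.2] with r hr
    rw [hceq r ⟨hr.1.le, hr.2.le⟩]
  · refine (measure_mono ?_).trans (h2 x A hA)
    rintro t ⟨ht, htA⟩
    rw [cube, Set.mem_univ_pi] at ht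
    refine ⟨?_, ?_⟩
    · rw [mem_ball_zero_iff]
      refine (pi_norm_lt_iff hε₂).2 fun i => ?_
      rw [Real.norm_eq_abs, abs_of_pos (ht i).1]
      exact (ht i).2.trans_lt hεε₂
    · have h3 : curveProd (fun i s => axisCurve n G i (c s)) t = axisProd n G t := by
        unfold curveProd axisProd
        congr 2
        funext i
        beta_reduce
        rw [hceq _ ⟨(ht i).1.le, (ht i).2⟩]
      simpa only [Set.mem_ofPred, h3] using htA

end Curves

/-! ### The smooth vectors of `L²(X)`. -/

section SmoothVec

lemma foldOp_nil {M K : Type*} [AddCommGroup M] [Module ℂ M] (D : K → M →ₗ[ℂ] M) (m : M) :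
    foldOp D [] m = m := rfl

lemma foldOp_cons {M K : Type*} [AddCommGroup M] [Module ℂ M] (D : K → M →ₗ[ℂ] M) (ξ : K)
    (l : List K) (m : M) : foldOp D (ξ :: l) m = D ξ (foldOp D l m) := rfl

lemma foldOp_append {M K : Type*} [AddCommGroup M] [Module ℂ M] (D : K → M →ₗ[ℂ] M) (l l' : List K)
    (m : M) : foldOp D (l ++ l') m = foldOp D l (foldOp D l' m) := by
  simp only [foldOp_apply, List.foldr_append]

lemma map_foldOp {M N K : Type*} [AddCommGroup M] [Module ℂ M] [AddCommGroup N] [Module ℂ N]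
    {D : K → M →ₗ[ℂ] M} {D' : K → N →ₗ[ℂ] N} {T : M → N} (h : ∀ ξ m, T (D ξ m) = D' ξ (T m))
    (l : List K) (m : M) : T (foldOp D l m) = foldOp D' l (T m) := by
  induction l with
  | nil => rfl
  | cons ξ l ih => rw [foldOp_cons, foldOp_cons, h, ih]

variable {n : ℕ} {G : Type u} [TopologicalSpace G] [ChartedSpace (EuclideanSpace ℝ (Fin n)) G]
  [Group G] [LieGroup (𝓡 n) ∞ G]
  {Γ : Subgroup G} (μ : Measure (LeftQuotient Γ)) [IsRightInvariant μ]

variable (n) in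
/-- The smooth vectors of `L²(X)`. -/
def wholeSmooth : Submodule ℂ (Lp ℂ 2 μ) where
  carrier := {v | ContMDiff (𝓡 n) 𝓘(ℝ, Lp ℂ 2 μ) ∞ fun g => regularRep μ g v}
  add_mem' hv hw := (hv.add hw).congr fun g => map_add (regularRep μ g) _ _
  zero_mem' := by simpa using contMDiff_const
  smul_mem' c v hv := by
    have h := (((c • ContinuousLinearMap.id ℂ (Lp ℂ 2 μ)) :
      Lp ℂ 2 μ →L[ℂ] Lp ℂ 2 μ).restrictScalars ℝ).contMDiff (n := ∞)
    simpa [Function.comp_def] using h.comp hv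

/-- The derived action on the smooth vectors of `L²(X)`. -/
def wholeDeriv (ξ : GroupLieAlgebra (𝓡 n) G) : wholeSmooth n μ →ₗ[ℂ] wholeSmooth n μ where
  toFun v := ⟨lieDeriv ξ (fun g => regularRep μ g v.1) 1,
    (contMDiff_lieDeriv ξ v.2).congr fun g => lieDeriv_regularRep μ ξ v.2 g⟩
  map_add' v w := Subtype.ext <| by
    refine Eq.trans ?_ (lieDeriv_add_right ξ v.2 w.2 1)
    simp
  map_smul' c v := Subtype.ext <| by
    refine Eq.trans ?_ (lieDeriv_clm (((c • ContinuousLinearMap.id ℂ (Lp ℂ 2 μ)) :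
      Lp ℂ 2 μ →L[ℂ] Lp ℂ 2 μ).restrictScalars ℝ) ξ v.2 1)
    simp

lemma regularRep_mem_wholeSmooth (v : wholeSmooth n μ) (g : G) :
    regularRep μ g v.1 ∈ wholeSmooth n μ := by
  have h : ContMDiff (𝓡 n) 𝓘(ℝ, Lp ℂ 2 μ) ∞ fun h => regularRep μ (h * g) v.1 :=
    v.2.comp (contMDiff_mul_right (I := 𝓡 n) (n := ∞) (a := g))
  exact h.congr fun h => (regularRep_mul μ h g v.1).symm

/-- Right translation of smooth vectors. -/
def wholeTranslate (g : G) (v : wholeSmooth n μ) : wholeSmooth n μ :=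
  ⟨regularRep μ g v.1, regularRep_mem_wholeSmooth μ v g⟩

lemma lieDerivL_regularRep (v : wholeSmooth n μ) (g : G) (ξ : EuclideanSpace ℝ (Fin n)) :
    lieDerivL (fun g => regularRep μ g v.1) g ξ =
      ∑ j, ξ j • regularRep μ g (wholeDeriv μ (stdVec n G j) v).1 := by
  rw [lieDerivL_eq_sum]
  exact Finset.sum_congr rfl fun j _ => congrArg _ (lieDeriv_regularRep μ _ v.2 g).symm

end SmoothVec

/-! ### The Sobolev lemma by integration by parts along curves. -/

section Sobolev

variable {n : ℕ} {G : Type u} [TopologicalSpace G] [ChartedSpace (EuclideanSpace ℝ (Fin n)) G]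
  [Group G] [LieGroup (𝓡 n) ∞ G] [IsTopologicalGroup G] [SecondCountableTopology G]
  {Γ : Subgroup G} [CompactSpace (LeftQuotient Γ)]
  [T2Space (LeftQuotient Γ)] [SecondCountableTopology (LeftQuotient Γ)]
  (μ : Measure (LeftQuotient Γ)) [IsProbabilityMeasure μ] [IsRightInvariant μ]

/-- Integrate the derivative of `(1 - s / ε) R_{γ s} v` over `[0, ε]`; the weight is `1` at `0` and
vanishes at `ε`. Differentiating the weight gives the term `none`, without a derivative of `v`;
differentiating the orbit gives one term for each basis vector, weighted by the velocity `a`. -/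
lemma exists_eq_sum_avgL {γ : ℝ → G} (hγ : Continuous γ) (h0 : γ 0 = 1) {ε : ℝ} (hε : 0 < ε)
    {a : ℝ → EuclideanSpace ℝ (Fin n)} (ha : Continuous a)
    (hd : ∀ s ∈ Set.Ioo 0 ε, ∀ (F' : Type u) [NormedAddCommGroup F'] [NormedSpace ℝ F'] (u : G → F'),
        ContMDiff (𝓡 n) 𝓘(ℝ, F') ∞ u →
        HasDerivAt (fun s => u (γ s)) (lieDerivL u (γ s) (a s)) s) :
    ∃ (k : Option (Fin n) → ℝ → ℝ) (hk : ∀ o, Continuous (k o)), ∀ v : wholeSmooth n μ,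
      v.1 = ∑ o, avgL μ hγ (hk o) ε
        (foldOp (wholeDeriv μ) (o.elim [] fun j => [stdVec n G j]) v).1 := by
  let k : Option (Fin n) → ℝ → ℝ := fun o s => o.elim (ε⁻¹) fun j => -((1 - s / ε) * a s j)
  have hak : ∀ j, Continuous fun s => a s j := fun j =>
    (EuclideanSpace.proj j : EuclideanSpace ℝ (Fin n) →L[ℝ] ℝ).continuous.comp ha
  have hk : ∀ o, Continuous (k o) := by
    rintro (_ | j)
    · exact continuous_const
    · exact ((continuous_const.sub (continuous_id.div_const _)).mul (hak j)).neg
  refine ⟨k, hk, fun v => ?_⟩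
  let D : Option (Fin n) → wholeSmooth n μ := fun o =>
    foldOp (wholeDeriv μ) (o.elim [] fun j => [stdVec n G j]) v
  have hcont : ∀ o, Continuous fun s => k o s • regularRep μ (γ s) (D o).1 := fun o =>
    (hk o).smul ((continuous_regularRep μ _).comp hγ)
  let U : ℝ → Lp ℂ 2 μ := fun s => (1 - s / ε) • regularRep μ (γ s) v.1
  have hU : Continuous U := (continuous_const.sub (continuous_id.div_const _)).smul
    ((continuous_regularRep μ _).comp hγ)
  have hU' : ∀ s ∈ Set.Ioo 0 ε, HasDerivAt U (-∑ o, k o s • regularRep μ (γ s) (D o).1) s := by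
    intro s hs
    have h1 := hd s hs (Lp ℂ 2 μ) (fun g => regularRep μ g v.1) v.2
    have h2 : HasDerivAt (fun s : ℝ => 1 - s / ε) (-ε⁻¹) s := by
      have := ((hasDerivAt_id s).div_const ε).const_sub 1
      simpa using this
    have h3 := h2.smul h1
    refine h3.congr_deriv ?_
    rw [lieDerivL_regularRep, Fintype.sum_option, Finset.smul_sum, neg_add, ← Finset.sum_neg_distrib,
      add_comm]
    congr 1
    · simp only [k, D, Option.elim, foldOp_nil, neg_smul]
    · refine Finset.sum_congr rfl fun j _ => ?_
      simp only [k, D, Option.elim, foldOp_nil, foldOp_cons, neg_smul, neg_neg, smul_smul]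
  have h4 := intervalIntegral.integral_eq_sub_of_hasDerivAt_of_le hε.le hU.continuousOn hU'
    ((continuous_finsetSum _ fun o _ => hcont o).neg.intervalIntegrable _ _)
  rw [intervalIntegral.integral_neg, intervalIntegral.integral_finsetSum fun o _ =>
    (hcont o).intervalIntegrable _ _] at h4
  have h5 : U ε = 0 := by simp [U, hε.ne']
  have h6 : U 0 = v.1 := by simp [U, h0]
  rw [h5, h6, zero_sub, neg_inj] at h4
  exact h4.symm

/-- Apply the one-curve formula for `γ 0`, then expand the resulting derivatives of `v`, which are
smooth vectors again, along the remaining curves. Each curve costs at most one derivative. -/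
lemma exists_eq_sum_isDominated {m : ℕ} {γ : Fin m → ℝ → G} (hγ : ∀ i, Continuous (γ i))
    (h0 : ∀ i, γ i 0 = 1) {ε : ℝ} (hε : 0 < ε)
    {a : Fin m → ℝ → EuclideanSpace ℝ (Fin n)} (ha : ∀ i, Continuous (a i))
    (hd : ∀ i, ∀ s ∈ Set.Ioo 0 ε, ∀ (F' : Type u) [NormedAddCommGroup F'] [NormedSpace ℝ F']
        (u : G → F'), ContMDiff (𝓡 n) 𝓘(ℝ, F') ∞ u →
        HasDerivAt (fun s => u (γ i s)) (lieDerivL u (γ i s) (a i s)) s) :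
    ∃ (ι : Type) (_ : Fintype ι) (S : ι → Lp ℂ 2 μ →L[ℂ] Lp ℂ 2 μ)
      (l : ι → List (GroupLieAlgebra (𝓡 n) G)), (∀ i, IsDominated μ γ ε (S i)) ∧
      ∀ v : wholeSmooth n μ, v.1 = ∑ i, S i (foldOp (wholeDeriv μ) (l i) v).1 := by
  induction m with
  | zero =>
    exact ⟨Unit, inferInstance, fun _ => ContinuousLinearMap.id ℂ _, fun _ => [],
      fun _ => isDominated_id μ γ ε, fun v => by simp [foldOp_nil]⟩
  | succ m ih =>
    obtain ⟨ι, _, S, l, hS, hv⟩ := ih (fun i => hγ i.succ) (fun i => h0 i.succ)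
      (fun i => ha i.succ) fun i => hd i.succ
    obtain ⟨k, hk, hkv⟩ := exists_eq_sum_avgL μ (hγ 0) (h0 0) hε (ha 0) (hd 0)
    refine ⟨Option (Fin n) × ι, inferInstance, fun q => (avgL μ (hγ 0) (hk q.1) ε).comp (S q.2),
      fun q => l q.2 ++ q.1.elim [] fun j => [stdVec n G j],
      fun q => (hS q.2).avgL_comp μ hγ hε.le (hk q.1), fun v => ?_⟩
    rw [Fintype.sum_prod_type]
    refine (hkv v).trans (Finset.sum_congr rfl fun o _ => ?_)
    conv_lhs => rw [hv (foldOp (wholeDeriv μ) (o.elim [] fun j => [stdVec n G j]) v)]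
    rw [map_sum]
    exact Finset.sum_congr rfl fun i _ => by rw [foldOp_append]; rfl

variable (n) in
/-- Smooth vectors of `L²(X)` are obtained by smoothing operators from their derivatives. -/
lemma exists_sobolev : ∃ (ι : Type) (_ : Fintype ι) (S : ι → Lp ℂ 2 μ →L[ℂ] C(LeftQuotient Γ, ℂ))
      (l : ι → List (GroupLieAlgebra (𝓡 n) G)),
      ∀ v : wholeSmooth n μ, v.1 = classC μ (∑ i, S i (foldOp (wholeDeriv μ) (l i) v).1) := by
  obtain ⟨ε, hε, γ, a, hγ, h0, ha, hd, C, hC, hb⟩ := exists_curves n μ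
  obtain ⟨ι, hι, S, l, hS, hv⟩ := exists_eq_sum_isDominated μ hγ h0 hε ha hd
  choose S' hS' using fun i => (hS i).exists_lift μ hγ hC hb
  refine ⟨ι, hι, S', l, fun v => ?_⟩
  rw [map_sum]
  exact (hv v).trans (Finset.sum_congr rfl fun i _ => (hS' i _).symm)

/-- The source of compact operators: `S` factors through `C(X)` without killing the given vector. -/
lemma exists_smoothing (n : ℕ) {G : Type u} [TopologicalSpace G]
    [ChartedSpace (EuclideanSpace ℝ (Fin n)) G] [Group G] [LieGroup (𝓡 n) ∞ G]
    [IsTopologicalGroup G] [SecondCountableTopology G]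
    {Γ : Subgroup G} [CompactSpace (LeftQuotient Γ)]
    [T2Space (LeftQuotient Γ)] [SecondCountableTopology (LeftQuotient Γ)]
    (μ : Measure (LeftQuotient Γ)) [IsProbabilityMeasure μ] [IsRightInvariant μ] {v : Lp ℂ 2 μ} (hv : v ≠ 0) :
    ∃ (S : Lp ℂ 2 μ →L[ℂ] Lp ℂ 2 μ) (S' : Lp ℂ 2 μ →L[ℂ] C(LeftQuotient Γ, ℂ)),
      (∀ w, classC μ (S' w) = S w) ∧ S v ≠ 0 ∧
      ∀ H : Submodule ℂ (Lp ℂ 2 μ), IsClosed (H : Set (Lp ℂ 2 μ)) →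
        (∀ g : G, ∀ w ∈ H, regularRep μ g w ∈ H) → ∀ w ∈ H, S w ∈ H := by
  obtain ⟨ε, hε, γ, a, hγ, h0, ha, hd, C, hC, hb⟩ := exists_curves n μ
  obtain ⟨S, hS, hSv, hH⟩ := exists_isDominated_ne_zero μ hγ h0 hε hv
  obtain ⟨S', hS'⟩ := hS.exists_lift μ hγ hC hb
  exact ⟨S, S', hS', hSv, hH⟩

end Sobolev

/-! ### Continuity criteria for topologies defined by operators. -/

section OperatorTopology

variable {M N K : Type*} [TopologicalSpace N] [AddCommGroup M] [Module ℂ M] [AddCommGroup N]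
  [Module ℂ N] (b : M →ₗ[ℂ] N) (D : K → M →ₗ[ℂ] M)

lemma tendsto_operatorTopology {Z : Type*} {F : Z → M} {l : Filter Z} {m : M}
    (h : ∀ w : List K, Filter.Tendsto (fun z => b (foldOp D w (F z))) l (nhds (b (foldOp D w m)))) :
    Filter.Tendsto F l (@nhds M (operatorTopology b fun ξ => D ξ) m) := by
  rw [operatorTopology_eq, nhds_iInf, Filter.tendsto_iInf]
  intro w
  rw [nhds_induced, Filter.tendsto_comap_iff]
  exact h w

lemma continuous_operatorTopology_rng {Z : Type*} [TopologicalSpace Z] {F : Z → M}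
    (h : ∀ w : List K, Continuous fun z => b (foldOp D w (F z))) :
    @Continuous Z M _ (operatorTopology b fun ξ => D ξ) F := by
  rw [operatorTopology_eq, continuous_iInf_rng]
  exact fun w => continuous_induced_rng.2 (h w)

lemma continuous_operatorTopology_dom (w : List K) :
    @Continuous M N (operatorTopology b fun ξ => D ξ) _ fun m => b (foldOp D w m) := by
  rw [operatorTopology_eq]
  exact continuous_iInf_dom (i := w) continuous_induced_dom

end OperatorTopology

/-! ### The adjoint action in coordinates. -/

section Conjugation

variable {n : ℕ} {G : Type u} [TopologicalSpace G] [ChartedSpace (EuclideanSpace ℝ (Fin n)) G]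
  [Group G] [LieGroup (𝓡 n) ∞ G]
  {F' : Type*} [NormedAddCommGroup F'] [NormedSpace ℝ F']

/-- The derivative of the conjugation `h ↦ g⁻¹ h g` at the identity, in coordinates. -/
def conjCoord (g : G) (ξ : EuclideanSpace ℝ (Fin n)) : Fin n → ℝ :=
  (mfderiv (𝓡 n) 𝓘(ℝ, Fin n → ℝ) (fun h : G => (coordInv (g⁻¹ * h * g) : Fin n → ℝ)) 1 :
    EuclideanSpace ℝ (Fin n) →L[ℝ] (Fin n → ℝ)) ξ

lemma contMDiffAt_conj (g : G) :
    ContMDiffAt ((𝓡 n).prod (𝓡 n)) 𝓘(ℝ, Fin n → ℝ) ∞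
      (Function.uncurry fun g h : G => (coordInv (g⁻¹ * h * g) : Fin n → ℝ)) (g, 1) := by
  have h1 : ContMDiff ((𝓡 n).prod (𝓡 n)) (𝓡 n) ∞ (fun q : G × G => q.1⁻¹ * q.2 * q.1) :=
    (contMDiff_fst.inv.mul contMDiff_snd).mul contMDiff_fst
  refine ContMDiffAt.comp (g := (coordInv : G → Fin n → ℝ)) _ ?_ h1.contMDiffAt
  simpa using contMDiffAt_coordInv.self_of_nhds

/-- The conjugation is smooth in both variables together, so its derivative at `1` depends smoothly
on `g`. The coordinate changes that appear are trivial: the base point `1` is fixed and the target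
is a vector space. -/
lemma contMDiff_conjCoord (ξ : EuclideanSpace ℝ (Fin n)) :
    ContMDiff (𝓡 n) 𝓘(ℝ, Fin n → ℝ) ∞ (fun g : G => conjCoord g ξ) := by
  intro g
  have h := ContMDiffAt.mfderiv_apply (I := 𝓡 n) (I' := 𝓘(ℝ, Fin n → ℝ)) (J := 𝓡 n) (J' := 𝓡 n)
    (m := ∞) (n := ∞) (x₀ := g)
    (fun g h : G => (coordInv (g⁻¹ * h * g) : Fin n → ℝ)) (fun _ => (1 : G)) (id : G → G)
    (fun _ => ξ) ?_ ?_ ?_ ?_ ?_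
  · refine h.congr_of_eventuallyEq (Filter.Eventually.of_forall fun x => ?_)
    have e := inTangentCoordinates_eq (I := 𝓡 n) (I' := 𝓘(ℝ, Fin n → ℝ)) (fun _ : G => (1 : G))
      (fun x : G => (coordInv (x⁻¹ * 1 * x) : Fin n → ℝ))
      (fun x => mfderiv (𝓡 n) 𝓘(ℝ, Fin n → ℝ) (fun h => (coordInv (x⁻¹ * h * x) : Fin n → ℝ)) 1)
      (x₀ := g) (x := x) (by simp) (by rw [chartAt_self_eq]; simp)
    refine Eq.symm ((congrArg (fun T => T ξ) e).trans ?_)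
    have e1 : (tangentBundleCore (𝓡 n) G).coordChange (achart _ 1) (achart _ 1) 1 ξ = ξ :=
      (tangentBundleCore (𝓡 n) G).coordChange_self _ _ (by simp) ξ
    have e2 : ∀ w : Fin n → ℝ, (tangentBundleCore 𝓘(ℝ, Fin n → ℝ) (Fin n → ℝ)).coordChange
        (achart (Fin n → ℝ) (coordInv (x⁻¹ * 1 * x)))
        (achart (Fin n → ℝ) (coordInv (g⁻¹ * 1 * g))) (coordInv (x⁻¹ * 1 * x)) w = w := fun w => by
      rw [tangentBundleCore_coordChange_model_space]; rfl
    refine (e2 _).trans ?_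
    exact congrArg (fun w : EuclideanSpace ℝ (Fin n) =>
      (mfderiv (𝓡 n) 𝓘(ℝ, Fin n → ℝ) (fun h => (coordInv (x⁻¹ * h * x) : Fin n → ℝ)) 1 :
        EuclideanSpace ℝ (Fin n) →L[ℝ] (Fin n → ℝ)) w) e1
  · exact contMDiffAt_conj g
  · exact contMDiffAt_const
  · exact contMDiffAt_id
  · exact contMDiffAt_const
  · simp

lemma mdifferentiableAt_conj (g : G) :
    MDifferentiableAt (𝓡 n) 𝓘(ℝ, Fin n → ℝ) (fun h : G => (coordInv (g⁻¹ * h * g) : Fin n → ℝ)) 1 :=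
  ((contMDiffAt_conj g).comp (1 : G)
    (contMDiffAt_const.prodMk contMDiffAt_id)).mdifferentiableAt (by simp)

variable [IsTopologicalGroup G]

/-- The vector `mcForm n G 0 (conjCoord g ξ)` plays the role of `Ad(g⁻¹) ξ`; the formula is the
chain rule through the coordinates at the identity. -/
lemma lieDeriv_conj {u : G → F'} (hu : ContMDiff (𝓡 n) 𝓘(ℝ, F') ∞ u) (g : G)
    (ξ : GroupLieAlgebra (𝓡 n) G) :
    lieDeriv ξ (fun h => u (g⁻¹ * h * g)) 1 =
      lieDerivL u 1 (mcForm n G 0 (conjCoord g ξ)) := by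
  have h1 := hasFDerivAt_comp_coordMap hu (t := 0) contMDiffAt_coordMap.self_of_nhds
  rw [coordMap_zero] at h1
  have h2 := (mdifferentiableAt_conj (n := n) g).hasMFDerivAt
  have h0 : coordInv (n := n) (g⁻¹ * 1 * g) = 0 := by simp
  have h1' : HasMFDerivAt 𝓘(ℝ, Fin n → ℝ) 𝓘(ℝ, F') (fun s => u (coordMap n G s))
      (coordInv (n := n) (g⁻¹ * 1 * g)) ((lieDerivL u 1).comp (mcForm n G 0)) := by
    rw [h0]
    exact h1.hasMFDerivAt
  have h3 := h1'.comp (1 : G) h2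
  have e : (fun h => u (1 * h)) = u := by simp
  have h4 : (fun h => u (g⁻¹ * (1 * h) * g)) =ᶠ[nhds (1 : G)]
      (fun s => u (coordMap n G s)) ∘ fun h => coordInv (g⁻¹ * h * g) := by
    have hc : Filter.Tendsto (fun h : G => g⁻¹ * h * g) (nhds 1) (nhds 1) := by
      have : Continuous fun h : G => g⁻¹ * h * g := by fun_prop
      simpa using this.tendsto 1
    filter_upwards [hc.eventually (eventually_coordMap_coordInv (n := n))] with h hh
    simp [hh]
  have h5 := (h3.congr_of_eventuallyEq h4).mfderiv
  exact congrArg (fun T : EuclideanSpace ℝ (Fin n) →L[ℝ] F' => T ξ) h5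

end Conjugation

/-! ### Smooth vectors of `L²(X)` are smooth functions. -/

section SmoothClass

variable {n : ℕ} {G : Type u} [TopologicalSpace G] [ChartedSpace (EuclideanSpace ℝ (Fin n)) G]
  [Group G] [LieGroup (𝓡 n) ∞ G] [IsTopologicalGroup G] [SecondCountableTopology G]
  {Γ : Subgroup G} [CompactSpace (LeftQuotient Γ)]
  [T2Space (LeftQuotient Γ)] [SecondCountableTopology (LeftQuotient Γ)]
  (μ : Measure (LeftQuotient Γ)) [IsProbabilityMeasure μ] [IsRightInvariant μ]

lemma regularRep_classC_smooth (f : SmoothFun n Γ) (g : G) :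
    regularRep μ g (classC μ (toContinuousMap Γ f)) = classC μ (orbitC f g) :=
  regularRep_classC μ g _

/-- The inclusion of the smooth functions into the smooth vectors of `L²(X)`. -/
def smoothClass : SmoothFun n Γ →ₗ[ℂ] wholeSmooth n μ :=
  ((classC μ).toLinearMap ∘ₗ toContinuousMap Γ).codRestrict _ fun f => by
    have h := ((classC μ).restrictScalars ℝ).contMDiff.comp (contMDiff_orbitC f)
    exact h.congr fun g => regularRep_classC_smooth μ f g

lemma coe_smoothClass (f : SmoothFun n Γ) :
    (smoothClass μ f).1 = classC μ (toContinuousMap Γ f) := rfl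

lemma toContinuousMap_injective : Function.Injective (toContinuousMap (n := n) Γ) := fun _ _ h =>
  SmoothFun.ext fun x => congrArg (fun w : C(LeftQuotient Γ, ℂ) => w x) h

lemma smoothClass_injective : Function.Injective (smoothClass (n := n) μ) := fun _ _ h =>
  toContinuousMap_injective (classC_injective μ (congrArg Subtype.val h))

lemma wholeDeriv_smoothClass (ξ : GroupLieAlgebra (𝓡 n) G) (f : SmoothFun n Γ) :
    wholeDeriv μ ξ (smoothClass μ f) = smoothClass μ (inducedField Γ ξ f) := by
  refine Subtype.ext ?_
  have h := lieDeriv_clm ((classC μ).restrictScalars ℝ) ξ (contMDiff_orbitC f) 1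
  rw [lieDeriv_orbitC] at h
  have e : (fun g => regularRep μ g (smoothClass μ f).1) =
      fun g => (classC μ).restrictScalars ℝ (orbitC f g) := by
    funext g
    exact regularRep_classC_smooth μ f g
  have e1 : orbitC (smoothDeriv ξ f) 1 = toContinuousMap Γ (inducedField Γ ξ f) := by
    ext x
    simp [orbitC]
    rfl
  change lieDeriv ξ (fun g => regularRep μ g (smoothClass μ f).1) 1 = _
  rw [e]
  refine h.trans ?_
  rw [e1]
  rfl

/-- From `R_h R_g = R_g R_{g⁻¹ h g}` one gets `ξ R_g v = R_g (Ad(g⁻¹) ξ) v`, expanded here in the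
standard basis. -/
lemma wholeDeriv_wholeTranslate (ξ : GroupLieAlgebra (𝓡 n) G) (g : G) (v : wholeSmooth n μ) :
    wholeDeriv μ ξ (wholeTranslate μ g v) = ∑ j, ((mcForm n G 0 (conjCoord g ξ) j : ℝ) : ℂ) •
      wholeTranslate μ g (wholeDeriv μ (stdVec n G j) v) := by
  refine Subtype.ext ?_
  change lieDeriv ξ (fun h => regularRep μ h (regularRep μ g v.1)) 1 = _
  have e : (fun h => regularRep μ h (regularRep μ g v.1)) =
      fun h => ((regularRep μ g).toContinuousLinearMap.restrictScalars ℝ)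
        ((fun h => regularRep μ (g⁻¹ * h * g) v.1) h) := by
    funext h
    change _ = regularRep μ g (regularRep μ _ v.1)
    rw [← regularRep_mul, ← regularRep_mul]
    congr 2
    group
  have hs : ContMDiff (𝓡 n) 𝓘(ℝ, Lp ℂ 2 μ) ∞ fun h => regularRep μ (g⁻¹ * h * g) v.1 :=
    v.2.comp ((contMDiff_mul_right (I := 𝓡 n) (n := ∞) (a := g)).comp
      (contMDiff_mul_left (I := 𝓡 n) (n := ∞) (a := g⁻¹)))
  rw [e, lieDeriv_clm _ ξ hs 1, lieDeriv_conj v.2 g ξ, lieDerivL_regularRep, map_sum]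
  rw [AddSubmonoidClass.coe_finsetSum]
  refine Finset.sum_congr rfl fun j _ => ?_
  rw [regularRep_one, map_smul]
  rfl

/-- The innermost derivative is moved past `R_g` first. Its coefficients are scalars smooth in `g`,
so they pass through the remaining linear operators. Hence the induction removes the last entry of
the list and covers all `v` at once. -/
lemma contMDiff_foldOp_wholeTranslate (l : List (GroupLieAlgebra (𝓡 n) G)) :
    ∀ v : wholeSmooth n μ, ContMDiff (𝓡 n) 𝓘(ℝ, Lp ℂ 2 μ) ∞ fun g =>
      (foldOp (wholeDeriv μ) l (wholeTranslate μ g v)).1 := by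
  induction l using List.reverseRecOn with
  | nil => exact fun v => v.2
  | append_singleton l ξ ih =>
    intro v
    have e : ∀ g, (foldOp (wholeDeriv μ) (l ++ [ξ]) (wholeTranslate μ g v)).1 =
        ∑ j, (mcForm n G 0 (conjCoord g ξ) j) • (foldOp (wholeDeriv μ) l
          (wholeTranslate μ g (wholeDeriv μ (stdVec n G j) v))).1 := fun g => by
      rw [foldOp_append, foldOp_cons, foldOp_nil, wholeDeriv_wholeTranslate, map_sum,
        AddSubmonoidClass.coe_finsetSum]
      refine Finset.sum_congr rfl fun j _ => ?_
      rw [map_smul]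
      rfl
    simp only [e]
    refine contMDiff_finsetSum fun j _ => ?_
    have h : ContDiff ℝ ∞ fun t : Fin n → ℝ => mcForm n G 0 t j :=
      ((EuclideanSpace.proj j : EuclideanSpace ℝ (Fin n) →L[ℝ] ℝ).comp (mcForm n G 0)).contDiff
    have h' : ContMDiff (𝓡 n) 𝓘(ℝ, ℝ) ∞ fun g : G => mcForm n G 0 (conjCoord g ξ) j :=
      h.contMDiff.comp (contMDiff_conjCoord ξ)
    exact h'.smul (ih _)

/-- Smooth vectors of `L²(X)` are smooth functions. -/
lemma smoothClass_surjective : Function.Surjective (smoothClass (n := n) μ) := by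
  intro v
  obtain ⟨ι, _, S, l, h⟩ := exists_sobolev n μ
  set w := ∑ i, S i (foldOp (wholeDeriv μ) (l i) v).1 with hw
  have htr : ∀ g, translateC Γ g w = ∑ i, S i (foldOp (wholeDeriv μ) (l i) (wholeTranslate μ g v)).1 :=
    fun g => classC_injective μ <| by
      rw [← regularRep_classC, ← h v, ← h (wholeTranslate μ g v)]
      rfl
  -- Since `w (Γ g) = (R_g w)(Γ 1)`, evaluating the Sobolev formula for `R_g v` at the base point
  -- reduces smoothness of `w` to that of the derivatives of `R_g v` as functions of `g`.
  have hsm : ContMDiff (𝓡 n) 𝓘(ℝ, ℂ) ∞ fun g => w (proj Γ g) := by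
    have h1 : ∀ g, w (proj Γ g) = ∑ i, ((ContinuousMap.evalCLM ℂ (proj Γ 1)).comp (S i)).restrictScalars ℝ
        (foldOp (wholeDeriv μ) (l i) (wholeTranslate μ g v)).1 := fun g => by
      have h2 : w (proj Γ g) = translateC Γ g w (proj Γ 1) := by
        simp [rightTranslate_proj]
      rw [h2, htr, ContinuousMap.sum_apply]
      rfl
    simp only [h1]
    exact contMDiff_finsetSum fun i _ => (ContinuousLinearMap.contMDiff _).comp
      (contMDiff_foldOp_wholeTranslate μ (l i) v)
  refine ⟨⟨w, hsm⟩, Subtype.ext ?_⟩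
  rw [h v]
  rfl

/-- Smooth functions are the same as smooth vectors of `L²(X)`. -/
def smoothEquiv : SmoothFun n Γ ≃ₗ[ℂ] wholeSmooth n μ :=
  LinearEquiv.ofBijective (smoothClass μ) ⟨smoothClass_injective μ, smoothClass_surjective μ⟩

lemma smoothEquiv_apply (f : SmoothFun n Γ) : smoothEquiv μ f = smoothClass μ f := rfl

lemma smoothEquiv_symm_deriv (ξ : GroupLieAlgebra (𝓡 n) G) (v : wholeSmooth n μ) :
    (smoothEquiv μ).symm (wholeDeriv μ ξ v) = inducedField Γ ξ ((smoothEquiv μ).symm v) := by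
  rw [LinearEquiv.symm_apply_eq, smoothEquiv_apply, ← wholeDeriv_smoothClass, ← smoothEquiv_apply,
    LinearEquiv.apply_symm_apply]

-- In this form the formula shows that sup norms of smooth functions are controlled by `L²` norms of
-- finitely many derivatives.
variable (n) in
lemma exists_sobolev_fun : ∃ (ι : Type) (_ : Fintype ι)
      (S : ι → Lp ℂ 2 μ →L[ℂ] C(LeftQuotient Γ, ℂ)) (l : ι → List (GroupLieAlgebra (𝓡 n) G)),
      ∀ v : wholeSmooth n μ, toContinuousMap Γ ((smoothEquiv μ).symm v) =
        ∑ i, S i (foldOp (wholeDeriv μ) (l i) v).1 := by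
  obtain ⟨ι, _, S, l, h⟩ := exists_sobolev n μ
  refine ⟨ι, inferInstance, S, l, fun v => classC_injective μ ?_⟩
  rw [← h v, ← coe_smoothClass, ← smoothEquiv_apply, LinearEquiv.apply_symm_apply]

end SmoothClass

/-! ### Operators factoring through `C(X)` are compact. -/

section Compactness

open scoped InnerProductSpace

lemma isCompactOperator_rankOne {V : Type*} [NormedAddCommGroup V] [InnerProductSpace ℂ V]
    (φ : V →L[ℂ] ℂ) (w : V) : IsCompactOperator (φ.smulRight w) := by
  have h : IsCompactOperator ((ContinuousLinearMap.id ℂ ℂ).smulRight w) :=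
    isCompactOperator_of_locallyCompactSpace_rng _
  exact h.comp_clm φ

/-- Hilbert–Schmidt operators are compact. -/
lemma isCompactOperator_of_summable {V ι : Type*} [NormedAddCommGroup V] [InnerProductSpace ℂ V]
    [CompleteSpace V] (b : HilbertBasis ι ℂ V) (S : V →L[ℂ] V)
    (hS : Summable fun i => ‖S (b i)‖ ^ 2) : IsCompactOperator S := by
  let T : Finset ι → V →L[ℂ] V := fun s => ∑ i ∈ s, (innerSL ℂ (b i)).smulRight (S (b i))
  have hT : ∀ s v, T s v = ∑ i ∈ s, ⟪b i, v⟫_ℂ • S (b i) := fun s v => by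
    simp [T]
  have hlim : ∀ v, Filter.Tendsto (fun s => T s v) Filter.atTop (nhds (S v)) := fun v => by
    have h1 : HasSum (fun i => S (b.repr v i • b i)) (S v) := S.hasSum (b.hasSum_repr v)
    simp only [map_smul, b.repr_apply_apply] at h1
    simp only [hT]
    exact h1
  have hcomp : ∀ s, IsCompactOperator (T s) := fun s => by
    induction s using Finset.cons_induction with
    | empty => simpa [T] using isCompactOperator_zero
    | cons i s hi ih =>
      have h : T (Finset.cons i s hi) = (innerSL ℂ (b i)).smulRight (S (b i)) + T s := by
        simp [T]
      rw [h]
      exact (isCompactOperator_rankOne _ _).add ih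
  refine isCompactOperator_of_tendsto (l := Filter.atTop) (F := T) ?_
    (Filter.Eventually.of_forall hcomp)
  refine Metric.tendsto_nhds.2 fun ε hε => ?_
  obtain ⟨s, hs⟩ := summable_iff_vanishing_norm.1 hS ((ε / 2) ^ 2) (by positivity)
  filter_upwards [Filter.eventually_ge_atTop s] with t hst
  -- By Cauchy–Schwarz and Bessel, the difference of two truncations is bounded by a tail of `∑ ‖S
  -- (b i)‖²`; letting the larger truncation tend to `S` gives the estimate in operator norm.
  have hbound : ‖T t - S‖ ≤ ε / 2 := by
    refine ContinuousLinearMap.opNorm_le_bound _ (by positivity) fun v => ?_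
    have h1 : Filter.Tendsto (fun t' => ‖T t v - T t' v‖) Filter.atTop (nhds ‖T t v - S v‖) :=
      (tendsto_const_nhds.sub (hlim v)).norm
    refine le_of_tendsto h1 ?_
    filter_upwards [Filter.eventually_ge_atTop t] with t' ht'
    classical
    have h2 : T t' v - T t v = ∑ i ∈ t' \ t, ⟪b i, v⟫_ℂ • S (b i) := by
      rw [hT, hT, Finset.sum_sdiff_eq_sub ht']
    rw [norm_sub_rev, h2]
    have h3 : ∑ i ∈ t' \ t, ‖⟪b i, v⟫_ℂ‖ ^ 2 ≤ ‖v‖ ^ 2 :=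
      b.orthonormal.sum_inner_products_le v
    have h4 : ∑ i ∈ t' \ t, ‖S (b i)‖ ^ 2 ≤ (ε / 2) ^ 2 := by
      have := hs (t' \ t) (Finset.disjoint_of_subset_right hst Finset.sdiff_disjoint)
      exact (le_abs_self _).trans this.le
    have h5 := Finset.sum_mul_sq_le_sq_mul_sq (t' \ t) (fun i => ‖⟪b i, v⟫_ℂ‖) fun i => ‖S (b i)‖
    have h6 : (∑ i ∈ t' \ t, ‖⟪b i, v⟫_ℂ‖ * ‖S (b i)‖) ^ 2 ≤ (ε / 2 * ‖v‖) ^ 2 := by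
      refine h5.trans ?_
      rw [mul_pow, mul_comm]
      exact mul_le_mul h4 h3 (Finset.sum_nonneg fun _ _ => sq_nonneg _) (sq_nonneg _)
    calc ‖∑ i ∈ t' \ t, ⟪b i, v⟫_ℂ • S (b i)‖ ≤ ∑ i ∈ t' \ t, ‖⟪b i, v⟫_ℂ‖ * ‖S (b i)‖ :=
          (norm_sum_le _ _).trans_eq (Finset.sum_congr rfl fun _ _ => norm_smul _ _)
      _ ≤ ε / 2 * ‖v‖ := le_of_sq_le_sq h6 (by positivity)
  rw [dist_eq_norm]
  linarith

/-- Evaluation at `x` after `S'` is a functional of norm at most `‖S'‖`, so Riesz and Bessel give `∑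
‖S' (b i) x‖² ≤ ‖S'‖²` at every point. Integrating over the probability space shows that `S` is
Hilbert–Schmidt. -/
lemma isCompactOperator_of_lift {X : Type*} [TopologicalSpace X] [CompactSpace X]
    [SecondCountableTopology X] [MeasurableSpace X] [BorelSpace X] (μ : Measure X)
    [IsProbabilityMeasure μ] {S : Lp ℂ 2 μ →L[ℂ] Lp ℂ 2 μ} {S' : Lp ℂ 2 μ →L[ℂ] C(X, ℂ)}
    (h : ∀ v, ContinuousMap.toLp 2 μ ℂ (S' v) = S v) : IsCompactOperator S := by
  obtain ⟨w, b, -⟩ := exists_hilbertBasis ℂ (Lp ℂ 2 μ)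
  refine isCompactOperator_of_summable b S ?_
  refine summable_of_sum_le (c := ‖S'‖ ^ 2) (fun _ => sq_nonneg _) fun s => ?_
  have hpt : ∀ x, ∑ i ∈ s, ‖S' (b i) x‖ ^ 2 ≤ ‖S'‖ ^ 2 := fun x => by
    let φ : Lp ℂ 2 μ →L[ℂ] ℂ := (ContinuousMap.evalCLM ℂ x).comp S'
    have hφ : ‖φ‖ ≤ ‖S'‖ := by
      refine ContinuousLinearMap.opNorm_le_bound _ (norm_nonneg _) fun v => ?_
      exact ((S' v).norm_coe_le_norm x).trans (S'.le_opNorm v)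
    let k := (InnerProductSpace.toDual ℂ (Lp ℂ 2 μ)).symm φ
    have hk : ∀ i, ‖S' (b i) x‖ = ‖⟪b i, k⟫_ℂ‖ := fun i => by
      rw [← norm_inner_symm, InnerProductSpace.toDual_symm_apply]
      rfl
    simp only [hk]
    refine (b.orthonormal.sum_inner_products_le k).trans ?_
    rw [LinearIsometryEquiv.norm_map]
    exact pow_le_pow_left₀ (norm_nonneg _) hφ 2
  have hint : ∀ v, Integrable (fun x => ‖S' v x‖ ^ 2) μ := fun v =>
    ((S' v).continuous.norm.pow 2).integrable_of_hasCompactSupport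
      (HasCompactSupport.of_compactSpace _)
  have hnorm : ∀ v, ‖S v‖ ^ 2 = ∫ x, ‖S' v x‖ ^ 2 ∂μ := fun v => by
    have h1 : ((‖S v‖ ^ 2 : ℝ) : ℂ) = ((∫ x, ‖S' v x‖ ^ 2 ∂μ : ℝ) : ℂ) := by
      rw [← h v]
      have h2 := inner_self_eq_norm_sq_to_K (𝕜 := ℂ) (ContinuousMap.toLp (E := ℂ) 2 μ ℂ (S' v))
      rw [ContinuousMap.inner_toLp] at h2
      push_cast at h2 ⊢
      rw [← integral_complex_ofReal]
      refine h2.symm.trans (integral_congr_ae (Filter.Eventually.of_forall fun x => ?_))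
      simp only [Complex.mul_conj, Complex.normSq_eq_norm_sq]
    exact_mod_cast h1
  calc ∑ i ∈ s, ‖S (b i)‖ ^ 2 = ∫ x, ∑ i ∈ s, ‖S' (b i) x‖ ^ 2 ∂μ := by
        rw [integral_finsetSum _ fun i _ => hint _]
        exact Finset.sum_congr rfl fun i _ => hnorm _
    _ ≤ ∫ _, ‖S'‖ ^ 2 ∂μ := integral_mono (integrable_finsetSum _ fun i _ => hint _)
        (integrable_const _) hpt
    _ = ‖S'‖ ^ 2 := by simp

end Compactness

/-! ### Schur's lemma for unitary representations. -/

section Schur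

open scoped InnerProductSpace

variable {G : Type u} [TopologicalSpace G] [Group G]

lemma IrreducibleUnitaryRep.inner_rho (π : IrreducibleUnitaryRep G) (g : G) (v w : π.V) :
    ⟪π.ρ g v, w⟫_ℂ = ⟪v, π.ρ g⁻¹ w⟫_ℂ := by
  have h : π.ρ g⁻¹ (π.ρ g v) = v := by
    change (π.ρ g⁻¹ * π.ρ g) v = v
    rw [← map_mul]
    simp
  rw [← (π.ρ g⁻¹).inner_map_map, h]

/-- A self-adjoint operator commuting with an irreducible representation is a scalar. -/
lemma IrreducibleUnitaryRep.exists_eq_algebraMap (π : IrreducibleUnitaryRep G) (B : π.V →L[ℂ] π.V)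
    (hB : IsSelfAdjoint B) (hc : ∀ g v, B (π.ρ g v) = π.ρ g (B v)) :
    ∃ c : ℝ, B = algebraMap ℝ (π.V →L[ℂ] π.V) c := by
  have hsub : (spectrum ℝ B).Subsingleton := by
    intro x hx y hy
    by_contra hne
    wlog hlt : x < y generalizing x y
    · exact this hy hx (Ne.symm hne) (lt_of_le_of_ne (not_lt.1 hlt) (Ne.symm hne))
    -- The functions `f` and `k` live on opposite sides of the midpoint of two spectral values. Thus
    -- `f(B)` and `k(B)` are both nonzero, while their product is zero.
    let c := (x + y) / 2
    let f : ℝ → ℝ := fun t => max (t - c) 0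
    let k : ℝ → ℝ := fun t => max (c - t) 0
    have hf : Continuous f := by fun_prop
    have hk : Continuous k := by fun_prop
    have hmul : cfc f B * cfc k B = 0 := by
      rw [← cfc_mul f k B hf.continuousOn hk.continuousOn]
      have : (fun t => f t * k t) = fun _ => 0 := by
        funext t
        rcases le_total t c with h | h
        · simp [f, max_eq_right (sub_nonpos.2 h)]
        · simp [k, max_eq_right (sub_nonpos.2 h)]
      rw [this, cfc_const_zero]
    have hne0 : ∀ (q : ℝ → ℝ), Continuous q → (∃ z ∈ spectrum ℝ B, q z ≠ 0) → cfc q B ≠ 0 := by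
      rintro q hq ⟨z, hz, hqz⟩ h0
      have h1 : q z ∈ spectrum ℝ (cfc q B) := by
        rw [cfc_map_spectrum q B hB hq.continuousOn]
        exact ⟨z, hz, rfl⟩
      rw [h0, spectrum.zero_eq] at h1
      exact hqz h1
    have hf0 := hne0 f hf ⟨y, hy, by simp only [f, c]; exact (lt_max_of_lt_left (by linarith)).ne'⟩
    have hk0 := hne0 k hk ⟨x, hx, by simp only [k, c]; exact (lt_max_of_lt_left (by linarith)).ne'⟩
    have hcomm : ∀ g v, cfc f B (π.ρ g v) = π.ρ g (cfc f B v) := fun g v => by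
      have h1 : Commute B ((π.ρ g).toContinuousLinearEquiv : π.V →L[ℂ] π.V) := by
        ext v
        exact hc g v
      have h2 := hB.commute_cfc h1 f
      exact congrArg (fun T : π.V →L[ℂ] π.V => T v) h2
    -- The kernel of `f(B)` is closed and invariant and contains the range of `k(B)`: if it is `⊥`
    -- then `k(B) = 0`, if it is `⊤` then `f(B) = 0`.
    rcases π.irreducible (LinearMap.ker (cfc f B).toLinearMap) (cfc f B).isClosed_ker
      (fun g w hw => by
        have : cfc f B w = 0 := hw
        change cfc f B (π.ρ g w) = 0
        rw [hcomm, this, map_zero]) with h | h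
    · refine hk0 (ContinuousLinearMap.ext fun v => ?_)
      have h3 : cfc k B v ∈ LinearMap.ker (cfc f B).toLinearMap :=
        congrArg (fun T : π.V →L[ℂ] π.V => T v) hmul
      rw [h] at h3
      exact h3
    · refine hf0 (ContinuousLinearMap.ext fun v => ?_)
      have h3 : v ∈ LinearMap.ker (cfc f B).toLinearMap := h ▸ Submodule.mem_top
      exact h3
  rcases hsub.eq_empty_or_singleton with h | ⟨c, h⟩
  · exact ⟨0, CFC.eq_algebraMap_of_spectrum_subset_singleton B 0 (by simp [h]) hB⟩
  · exact ⟨c, CFC.eq_algebraMap_of_spectrum_subset_singleton B c h.le hB⟩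

/-- Schur's lemma: irreducible unitary representations with a nonzero intertwining operator between
them are equivalent. -/
lemma IrreducibleUnitaryRep.equiv_of_intertwiner {π σ : IrreducibleUnitaryRep G} (A : π.V →L[ℂ] σ.V)
    (hA : A ≠ 0) (hi : ∀ g v, A (π.ρ g v) = σ.ρ g (A v)) : π ≈ σ := by
  have hadj : ∀ g w, A.adjoint (σ.ρ g w) = π.ρ g (A.adjoint w) := fun g w => by
    refine ext_inner_right ℂ fun v => ?_
    rw [ContinuousLinearMap.adjoint_inner_left, σ.inner_rho, π.inner_rho,
      ContinuousLinearMap.adjoint_inner_left, hi]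
  -- As `A* A` commutes with `π`, it is a scalar `c`, which is positive. So `A / √c` is an isometry,
  -- and its closed invariant range is everything by irreducibility of `σ`.
  obtain ⟨c, hc⟩ := π.exists_eq_algebraMap (A.adjoint.comp A)
    (by
      rw [ContinuousLinearMap.isSelfAdjoint_iff_isSymmetric]
      intro v w
      change ⟪A.adjoint (A v), w⟫_ℂ = ⟪v, A.adjoint (A w)⟫_ℂ
      rw [ContinuousLinearMap.adjoint_inner_left, ContinuousLinearMap.adjoint_inner_right])
    fun g v => by simp only [ContinuousLinearMap.comp_apply, hi, hadj]
  have hnorm : ∀ v, ‖A v‖ ^ 2 = c * ‖v‖ ^ 2 := fun v => by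
    have h1 : A.adjoint (A v) = (c : ℂ) • v := by
      have := congrArg (fun T : π.V →L[ℂ] π.V => T v) hc
      simpa [Algebra.algebraMap_eq_smul_one] using this
    have h2 : ⟪A v, A v⟫_ℂ = (c : ℂ) * ⟪v, v⟫_ℂ := by
      rw [← ContinuousLinearMap.adjoint_inner_right, h1, inner_smul_right]
    rw [inner_self_eq_norm_sq_to_K, inner_self_eq_norm_sq_to_K] at h2
    exact Complex.ofReal_injective (by push_cast; exact h2)
  have hc0 : 0 < c := by
    obtain ⟨v, hv⟩ : ∃ v, A v ≠ 0 := by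
      by_contra! h
      exact hA (ContinuousLinearMap.ext h)
    by_contra! h
    have h1 := hnorm v
    have h2 : 0 < ‖A v‖ ^ 2 := by
      have := norm_pos_iff.2 hv
      positivity
    nlinarith [sq_nonneg ‖v‖]
  let U : π.V →ₗᵢ[ℂ] σ.V :=
    { ((((Real.sqrt c)⁻¹ : ℝ) : ℂ) • A : π.V →ₗ[ℂ] σ.V) with
      norm_map' := fun v => by
        change ‖(((Real.sqrt c)⁻¹ : ℝ) : ℂ) • A v‖ = ‖v‖
        have h1 : ‖A v‖ = Real.sqrt c * ‖v‖ := by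
          rw [← Real.sqrt_sq (norm_nonneg (A v)), hnorm, Real.sqrt_mul hc0.le,
            Real.sqrt_sq (norm_nonneg v)]
        have h2 := Real.sqrt_pos.2 hc0
        rw [norm_smul, Complex.norm_real, Real.norm_of_nonneg (by positivity), h1]
        field_simp }
  have hU : ∀ v, U v = (((Real.sqrt c)⁻¹ : ℝ) : ℂ) • A v := fun v => rfl
  have hUi : ∀ g v, U (π.ρ g v) = σ.ρ g (U v) := fun g v => by rw [hU, hU, hi, map_smul]
  have hsurj : Function.Surjective U := by
    rcases σ.irreducible (LinearMap.range U.toLinearMap) U.isometry.isClosedEmbedding.isClosed_range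
      (by
        rintro g _ ⟨v, rfl⟩
        exact ⟨π.ρ g v, hUi g v⟩) with h | h
    · obtain ⟨v, hv⟩ := exists_ne (0 : π.V)
      have h1 : U v ∈ LinearMap.range U.toLinearMap := ⟨v, rfl⟩
      rw [h, Submodule.mem_bot] at h1
      exact absurd (U.injective (h1.trans (map_zero U).symm)) hv
    · intro w
      have h1 : w ∈ LinearMap.range U.toLinearMap := h ▸ Submodule.mem_top
      exact h1
  exact ⟨LinearIsometryEquiv.ofSurjective U hsurj, hUi⟩

end Schur

/-! ### Discrete decomposition of `L²(X)`. -/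

section Decomposition

open scoped InnerProductSpace

variable {n : ℕ} {G : Type u} [TopologicalSpace G]
  [ChartedSpace (EuclideanSpace ℝ (Fin n)) G] [Group G] [LieGroup (𝓡 n) ∞ G]
  [IsTopologicalGroup G] [SecondCountableTopology G]
  {Γ : Subgroup G} [CompactSpace (LeftQuotient Γ)]
  [T2Space (LeftQuotient Γ)] [SecondCountableTopology (LeftQuotient Γ)]
  (μ : Measure (LeftQuotient Γ)) [IsProbabilityMeasure μ] [IsRightInvariant μ]

/-- Closed subspaces of `L²(X)` which are invariant under the regular representation. -/
def IsInvariantSubspace (H : Submodule ℂ (Lp ℂ 2 μ)) : Prop :=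
  IsClosed (H : Set (Lp ℂ 2 μ)) ∧ ∀ g : G, ∀ w ∈ H, regularRep μ g w ∈ H

variable {μ}

lemma IsInvariantSubspace.orthogonal {H : Submodule ℂ (Lp ℂ 2 μ)} (hH : IsInvariantSubspace μ H) :
    IsInvariantSubspace μ Hᗮ := by
  refine ⟨H.isClosed_orthogonal, fun g w hw => ?_⟩
  rw [Submodule.mem_orthogonal] at hw ⊢
  intro v hv
  have h := inner_regularRep μ g⁻¹ v w
  rw [inv_inv] at h
  rw [← h]
  exact hw _ (hH.2 _ _ hv)

/-- An operator preserving `K` and its orthogonal complement commutes with the projection. -/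
lemma starProjection_comm {V : Type*} [NormedAddCommGroup V] [InnerProductSpace ℂ V]
    {K : Submodule ℂ V} [K.HasOrthogonalProjection] (T : V →ₗ[ℂ] V) (h1 : ∀ v ∈ K, T v ∈ K)
    (h2 : ∀ v ∈ Kᗮ, T v ∈ Kᗮ) (v : V) : K.starProjection (T v) = T (K.starProjection v) := by
  refine Submodule.eq_starProjection_of_mem_orthogonal (h1 _ (K.starProjection_apply_mem v)) ?_
  rw [← map_sub]
  exact h2 _ (K.sub_starProjection_mem_orthogonal v)

/-- The orthogonal complement of `H` is invariant too, so `S` preserves it, and therefore `S*`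
preserves its complement, which is `H`. -/
lemma adjoint_mem_of_invariant {S : Lp ℂ 2 μ →L[ℂ] Lp ℂ 2 μ}
    (hS : ∀ H, IsInvariantSubspace μ H → ∀ w ∈ H, S w ∈ H) {H : Submodule ℂ (Lp ℂ 2 μ)}
    (hH : IsInvariantSubspace μ H) {w : Lp ℂ 2 μ} (hw : w ∈ H) : S.adjoint w ∈ H := by
  have : CompleteSpace H := hH.1.completeSpace_coe
  rw [← H.orthogonal_orthogonal, Submodule.mem_orthogonal]
  intro v hv
  rw [ContinuousLinearMap.adjoint_inner_right]
  exact (Submodule.mem_orthogonal' _ _).1 (hS _ hH.orthogonal v hv) _ hw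

lemma isSymmetric_adjoint_comp_self {V : Type*} [NormedAddCommGroup V] [InnerProductSpace ℂ V]
    [CompleteSpace V] (S : V →L[ℂ] V) : (S.adjoint.comp S : V →ₗ[ℂ] V).IsSymmetric := fun v w => by
  change ⟪S.adjoint (S v), w⟫_ℂ = ⟪v, S.adjoint (S w)⟫_ℂ
  rw [ContinuousLinearMap.adjoint_inner_left, ContinuousLinearMap.adjoint_inner_right]

lemma isCompactOperator_adjoint_comp_self {V : Type*} [NormedAddCommGroup V]
    [InnerProductSpace ℂ V] [CompleteSpace V] {S : V →L[ℂ] V} (hS : IsCompactOperator S) :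
    IsCompactOperator (S.adjoint.comp S) :=
  hS.clm_comp S.adjoint

lemma adjoint_apply_self_ne_zero {V : Type*} [NormedAddCommGroup V] [InnerProductSpace ℂ V]
    [CompleteSpace V] {S : V →L[ℂ] V} {v : V} (hv : S v ≠ 0) : S.adjoint (S v) ≠ 0 := fun h => by
  have h1 := ContinuousLinearMap.adjoint_inner_left S v (S v)
  rw [h, inner_zero_left] at h1
  exact hv (inner_self_eq_zero.1 h1.symm)

/-- A compact symmetric operator which does not vanish on the closed subspace `H` that it preserves
has an eigenvector in `H` with nonzero eigenvalue. -/
lemma exists_eigenvector_mem {V : Type*} [NormedAddCommGroup V] [InnerProductSpace ℂ V]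
    [CompleteSpace V] {B : V →L[ℂ] V} (hBc : IsCompactOperator B)
    (hBs : (B : V →ₗ[ℂ] V).IsSymmetric) {H : Submodule ℂ V} (hH : IsClosed (H : Set V))
    (hBi : ∀ w ∈ H, B w ∈ H) {v : V} (hvH : v ∈ H) (hBv : B v ≠ 0) :
    ∃ c : ℂ, c ≠ 0 ∧ ∃ w ∈ H, w ≠ 0 ∧ B w = c • w := by
  have hcH : CompleteSpace H := hH.completeSpace_coe
  let BH : H →L[ℂ] H := B.restrict hBi
  have hBHc : IsCompactOperator BH := hBc.restrict' hBi
  have hBHs : (BH : H →ₗ[ℂ] H).IsSymmetric := hBs.restrict_invariant hBi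
  have hBH0 : BH ≠ 0 := fun h => hBv (congrArg Subtype.val (congrArg (fun T : H →L[ℂ] H => T ⟨v, hvH⟩) h))
  obtain ⟨c, hc, hc0⟩ : ∃ c, Module.End.HasEigenvalue (BH : Module.End ℂ H) c ∧ c ≠ 0 := by
    by_contra! h
    exact hBH0 ((ContinuousLinearMap.eq_zero_of_forall_hasEigenvalue_eq_zero hBHc hBHs).1 h)
  obtain ⟨w, hw⟩ := hc.exists_hasEigenvector
  exact ⟨c, hc0, w.1, w.2, fun h => hw.2 (Subtype.ext h), congrArg Subtype.val hw.apply_eq_smul⟩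

lemma exists_symmetric_of_isCompactOperator {V : Type*} [NormedAddCommGroup V]
    [InnerProductSpace ℂ V] [CompleteSpace V] {S : V →L[ℂ] V} (hS : IsCompactOperator S) {v : V}
    (hv : S v ≠ 0) : ∃ B : V →L[ℂ] V, IsCompactOperator B ∧ (B : V →ₗ[ℂ] V).IsSymmetric ∧ B v ≠ 0 ∧
      ∀ w, B w = S.adjoint (S w) :=
  ⟨S.adjoint.comp S, isCompactOperator_adjoint_comp_self hS, isSymmetric_adjoint_comp_self S,
    adjoint_apply_self_ne_zero hv, fun _ => rfl⟩

-- Take `S* S` for a smoothing operator with `S v ≠ 0`; it does not kill `v`, because `⟪S* S v, v⟫ =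
-- ‖S v‖²`.
include n in
lemma exists_compact_symmetric {v : Lp ℂ 2 μ} (hv : v ≠ 0) :
    ∃ B : Lp ℂ 2 μ →L[ℂ] Lp ℂ 2 μ, IsCompactOperator B ∧
      (B : Lp ℂ 2 μ →ₗ[ℂ] Lp ℂ 2 μ).IsSymmetric ∧ B v ≠ 0 ∧
      ∀ K, IsInvariantSubspace μ K → ∀ w ∈ K, B w ∈ K := by
  obtain ⟨S, S', hSS', hSv, hinv⟩ := exists_smoothing n μ hv
  have hinv' : ∀ K, IsInvariantSubspace μ K → ∀ w ∈ K, S w ∈ K := fun K hK => hinv K hK.1 hK.2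
  have hc := isCompactOperator_of_lift μ hSS'
  obtain ⟨B, hBc, hBs, hBv, hB⟩ := exists_symmetric_of_isCompactOperator hc hSv
  refine ⟨B, hBc, hBs, hBv, fun K hK w hw => ?_⟩
  rw [hB]
  exact adjoint_mem_of_invariant hinv' hK (hinv' K hK w hw)

include n in
/-- There is a finite dimensional space which meets `H` and is preserved by the projections onto all
closed invariant subspaces. -/
lemma IsInvariantSubspace.exists_finiteDimensional {H : Submodule ℂ (Lp ℂ 2 μ)}
    (hH : IsInvariantSubspace μ H) (h0 : H ≠ ⊥) :
    ∃ E : Submodule ℂ (Lp ℂ 2 μ), FiniteDimensional ℂ E ∧ H ⊓ E ≠ ⊥ ∧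
      ∀ U, IsInvariantSubspace μ U → ∀ x ∈ E, ∃ y ∈ U ⊓ E, x - y ∈ Uᗮ := by
  obtain ⟨v, hvH, hv⟩ := H.exists_mem_ne_zero_of_ne_bot h0
  obtain ⟨B, hBc, hBs, hBv, hBi⟩ := exists_compact_symmetric (n := n) hv
  obtain ⟨c, hc0, w, hwH, hw0, hwc⟩ := exists_eigenvector_mem hBc hBs hH.1 (hBi H hH) hvH hBv
  have hE : ∀ w, w ∈ Module.End.eigenspace B.toLinearMap c ↔ B w = c • w := fun w =>
    Module.End.mem_eigenspace_iff
  -- The space is an eigenspace of a compact operator for a nonzero eigenvalue, hence finite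
  -- dimensional. Projections onto invariant subspaces commute with `B` and so preserve it.
  refine ⟨Module.End.eigenspace B.toLinearMap c,
    ContinuousLinearMap.finite_dimensional_eigenspace hBc c hc0,
    (Submodule.ne_bot_iff _).2 ⟨w, ⟨hwH, (hE _).2 hwc⟩, hw0⟩, fun U hU x hx => ?_⟩
  have hcU : CompleteSpace U := hU.1.completeSpace_coe
  refine ⟨U.starProjection x, ⟨U.starProjection_apply_mem x, (hE _).2 ?_⟩,
    U.sub_starProjection_mem_orthogonal x⟩
  have h1 := starProjection_comm B.toLinearMap (hBi U hU) (hBi _ hU.orthogonal) x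
  refine h1.symm.trans ?_
  change U.starProjection (B x) = _
  rw [(hE x).1 hx, map_smul]

include n in
/-- A closed invariant subspace other than zero contains a minimal one. -/
lemma IsInvariantSubspace.exists_irreducible {H : Submodule ℂ (Lp ℂ 2 μ)}
    (hH : IsInvariantSubspace μ H) (h0 : H ≠ ⊥) :
    ∃ W ≤ H, IsInvariantSubspace μ W ∧ W ≠ ⊥ ∧
      ∀ U ≤ W, IsInvariantSubspace μ U → U = ⊥ ∨ U = W := by
  obtain ⟨E, hfin, hHE, hproj⟩ := hH.exists_finiteDimensional (n := n) h0
  have hfinU : ∀ U : Submodule ℂ (Lp ℂ 2 μ), FiniteDimensional ℂ (U ⊓ E : Submodule ℂ _) := fun U =>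
    Submodule.finiteDimensional_of_le inf_le_right
  have hex : ∃ d, ∃ U ≤ H, IsInvariantSubspace μ U ∧ U ⊓ E ≠ ⊥ ∧
      Module.finrank ℂ (U ⊓ E : Submodule ℂ _) = d := by
    exact ⟨_, H, le_rfl, hH, hHE, rfl⟩
  classical
  -- Among the invariant subspaces of `H` that meet `E`, choose `W` with `W ⊓ E` of least dimension.
  -- The closed cyclic subspace `Y` of any nonzero `x ∈ W ⊓ E` is then minimal.
  obtain ⟨W, hWH, hW, hWE, hWd⟩ := Nat.find_spec hex
  obtain ⟨x, hx, hx0⟩ := (W ⊓ E).exists_mem_ne_zero_of_ne_bot hWE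
  let Y := (Submodule.span ℂ (Set.range fun g : G => regularRep μ g x)).topologicalClosure
  have hYi : IsInvariantSubspace μ Y := by
    refine ⟨Submodule.isClosed_topologicalClosure _, fun g w hw => ?_⟩
    refine map_mem_closure (regularRep μ g).continuous hw fun y hy => ?_
    have : Submodule.span ℂ (Set.range fun g : G => regularRep μ g x) ≤
        (Submodule.span ℂ (Set.range fun g : G => regularRep μ g x)).comap
          (regularRep μ g).toLinearMap := by
      refine Submodule.span_le.2 ?_
      rintro _ ⟨g', rfl⟩
      exact Submodule.subset_span ⟨g * g', regularRep_mul μ g g' x⟩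
    exact this hy
  have hYmin : ∀ U, IsInvariantSubspace μ U → x ∈ U → Y ≤ U := fun U hU hxU => by
    refine Submodule.topologicalClosure_minimal _ (Submodule.span_le.2 ?_) hU.1
    rintro _ ⟨g, rfl⟩
    exact hU.2 g x hxU
  have hxY : x ∈ Y := Submodule.le_topologicalClosure _
    (Submodule.subset_span ⟨1, regularRep_one μ x⟩)
  refine ⟨Y, (hYmin W hW hx.1).trans hWH, hYi, (Submodule.ne_bot_iff _).2 ⟨x, hxY, hx0⟩,
    fun U hUY hU => ?_⟩
  -- Here `y` is the projection of `x` to `U`. If it vanishes, then `x`, and with it `Y`, is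
  -- orthogonal to `U ≤ Y`, so `U = ⊥`. Otherwise `U` meets `E`, the choice of `W` forces `U ⊓ E = W
  -- ⊓ E`, and `x ∈ U`.
  obtain ⟨y, hyU, hxy⟩ := hproj U hU x hx.2
  by_cases hy0 : y = 0
  · left
    rw [hy0, sub_zero] at hxy
    have h2 := hUY.trans (hYmin _ hU.orthogonal hxy)
    rw [eq_bot_iff]
    intro y hy
    exact inner_self_eq_zero.1 ((Submodule.mem_orthogonal _ _).1 (h2 hy) y hy)
  · right
    refine le_antisymm hUY (hYmin U hU ?_)
    have hUW : U ≤ W := hUY.trans (hYmin W hW hx.1)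
    have h1 : Nat.find hex ≤ Module.finrank ℂ (U ⊓ E : Submodule ℂ _) :=
      Nat.find_min' hex ⟨U, hUW.trans hWH, hU, (Submodule.ne_bot_iff _).2 ⟨y, hyU, hy0⟩, rfl⟩
    have h2 : U ⊓ E = W ⊓ E :=
      Submodule.eq_of_le_of_finrank_le (inf_le_inf_right E hUW) (hWd.trans_le h1)
    have h3 : x ∈ U ⊓ E := h2 ▸ hx
    exact h3.1

/-- The regular representation restricted to an invariant subspace. -/
def IsInvariantSubspace.restrict {H : Submodule ℂ (Lp ℂ 2 μ)} (hH : IsInvariantSubspace μ H) :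
    G →* (H ≃ₗᵢ[ℂ] H) where
  toFun g :=
    { toFun := fun v => ⟨regularRep μ g v, hH.2 g v v.2⟩
      invFun := fun v => ⟨regularRep μ g⁻¹ v, hH.2 g⁻¹ v v.2⟩
      left_inv := fun v => Subtype.ext <| by
        change regularRep μ g⁻¹ (regularRep μ g v) = v
        rw [← regularRep_mul, inv_mul_cancel, regularRep_one]
      right_inv := fun v => Subtype.ext <| by
        change regularRep μ g (regularRep μ g⁻¹ v) = v
        rw [← regularRep_mul, mul_inv_cancel, regularRep_one]
      map_add' := fun v w => Subtype.ext (map_add (regularRep μ g) v.1 w.1)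
      map_smul' := fun c v => Subtype.ext (map_smul (regularRep μ g) c v.1)
      norm_map' := fun v => (regularRep μ g).norm_map v.1 }
  map_one' := by
    refine LinearIsometryEquiv.ext fun v => Subtype.ext ?_
    change regularRep μ 1 v.1 = v.1
    rw [regularRep_one]
  map_mul' g h := by
    refine LinearIsometryEquiv.ext fun v => Subtype.ext ?_
    exact regularRep_mul μ g h v.1

/-- A minimal `W` is itself an irreducible representation. The chosen representative of its class
maps isometrically onto `W`, and this map is an intertwiner into `L²(X)`. -/
lemma IsInvariantSubspace.exists_le_isotypic {W : Submodule ℂ (Lp ℂ 2 μ)}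
    (hW : IsInvariantSubspace μ W) (h0 : W ≠ ⊥)
    (hirr : ∀ U ≤ W, IsInvariantSubspace μ U → U = ⊥ ∨ U = W) :
    ∃ π : UnitaryDual G, W ≤ isotypic μ π := by
  have hcW : CompleteSpace W := hW.1.completeSpace_coe
  have hnW : Nontrivial W := Submodule.nontrivial_iff_ne_bot.2 h0
  let σ : IrreducibleUnitaryRep G :=
    { V := W
      ρ := hW.restrict
      continuous_apply := fun v =>
        Continuous.subtype_mk (continuous_regularRep μ v.1) _
      irreducible := fun U hU hUi => by
        have h1 : IsInvariantSubspace μ (U.map W.subtype) := by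
          refine ⟨?_, ?_⟩
          · rw [Submodule.map_coe]
            exact (hW.1.isClosedEmbedding_subtypeVal.isClosedMap) _ hU
          · rintro g _ ⟨w, hw, rfl⟩
            exact ⟨_, hUi g w hw, rfl⟩
        rcases hirr _ (Submodule.map_subtype_le _ _) h1 with h | h
        · left
          exact Submodule.map_injective_of_injective W.injective_subtype (h.trans (Submodule.map_bot _).symm)
        · right
          refine Submodule.map_injective_of_injective W.injective_subtype ?_
          rw [h, Submodule.map_subtype_top] }
  let π : UnitaryDual G := Quotient.mk (unitaryEquivalence G) σ
  obtain ⟨T, hT⟩ : π.rep ≈ σ := Quotient.mk_out σ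
  refine ⟨π, fun w hw => Submodule.le_topologicalClosure _ ?_⟩
  let A : π.rep.V →L[ℂ] Lp ℂ 2 μ := W.subtypeL.comp (T.toContinuousLinearEquiv : π.rep.V →L[ℂ] W)
  have hA : A ∈ intertwiners μ π.rep := fun g v => congrArg Subtype.val (hT g v)
  refine (le_iSup₂_of_le (f := fun (T : π.rep.V →L[ℂ] Lp ℂ 2 μ) (_ : T ∈ intertwiners μ π.rep) =>
    LinearMap.range (T : π.rep.V →ₗ[ℂ] Lp ℂ 2 μ)) A hA le_rfl) ⟨T.symm ⟨w, hw⟩, ?_⟩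
  exact congrArg Subtype.val (T.apply_symm_apply ⟨w, hw⟩)

variable (μ)

lemma isInvariantSubspace_isotypic (π : UnitaryDual G) : IsInvariantSubspace μ (isotypic μ π) :=
  ⟨Submodule.isClosed_topologicalClosure _, fun g _ => regularRep_mem_isotypic μ π g⟩

instance (π : UnitaryDual G) : CompleteSpace (isotypic μ π) :=
  (isInvariantSubspace_isotypic μ π).1.completeSpace_coe

/-- For intertwiners `T` and `S` the operator `S* T` intertwines the two irreducible
representations, so by Schur's lemma it vanishes and the ranges are orthogonal. This passes to sums
and closures. -/
lemma isotypic_isOrtho {π σ : UnitaryDual G} (h : π ≠ σ) : isotypic μ π ⟂ isotypic μ σ := by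
  have key : ∀ T ∈ intertwiners μ π.rep, ∀ S ∈ intertwiners μ σ.rep, ∀ x y, ⟪S y, T x⟫_ℂ = 0 := by
    intro T hT S hS x y
    by_cases hA : S.adjoint.comp T = 0
    · rw [← ContinuousLinearMap.adjoint_inner_right]
      have : S.adjoint (T x) = 0 := congrArg (fun A : π.rep.V →L[ℂ] σ.rep.V => A x) hA
      rw [this, inner_zero_right]
    · refine absurd (Quotient.out_equiv_out.1
        (IrreducibleUnitaryRep.equiv_of_intertwiner (π := π.rep) (σ := σ.rep) _ hA ?_)) h
      intro g v
      refine ext_inner_right ℂ fun w => ?_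
      change ⟪S.adjoint (T _), w⟫_ℂ = ⟪σ.rep.ρ g (S.adjoint (T v)), w⟫_ℂ
      rw [ContinuousLinearMap.adjoint_inner_left, IrreducibleUnitaryRep.inner_rho,
        ContinuousLinearMap.adjoint_inner_left, hT, hS, inner_regularRep]
  rw [Submodule.isOrtho_iff_le]
  refine Submodule.topologicalClosure_minimal _ (iSup₂_le fun T hT => ?_)
    (Submodule.isClosed_orthogonal _)
  rw [← Submodule.isOrtho_iff_le, Submodule.isOrtho_comm, Submodule.isOrtho_iff_le]
  refine Submodule.topologicalClosure_minimal _ (iSup₂_le fun S hS => ?_)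
    (Submodule.isClosed_orthogonal _)
  rintro _ ⟨y, rfl⟩
  rw [Submodule.mem_orthogonal']
  rintro _ ⟨x, rfl⟩
  exact key T hT S hS x y

-- If nonzero, this invariant subspace would contain a minimal one, which lies in some isotypic
-- component and would thus be orthogonal to itself.
include n in
lemma orthogonal_iSup_isotypic : (⨆ π : UnitaryDual G, isotypic μ π)ᗮ = ⊥ := by
  by_contra h
  have hinv : IsInvariantSubspace μ (⨆ π : UnitaryDual G, isotypic μ π)ᗮ := by
    refine ⟨Submodule.isClosed_orthogonal _, fun g w hw => ?_⟩
    rw [← Submodule.iInf_orthogonal, Submodule.mem_iInf] at hw ⊢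
    exact fun π => (isInvariantSubspace_isotypic μ π).orthogonal.2 g w (hw π)
  obtain ⟨W, hW, hWi, hW0, hirr⟩ := hinv.exists_irreducible (n := n) h
  obtain ⟨π, hπ⟩ := hWi.exists_le_isotypic hW0 hirr
  refine hW0 (eq_bot_iff.2 fun w hw => ?_)
  exact inner_self_eq_zero.1 ((Submodule.mem_orthogonal _ _).1 (hW hw) w
    (le_iSup (isotypic μ) π (hπ hw)))

/-- The orthogonal projection of `L²(X)` onto the isotypic component `H(π)`. -/
def isotypicProj (π : UnitaryDual G) : Lp ℂ 2 μ →L[ℂ] Lp ℂ 2 μ := (isotypic μ π).starProjection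

lemma isotypicProj_mem (π : UnitaryDual G) (v : Lp ℂ 2 μ) : isotypicProj μ π v ∈ isotypic μ π :=
  Submodule.starProjection_apply_mem _ v

lemma isotypicProj_of_mem {π : UnitaryDual G} {v : Lp ℂ 2 μ} (hv : v ∈ isotypic μ π) :
    isotypicProj μ π v = v :=
  Submodule.starProjection_eq_self_iff.2 hv

lemma isotypicProj_of_mem_of_ne {π σ : UnitaryDual G} (h : π ≠ σ) {v : Lp ℂ 2 μ}
    (hv : v ∈ isotypic μ π) : isotypicProj μ σ v = 0 :=
  (Submodule.starProjection_apply_eq_zero_iff _).2 (isotypic_isOrtho μ h hv)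

lemma isotypicProj_regularRep (π : UnitaryDual G) (g : G) (v : Lp ℂ 2 μ) :
    isotypicProj μ π (regularRep μ g v) = regularRep μ g (isotypicProj μ π v) :=
  starProjection_comm (regularRep μ g).toLinearMap ((isInvariantSubspace_isotypic μ π).2 g)
    ((isInvariantSubspace_isotypic μ π).orthogonal.2 g) v

include n in
lemma hasSum_isotypicProj (v : Lp ℂ 2 μ) :
    HasSum (fun π : UnitaryDual G => isotypicProj μ π v) v := by
  have hsum : IsHilbertSum ℂ (fun π : UnitaryDual G => isotypic μ π)
      fun π => (isotypic μ π).subtypeₗᵢ := by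
    refine IsHilbertSum.mkInternal (F := isotypic μ) (OrthogonalFamily.of_pairwise fun π σ h => ?_) ?_
    · exact isotypic_isOrtho μ h
    · rw [← Submodule.orthogonal_orthogonal_eq_closure, orthogonal_iSup_isotypic (n := n)]
      simp
  have h1 := hsum.hasSum_linearIsometryEquiv_symm (hsum.linearIsometryEquiv v)
  rw [LinearIsometryEquiv.symm_apply_apply] at h1
  have h2 : ∀ σ, isotypicProj μ σ v = hsum.linearIsometryEquiv v σ := fun σ => by
    have h3 := (isotypicProj μ σ).hasSum h1
    refine h3.unique ?_
    have h4 := hasSum_single (f := fun π => isotypicProj μ σ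
      ((isotypic μ π).subtypeₗᵢ (hsum.linearIsometryEquiv v π))) σ fun π h =>
        isotypicProj_of_mem_of_ne μ h (Subtype.mem _)
    convert h4 using 1
    exact (isotypicProj_of_mem μ (Subtype.mem _)).symm
  simp only [h2]
  exact h1

end Decomposition

/-! ### Induced fields as operators. -/

section FieldOp

variable {n : ℕ} {G : Type u} [TopologicalSpace G]
  [ChartedSpace (EuclideanSpace ℝ (Fin n)) G] [Group G] [LieGroup (𝓡 n) ∞ G]

/-- The induced vector fields as linear operators. -/
abbrev fieldOp (Γ : Subgroup G) (ξ : GroupLieAlgebra (𝓡 n) G) : SmoothFun n Γ →ₗ[ℂ] SmoothFun n Γ :=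
  (inducedField Γ ξ : SmoothFun n Γ →ₗ[ℂ] SmoothFun n Γ)

end FieldOp

/-! ### Isotypic components of smooth functions. -/

section IsotypicFunctions

variable {n : ℕ} {G : Type u} [TopologicalSpace G]
  [ChartedSpace (EuclideanSpace ℝ (Fin n)) G] [Group G] [LieGroup (𝓡 n) ∞ G]
  {Γ : Subgroup G} (μ : Measure (LeftQuotient Γ)) [IsRightInvariant μ]

/-- The inclusion of the smooth vectors of an isotypic component into those of `L²(X)`. -/
def isotypicIncl (π : UnitaryDual G) : SmoothVectors n μ π →ₗ[ℂ] wholeSmooth n μ where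
  toFun v := ⟨toLp n μ π v, v.2.2⟩
  map_add' _ _ := rfl
  map_smul' _ _ := rfl

lemma isotypicIncl_deriv (π : UnitaryDual G) (ξ : GroupLieAlgebra (𝓡 n) G)
    (v : SmoothVectors n μ π) :
    isotypicIncl μ π (derivedAction μ π ξ v) = wholeDeriv μ ξ (isotypicIncl μ π v) := rfl

variable [IsTopologicalGroup G] [SecondCountableTopology G] [CompactSpace (LeftQuotient Γ)]
  [T2Space (LeftQuotient Γ)] [SecondCountableTopology (LeftQuotient Γ)] [IsProbabilityMeasure μ]

lemma regularRep_isotypicProj (π : UnitaryDual G) (v : Lp ℂ 2 μ) :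
    (fun g => regularRep μ g (isotypicProj μ π v)) =
      fun g => (isotypicProj μ π).restrictScalars ℝ (regularRep μ g v) :=
  funext fun g => (isotypicProj_regularRep μ π g v).symm

/-- The projection of the smooth vectors of `L²(X)` to those of an isotypic component. -/
def isotypicSmoothProj (π : UnitaryDual G) : wholeSmooth n μ →ₗ[ℂ] SmoothVectors n μ π where
  toFun v := ⟨isotypicProj μ π v.1, isotypicProj_mem μ π v.1, by
    rw [regularRep_isotypicProj]
    exact ((isotypicProj μ π).restrictScalars ℝ).contMDiff.comp v.2⟩
  map_add' v w := Subtype.ext (map_add (isotypicProj μ π) v.1 w.1)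
  map_smul' c v := Subtype.ext (map_smul (isotypicProj μ π) c v.1)

lemma isotypicSmoothProj_deriv (π : UnitaryDual G) (ξ : GroupLieAlgebra (𝓡 n) G)
    (v : wholeSmooth n μ) :
    isotypicSmoothProj μ π (wholeDeriv μ ξ v) = derivedAction μ π ξ (isotypicSmoothProj μ π v) := by
  apply toLp_injective
  have h := lieDeriv_clm ((isotypicProj μ π).restrictScalars ℝ) ξ v.2 1
  rw [← regularRep_isotypicProj] at h
  exact h.symm

lemma isotypicSmoothProj_incl (π : UnitaryDual G) (v : SmoothVectors n μ π) :
    isotypicSmoothProj μ π (isotypicIncl μ π v) = v :=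
  toLp_injective μ π (isotypicProj_of_mem μ v.2.1)

lemma isotypicSmoothProj_incl_of_ne {π σ : UnitaryDual G} (h : π ≠ σ) (v : SmoothVectors n μ π) :
    isotypicSmoothProj μ σ (isotypicIncl μ π v) = 0 :=
  toLp_injective μ σ ((isotypicProj_of_mem_of_ne μ h v.2.1).trans (map_zero (toLp n μ σ)).symm)

/-- Smooth vectors of an isotypic component, as smooth functions on `X`. -/
def isotypicToFun (π : UnitaryDual G) : SmoothVectors n μ π →ₗ[ℂ] SmoothFun n Γ :=
  (smoothEquiv μ).symm.toLinearMap ∘ₗ isotypicIncl μ π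

/-- The component of a smooth function on `X` in `H(π)^∞`. -/
def isotypicOfFun (π : UnitaryDual G) : SmoothFun n Γ →ₗ[ℂ] SmoothVectors n μ π :=
  isotypicSmoothProj μ π ∘ₗ (smoothEquiv μ).toLinearMap

lemma isotypicToFun_deriv (π : UnitaryDual G) (ξ : GroupLieAlgebra (𝓡 n) G)
    (v : SmoothVectors n μ π) :
    isotypicToFun μ π (derivedAction μ π ξ v) = inducedField Γ ξ (isotypicToFun μ π v) :=
  smoothEquiv_symm_deriv μ ξ (isotypicIncl μ π v)

lemma isotypicOfFun_deriv (π : UnitaryDual G) (ξ : GroupLieAlgebra (𝓡 n) G) (f : SmoothFun n Γ) :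
    isotypicOfFun μ π (inducedField Γ ξ f) = derivedAction μ π ξ (isotypicOfFun μ π f) := by
  refine Eq.trans (congrArg (isotypicSmoothProj μ π) ?_) (isotypicSmoothProj_deriv μ π ξ _)
  exact (wholeDeriv_smoothClass μ ξ f).symm

lemma isotypicOfFun_toFun (π : UnitaryDual G) (v : SmoothVectors n μ π) :
    isotypicOfFun μ π (isotypicToFun μ π v) = v := by
  simp [isotypicOfFun, isotypicToFun, isotypicSmoothProj_incl]

lemma isotypicOfFun_toFun_of_ne {π σ : UnitaryDual G} (h : π ≠ σ) (v : SmoothVectors n μ π) :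
    isotypicOfFun μ σ (isotypicToFun μ π v) = 0 := by
  simp [isotypicOfFun, isotypicToFun, isotypicSmoothProj_incl_of_ne μ h]

lemma classC_isotypicToFun (π : UnitaryDual G) (v : SmoothVectors n μ π) :
    classC μ (toContinuousMap Γ (isotypicToFun μ π v)) = toLp n μ π v := by
  have h : smoothEquiv μ (isotypicToFun μ π v) = isotypicIncl μ π v :=
    LinearEquiv.apply_symm_apply _ _
  exact congrArg Subtype.val h

lemma isotypicToFun_ae_eq (π : UnitaryDual G) (v : SmoothVectors n μ π) :
    (isotypicToFun μ π v : LeftQuotient Γ → ℂ) =ᵐ[μ] toLp n μ π v := by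
  rw [← classC_isotypicToFun]
  exact (coeFn_classC μ (toContinuousMap Γ (isotypicToFun μ π v))).symm

/-- A smooth function is determined by its class in `L²(X)`. -/
lemma SmoothFun.eq_of_ae_eq {f g : SmoothFun n Γ}
    (h : (f : LeftQuotient Γ → ℂ) =ᵐ[μ] (g : LeftQuotient Γ → ℂ)) : f = g := by
  refine toContinuousMap_injective (classC_injective μ (Lp.ext ?_))
  exact (coeFn_classC μ (toContinuousMap Γ f)).trans
    (h.trans (coeFn_classC μ (toContinuousMap Γ g)).symm)

lemma isotypicIncl_foldOp (π : UnitaryDual G) (l : List (GroupLieAlgebra (𝓡 n) G))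
    (v : SmoothVectors n μ π) : isotypicIncl μ π (foldOp (fun ξ => derivedAction μ π ξ) l v) =
      foldOp (wholeDeriv μ) l (isotypicIncl μ π v) :=
  map_foldOp (D := fun ξ => derivedAction μ π ξ) (D' := wholeDeriv μ) (T := isotypicIncl μ π)
    (isotypicIncl_deriv μ π) l v

lemma isotypicSmoothProj_foldOp (π : UnitaryDual G) (l : List (GroupLieAlgebra (𝓡 n) G))
    (v : wholeSmooth n μ) : isotypicSmoothProj μ π (foldOp (wholeDeriv μ) l v) =
      foldOp (fun ξ => derivedAction μ π ξ) l (isotypicSmoothProj μ π v) :=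
  map_foldOp (D := wholeDeriv μ) (D' := fun ξ => derivedAction μ π ξ)
    (T := isotypicSmoothProj μ π) (isotypicSmoothProj_deriv μ π) l v

lemma isotypicToFun_foldOp (π : UnitaryDual G) (l : List (GroupLieAlgebra (𝓡 n) G))
    (v : SmoothVectors n μ π) : isotypicToFun μ π (foldOp (fun ξ => derivedAction μ π ξ) l v) =
      foldOp (fieldOp Γ) l (isotypicToFun μ π v) :=
  map_foldOp (D := fun ξ => derivedAction μ π ξ) (D' := fieldOp Γ) (T := isotypicToFun μ π)
    (isotypicToFun_deriv μ π) l v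

lemma isotypicOfFun_foldOp (π : UnitaryDual G) (l : List (GroupLieAlgebra (𝓡 n) G))
    (f : SmoothFun n Γ) : isotypicOfFun μ π (foldOp (fieldOp Γ) l f) =
      foldOp (fun ξ => derivedAction μ π ξ) l (isotypicOfFun μ π f) :=
  map_foldOp (D := fieldOp Γ) (D' := fun ξ => derivedAction μ π ξ) (T := isotypicOfFun μ π)
    (isotypicOfFun_deriv μ π) l f

/-- By the Sobolev formula each derivative of the function depends continuously, in the sup norm, on
finitely many derivatives of the vector in `L²`. -/
lemma continuous_isotypicToFun (π : UnitaryDual G) : Continuous (isotypicToFun (n := n) μ π) := by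
  obtain ⟨ι, _, S, l, h⟩ := exists_sobolev_fun n μ
  refine continuous_operatorTopology_rng (toContinuousMap Γ)
    (fieldOp Γ) fun w => ?_
  have e : ∀ v, toContinuousMap Γ (foldOp (fieldOp Γ) w (isotypicToFun μ π v)) =
      ∑ i, S i (toLp n μ π (foldOp (fun ξ => derivedAction μ π ξ) (l i ++ w) v)) := fun v => by
    rw [← isotypicToFun_foldOp]
    refine (h _).trans (Finset.sum_congr rfl fun i _ => congrArg (S i) ?_)
    rw [← isotypicIncl_foldOp, foldOp_append]
    rfl
  simp only [e]
  exact continuous_finsetSum _ fun i _ => (S i).continuous.comp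
    (continuous_operatorTopology_dom (toLp n μ π) (fun ξ => derivedAction μ π ξ) _)

/-- The projection commutes with derivatives and is bounded on `L²(X)`, whose norm is dominated by
the sup norm. -/
lemma continuous_isotypicOfFun (π : UnitaryDual G) : Continuous (isotypicOfFun (n := n) μ π) := by
  refine continuous_operatorTopology_rng (toLp n μ π) (fun ξ => derivedAction μ π ξ) fun w => ?_
  have e : ∀ f, toLp n μ π (foldOp (fun ξ => derivedAction μ π ξ) w (isotypicOfFun μ π f)) =
      isotypicProj μ π (classC μ (toContinuousMap Γ (foldOp (fieldOp Γ) w f))) := fun f => by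
    rw [← isotypicOfFun_foldOp]
    rfl
  simp only [e]
  exact (isotypicProj μ π).continuous.comp ((classC μ).continuous.comp
    (continuous_operatorTopology_dom (toContinuousMap Γ) (fieldOp Γ) _))

/-- Smooth functions are the sums of their isotypic components, in the `C^∞` topology. -/
lemma hasSum_isotypicToFun (f : SmoothFun n Γ) :
    HasSum (fun π : UnitaryDual G => isotypicToFun μ π (isotypicOfFun μ π f)) f := by
  obtain ⟨ι, _, S, l, h⟩ := exists_sobolev_fun n μ
  refine tendsto_operatorTopology (toContinuousMap Γ)
    (fieldOp Γ) fun w => ?_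
  simp only [map_sum]
  let u := foldOp (wholeDeriv μ) w (smoothEquiv μ f)
  -- Each derivative of the `π`-component is the image, under operators `S i` that do not depend on
  -- `π`, of the `π`-components of fixed `L²` vectors. So the `L²` expansions of these vectors yield
  -- uniform convergence.
  have e1 : ∀ π : UnitaryDual G, toContinuousMap Γ (foldOp (fieldOp Γ) w
        (isotypicToFun μ π (isotypicOfFun μ π f))) =
      ∑ i, S i (isotypicProj μ π (foldOp (wholeDeriv μ) (l i) u).1) := fun π => by
    rw [← isotypicToFun_foldOp]
    refine (h _).trans (Finset.sum_congr rfl fun i _ => congrArg (S i) ?_)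
    rw [← isotypicIncl_foldOp, ← foldOp_append]
    unfold isotypicOfFun
    rw [LinearMap.comp_apply, LinearEquiv.coe_coe,
      ← isotypicSmoothProj_foldOp,
      foldOp_append]
    rfl
  have e2 : toContinuousMap Γ (foldOp (fieldOp Γ) w f) =
      ∑ i, S i (foldOp (wholeDeriv μ) (l i) u).1 := by
    rw [← h u, map_foldOp (D := wholeDeriv μ) (D' := fieldOp Γ) (T := (smoothEquiv μ).symm)
      (smoothEquiv_symm_deriv μ), LinearEquiv.symm_apply_apply]
  simp only [e1]
  rw [e2]
  exact hasSum_sum fun i _ => (S i).hasSum (hasSum_isotypicProj (n := n) μ _)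

end IsotypicFunctions

/-! ### Continuity of derivations and multiplications on `C^∞(X)`. -/

section Multiplication

variable {n : ℕ} {G : Type u} [TopologicalSpace G]
  [ChartedSpace (EuclideanSpace ℝ (Fin n)) G] [Group G] [LieGroup (𝓡 n) ∞ G] {Γ : Subgroup G}

lemma continuous_inducedField (ξ : GroupLieAlgebra (𝓡 n) G) : Continuous (inducedField Γ ξ) := by
  refine continuous_operatorTopology_rng (toContinuousMap Γ)
    (fieldOp Γ) fun w => ?_
  have h := continuous_operatorTopology_dom (toContinuousMap Γ)
    (fieldOp Γ)
    (w ++ [ξ])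
  simp only [foldOp_append] at h
  exact h

/-- Leibniz' rule for the innermost derivative replaces either `g` or the fixed factor `f` by its
derivative, hence the induction over all `f`. Continuity of `extendForm` rests on this. -/
lemma SmoothFun.continuous_const_mul [CompactSpace (LeftQuotient Γ)] [T2Space (LeftQuotient Γ)]
    (f : SmoothFun n Γ) : Continuous fun g : SmoothFun n Γ => f * g := by
  refine continuous_operatorTopology_rng (toContinuousMap Γ)
    (fieldOp Γ) fun w => ?_
  induction w using List.reverseRecOn generalizing f with
  | nil =>
    have h := continuous_operatorTopology_dom (toContinuousMap Γ)
      (fieldOp (n := n) Γ) []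
    exact Continuous.mul (continuous_const (y := toContinuousMap (n := n) Γ f)) h
  | append_singleton w ξ ih =>
    have e : ∀ g, toContinuousMap Γ (foldOp (fieldOp Γ) (w ++ [ξ]) (f * g)) =
        toContinuousMap Γ (foldOp (fieldOp Γ) w (f * inducedField Γ ξ g)) +
        toContinuousMap Γ (foldOp (fieldOp Γ) w (inducedField Γ ξ f * g)) :=
      fun g => by
        rw [foldOp_append, foldOp_cons, foldOp_nil, ← map_add, ← map_add]
        congr 2
        refine ((inducedField Γ ξ).leibniz f g).trans ?_
        rw [smul_eq_mul, smul_eq_mul, mul_comm g]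
    simp only [e]
    exact ((ih f).comp (continuous_inducedField ξ)).add (ih _)

end Multiplication

/-! ### Smooth functions on `Γ \ G` with prescribed local behaviour. -/

section LocalFunctions

variable {n : ℕ} {G : Type u} [TopologicalSpace G]
  [ChartedSpace (EuclideanSpace ℝ (Fin n)) G] [Group G] [LieGroup (𝓡 n) ∞ G]
  [IsTopologicalGroup G] [T2Space G] [LocallyCompactSpace G]
  (Γ : Subgroup G) [DiscreteTopology Γ]

/-- A discrete subgroup acts properly discontinuously, so only finitely many of its elements move a
point of the compact support into a given compact neighbourhood. -/
lemma locallyFinite_support_translates {w : G → ℂ} (hw : HasCompactSupport w) :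
    LocallyFinite fun γ : Γ => Function.support fun y => w ((γ : G) * y) := by
  have : ProperlyDiscontinuousSMul Γ G :=
    Subgroup.properlyDiscontinuousSMul_of_tendsto_cofinite Γ (Γ.tendsto_coe_cofinite_of_discrete ⟨‹_›⟩)
  intro y
  obtain ⟨N, hN, hy⟩ := exists_compact_mem_nhds y
  refine ⟨N, hy, (ProperlyDiscontinuousSMul.finite_disjoint_inter_image (Γ := Γ) hN hw).subset ?_⟩
  rintro γ ⟨z, hz, hzN⟩
  exact ⟨(γ : G) * z, ⟨z, hzN, rfl⟩, subset_tsupport _ hz⟩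

/-- The sum of the translates of a compactly supported function, as a function on `Γ \ G`. -/
def periodize (w : G → ℂ) (hw : HasCompactSupport w) (hs : ContMDiff (𝓡 n) 𝓘(ℝ, ℂ) ∞ w) :
    SmoothFun n Γ :=
  ⟨Quotient.lift (fun y => ∑ᶠ γ : Γ, w ((γ : G) * y)) fun a b h => by
      change QuotientGroup.rightRel Γ _ _ at h
      rw [QuotientGroup.rightRel_apply] at h
      rw [← finsum_comp_equiv (Equiv.mulRight (⟨b * a⁻¹, h⟩ : Γ))]
      refine finsum_congr fun γ => congrArg w ?_
      simp [mul_assoc],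
    contMDiff_finsum (fun γ => hs.comp (contMDiff_mul_left (I := 𝓡 n) (n := ∞) (a := (γ : G))))
      (locallyFinite_support_translates Γ hw)⟩

lemma periodize_proj (w : G → ℂ) (hw : HasCompactSupport w)
    (hs : ContMDiff (𝓡 n) 𝓘(ℝ, ℂ) ∞ w) (y : G) :
    periodize Γ w hw hs (proj Γ y) = ∑ᶠ γ : Γ, w ((γ : G) * y) := rfl

/-- Every smooth function defined near `g` agrees near `g` with the pullback of a smooth function on
`Γ \ G`. -/
lemma exists_smoothFun_eventuallyEq (g : G) {F : G → ℂ}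
    (hF : ContMDiffOn (𝓡 n) 𝓘(ℝ, ℂ) ∞ F (chartAt (EuclideanSpace ℝ (Fin n)) g).source) :
    ∃ f : SmoothFun n Γ, (fun y => f (proj Γ y)) =ᶠ[nhds g] F := by
  obtain ⟨V, hV, hVΓ⟩ : ∃ V ∈ nhds (1 : G), ∀ γ ∈ Γ, γ ∈ V → γ = 1 := by
    obtain ⟨V, hV, hVe⟩ := mem_nhds_induced (Subtype.val : Γ → G) 1 {1} |>.1
      ((isOpen_discrete _).mem_nhds rfl)
    exact ⟨V, hV, fun γ hγ h => congrArg Subtype.val (hVe (show (⟨γ, hγ⟩ : Γ) ∈ _ from h))⟩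
  have hcont : Filter.Tendsto (fun q : G × G => q.1 * q.2⁻¹) (nhds (g, g)) (nhds 1) := by
    have : Continuous fun q : G × G => q.1 * q.2⁻¹ := by fun_prop
    have h := this.tendsto (g, g)
    simpa using h
  -- If `y` and `γ y` both lie in `U`, then `γ = (γ y) y⁻¹` lies in `V`, so `γ = 1`. Near `g` the
  -- sum over `Γ` thus has a single term.
  obtain ⟨U, hU, hUV⟩ := Filter.mem_prod_same_iff.1 (nhds_prod_eq (x := g) (y := g) ▸ hcont hV)
  obtain ⟨ρ, -, hρ⟩ := (SmoothBumpFunction.nhds_basis_tsupport (I := 𝓡 n) g).mem_iff.1 hU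
  let w : G → ℂ := fun y => ρ y • F y
  have hsupp : Function.support w ⊆ U := fun y hy => hρ <| subset_tsupport _ <| by
    intro h
    exact hy (by simp [w, h])
  have hw : HasCompactSupport w := ρ.hasCompactSupport.smul_right
  refine ⟨periodize Γ w hw (ρ.contMDiff_smul hF), ?_⟩
  filter_upwards [hU, ρ.eventuallyEq_one] with y hyU hy1
  rw [periodize_proj, finsum_eq_single _ (1 : Γ)]
  · simp [w, hy1]
  · intro γ hγ
    by_contra h
    have h1 : ((γ : G) * y, y) ∈ U ×ˢ U := ⟨hsupp h, hyU⟩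
    have h2 := hUV h1
    simp only [Set.mem_preimage, mul_inv_cancel_right] at h2
    exact hγ (Subtype.ext (hVΓ γ γ.2 h2))

/-- Smooth functions on `Γ \ G` separate tangent vectors. -/
lemma exists_injective_inducedField (g : G) :
    ∃ T : GroupLieAlgebra (𝓡 n) G →ₗ[ℝ] EuclideanSpace ℝ (Fin n), Function.Injective T ∧
      ∀ j, ∃ f : SmoothFun n Γ, ∀ ξ, inducedField Γ ξ f (proj Γ g) = ((T ξ j : ℝ) : ℂ) := by
  let E := EuclideanSpace ℝ (Fin n)
  have : IsManifold (𝓡 n) ∞ G := inferInstance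
  have h1 : IsManifold (𝓡 n) 1 G := .of_le (n := ∞) (by simp)
  let A : E →L[ℝ] E := mfderiv (𝓡 n) (𝓡 n) (fun h : G => g * h) 1
  let B : E →L[ℝ] E := mfderiv (𝓡 n) 𝓘(ℝ, E) (extChartAt (𝓡 n) g) g
  have hA : HasMFDerivAt (𝓡 n) (𝓡 n) (fun h : G => g * h) 1 A :=
    ((contMDiff_mul_left (I := 𝓡 n) (n := ∞) (a := g)).mdifferentiable (by simp) _).hasMFDerivAt
  have hA' : HasMFDerivAt (𝓡 n) (𝓡 n) (fun h : G => g⁻¹ * h) (g * 1)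
      (mfderiv (𝓡 n) (𝓡 n) (fun h : G => g⁻¹ * h) (g * 1)) :=
    ((contMDiff_mul_left (I := 𝓡 n) (n := ∞) (a := g⁻¹)).mdifferentiable (by simp) _).hasMFDerivAt
  have hAinj : Function.Injective A := by
    have h2 := (hA'.comp (1 : G) hA).mfderiv
    have h3 : (fun h : G => g⁻¹ * h) ∘ (fun h : G => g * h) = id := by
      funext h
      simp
    rw [h3, mfderiv_id] at h2
    intro v w hvw
    have h4 : ∀ v, v = mfderiv (𝓡 n) (𝓡 n) (fun h : G => g⁻¹ * h) (g * 1) (A v) := fun v =>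
      congrArg (fun S : E →L[ℝ] E => S v) h2
    rw [h4 v, h4 w, hvw]
  have hBinv := isInvertible_mfderiv_extChartAt (I := 𝓡 n) (mem_extChartAt_source (I := 𝓡 n) g)
  have hB : HasMFDerivAt (𝓡 n) 𝓘(ℝ, E) (extChartAt (𝓡 n) g) g B :=
    (mdifferentiableAt_extChartAt (mem_chart_source _ g)).hasMFDerivAt
  have hBinj : Function.Injective B := by
    obtain ⟨e, he⟩ := hBinv
    intro v w hvw
    have h4 : ∀ v, B v = e v := fun v => (congrArg (fun S : E →L[ℝ] E => S v) he).symm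
    rw [h4, h4] at hvw
    exact e.injective hvw
  -- Here `T` is the derivative of the chart at `g` after that of left translation by `g`. The
  -- `j`-th test function agrees near `g` with the `j`-th chart coordinate.
  refine ⟨(B.comp A).toLinearMap, hBinj.comp hAinj, fun j => ?_⟩
  let ℓ : E →L[ℝ] ℂ := Complex.ofRealCLM.comp (EuclideanSpace.proj j)
  obtain ⟨f, hf⟩ := exists_smoothFun_eventuallyEq Γ g (F := fun y => ℓ (extChartAt (𝓡 n) g y))
    (ℓ.contMDiff.comp_contMDiffOn (contMDiffOn_extChartAt (I := 𝓡 n) (n := ∞)))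
  refine ⟨f, fun ξ => ?_⟩
  have hmul : Filter.Tendsto (fun h : G => g * h) (nhds 1) (nhds g) := by
    have := (continuous_const_mul g).tendsto (1 : G)
    rwa [mul_one] at this
  have hev : (fun h => f (proj Γ (g * h))) =ᶠ[nhds (1 : G)]
      fun h => ℓ (extChartAt (𝓡 n) g (g * h)) := hmul.eventually hf
  have hB' : HasMFDerivAt (𝓡 n) 𝓘(ℝ, E) (extChartAt (𝓡 n) g) (g * 1) B := by
    have : ∀ y, y = g → HasMFDerivAt (𝓡 n) 𝓘(ℝ, E) (extChartAt (𝓡 n) g) y B := by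
      rintro _ rfl
      exact hB
    exact this _ (mul_one g)
  have h5 := ((ℓ.hasMFDerivAt).comp (1 : G) (hB'.comp (1 : G) hA)).mfderiv
  change lieDeriv ξ (fun h => f (proj Γ h)) g = _
  unfold lieDeriv
  rw [hev.mfderiv_eq]
  exact congrArg (fun S : E →L[ℝ] ℂ => S ξ) h5

end LocalFunctions

/-! ### The leafwise fields form a free module. -/

section FieldsBasis

variable {n : ℕ} {G : Type u} [TopologicalSpace G]
  [ChartedSpace (EuclideanSpace ℝ (Fin n)) G] [Group G] [LieGroup (𝓡 n) ∞ G]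
  (𝔭 : LieSubalgebra ℝ (GroupLieAlgebra (𝓡 n) G)) (Γ : Subgroup G)

lemma leafwiseField_add (ξ η : 𝔭) :
    leafwiseField 𝔭 Γ (ξ + η) = leafwiseField 𝔭 Γ ξ + leafwiseField 𝔭 Γ η := by
  refine Subtype.ext (Derivation.ext fun f => SmoothFun.ext_proj fun x => ?_)
  exact map_add (mfderiv (𝓡 n) 𝓘(ℝ, ℂ) (fun h : G => f (proj Γ (x * h))) 1) ξ.1 η.1

lemma leafwiseField_smul (c : ℝ) (ξ : 𝔭) :
    leafwiseField 𝔭 Γ (c • ξ) = algebraMap ℂ (SmoothFun n Γ) c • leafwiseField 𝔭 Γ ξ := by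
  refine Subtype.ext (Derivation.ext fun f => SmoothFun.ext_proj fun x => ?_)
  exact map_smul (mfderiv (𝓡 n) 𝓘(ℝ, ℂ) (fun h : G => f (proj Γ (x * h))) 1) c ξ.1

lemma leafwiseField_lie (ξ η : 𝔭) :
    leafwiseField 𝔭 Γ ⁅ξ, η⁆ = ⁅leafwiseField 𝔭 Γ ξ, leafwiseField 𝔭 Γ η⁆ :=
  Subtype.ext (inducedField_bracket (Γ := Γ) (ξ : GroupLieAlgebra (𝓡 n) G) η).symm

variable {𝔭} {ι : Type*} [Fintype ι] (b : Module.Basis ι ℝ 𝔭)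

lemma leafwiseField_eq_sum (ξ : 𝔭) : leafwiseField 𝔭 Γ ξ =
    ∑ i, algebraMap ℂ (SmoothFun n Γ) (b.repr ξ i : ℝ) • leafwiseField 𝔭 Γ (b i) := by
  let A : 𝔭 →+ leafwiseFields Γ 𝔭 := AddMonoidHom.mk' (leafwiseField 𝔭 Γ) (leafwiseField_add 𝔭 Γ)
  change A ξ = _
  conv_lhs => rw [← b.sum_repr ξ]
  rw [map_sum]
  exact Finset.sum_congr rfl fun i _ => leafwiseField_smul 𝔭 Γ _ _

lemma span_leafwiseField : ⊤ ≤ Submodule.span (SmoothFun n Γ)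
    (Set.range fun i => leafwiseField 𝔭 Γ (b i)) := by
  rintro ⟨D, hD⟩ -
  have : leafwiseFields Γ 𝔭 ≤ (Submodule.span (SmoothFun n Γ)
      (Set.range fun i => leafwiseField 𝔭 Γ (b i))).map (leafwiseFields Γ 𝔭).subtype := by
    refine Submodule.span_le.2 ?_
    rintro _ ⟨ξ, rfl⟩
    refine ⟨leafwiseField 𝔭 Γ ξ, ?_, rfl⟩
    rw [leafwiseField_eq_sum Γ b]
    exact Submodule.sum_mem _ fun i _ => Submodule.smul_mem _ _ (Submodule.subset_span ⟨i, rfl⟩)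
  obtain ⟨D', hD', h⟩ := this hD
  rwa [show (⟨D, hD⟩ : leafwiseFields Γ 𝔭) = D' from Subtype.ext h.symm]

variable [IsTopologicalGroup G] [T2Space G] [LocallyCompactSpace G] [DiscreteTopology Γ]

/-- At each point `Γ g`, testing a relation on functions that extend the coordinates gives a complex
linear relation between the vectors `T (b i)`. These are real and independent, so the real and
imaginary parts of the coefficients vanish separately. -/
lemma linearIndependent_leafwiseField :
    LinearIndependent (SmoothFun n Γ) fun i => leafwiseField 𝔭 Γ (b i) := by
  rw [Fintype.linearIndependent_iff]
  intro f hf i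
  refine SmoothFun.ext_proj fun g => ?_
  obtain ⟨T, hT, hTf⟩ := exists_injective_inducedField (n := n) Γ g
  let c : ι → ℂ := fun i => f i (proj Γ g)
  have h1 : ∀ j, ∑ i, c i * ((T (b i : GroupLieAlgebra (𝓡 n) G) j : ℝ) : ℂ) = 0 := fun j => by
    obtain ⟨u, hu⟩ := hTf j
    have h2 : ∑ i, f i * inducedField Γ (b i : GroupLieAlgebra (𝓡 n) G) u = 0 := by
      let ev : leafwiseFields Γ 𝔭 →+ SmoothFun n Γ := AddMonoidHom.mk' (fun D => D.1 u) fun _ _ => rfl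
      have h3 := congrArg ev hf
      rw [map_sum, map_zero] at h3
      exact h3
    let ev : SmoothFun n Γ →+ ℂ := AddMonoidHom.mk' (fun u => u (proj Γ g)) fun _ _ => rfl
    have h3 := congrArg ev h2
    rw [map_sum, map_zero] at h3
    refine Eq.trans (Finset.sum_congr rfl fun i _ => ?_) h3
    rw [← hu]
    rfl
  have key : ∀ r : ι → ℝ, (∀ j, ∑ i, r i * T (b i : GroupLieAlgebra (𝓡 n) G) j = 0) → ∀ i, r i = 0 := by
    intro r hr
    have h2 : T (∑ i, r i • b i : 𝔭) = 0 := by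
      ext j
      rw [AddSubmonoidClass.coe_finsetSum, map_sum]
      refine Eq.trans ?_ (hr j)
      rw [WithLp.ofLp_sum, Finset.sum_apply]
      exact Finset.sum_congr rfl fun i _ => congrArg (fun v : EuclideanSpace ℝ (Fin n) => v j)
        (map_smul T (r i) (b i : GroupLieAlgebra (𝓡 n) G))
    have h3 : ∑ i, r i • b i = 0 := Subtype.ext (hT (h2.trans (map_zero T).symm))
    exact Fintype.linearIndependent_iff.1 b.linearIndependent r h3
  change c i = 0
  refine Complex.ext (key (fun i => (c i).re) (fun j => ?_) i) (key (fun i => (c i).im) (fun j => ?_) i)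
  · simpa using congrArg Complex.re (h1 j)
  · simpa using congrArg Complex.im (h1 j)

/-- The leafwise fields induced by a basis of `𝔭` are a basis of the module of all leafwise fields. -/
def fieldsBasis : Module.Basis ι (SmoothFun n Γ) (leafwiseFields Γ 𝔭) :=
  Module.Basis.mk (linearIndependent_leafwiseField Γ b) (span_leafwiseField Γ b)

lemma fieldsBasis_apply (i : ι) : fieldsBasis Γ b i = leafwiseField 𝔭 Γ (b i) :=
  Module.Basis.mk_apply _ _ _

end FieldsBasis

/-! ### The differential is multilinear over functions. -/

section Tensoriality

variable {A L M : Type*} [CommRing A] [LieRing L] [Module A L] [AddCommGroup M] [Module A M]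
  [LieRingModule L M] {p : ℕ}

lemma update_comp_succAbove (j : Fin (p + 1)) (v : Fin (p + 1) → L) (k : Fin p) (x : L) :
    Function.update v (j.succAbove k) x ∘ j.succAbove = Function.update (v ∘ j.succAbove) k x :=
  Function.update_comp_eq_of_injective v Fin.succAbove_right_injective k x

lemma update_self_comp_succAbove (j : Fin (p + 1)) (v : Fin (p + 1) → L) (x : L) :
    Function.update v j x ∘ j.succAbove = v ∘ j.succAbove :=
  Function.update_comp_eq_of_notMem_range v x fun ⟨k, hk⟩ => Fin.succAbove_ne j k hk

variable (β : L [⋀^Fin p]→ₗ[A] M)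

lemma differential_update_add (v : Fin (p + 1) → L) (k : Fin (p + 1)) (x y : L) :
    differential β (Function.update v k (x + y)) =
      differential β (Function.update v k x) + differential β (Function.update v k y) := by
  unfold differential
  rw [add_add_add_comm]
  congr 1
  · rw [← Finset.sum_add_distrib]
    refine Finset.sum_congr rfl fun j _ => ?_
    rw [← smul_add]
    congr 1
    rcases eq_or_ne k j with rfl | h
    · simp only [Function.update_self, update_self_comp_succAbove, add_lie]
    · obtain ⟨k, rfl⟩ := Fin.exists_succAbove_eq h
      simp only [Function.update_of_ne h.symm, update_comp_succAbove, AlternatingMap.map_update_add,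
        lie_add]
  · rw [← Finset.sum_add_distrib]
    refine Finset.sum_congr rfl fun j _ => ?_
    rw [← Finset.sum_add_distrib]
    refine Finset.sum_congr rfl fun i hi => ?_
    have hij : i ≠ j := ((Finset.mem_filter.1 hi).2).ne
    rw [← smul_add]
    congr 1
    obtain ⟨i, rfl⟩ := Fin.exists_succAbove_eq hij
    simp only [update_comp_succAbove]
    rcases eq_or_ne k j with rfl | h
    · simp only [Function.update_self, Function.update_of_ne hij, update_self_comp_succAbove, lie_add,
        AlternatingMap.map_update_add]
    · obtain ⟨k, rfl⟩ := Fin.exists_succAbove_eq h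
      rcases eq_or_ne k i with rfl | hki
      · simp only [Function.update_self, Function.update_of_ne h.symm, update_comp_succAbove, add_lie,
          Function.update_idem, AlternatingMap.map_update_add]
      · have hki' : j.succAbove i ≠ j.succAbove k := fun e => hki (Fin.succAbove_right_injective e).symm
        simp only [Function.update_of_ne h.symm, Function.update_of_ne hki', update_comp_succAbove]
        simp only [Function.update_comm hki, AlternatingMap.map_update_add]

variable {D : L → A → A} (h1 : ∀ x (f : A) (y : L), ⁅x, f • y⁆ = f • ⁅x, y⁆ + D x f • y)
  (h2 : ∀ (x : L) (f : A) (m : M), ⁅x, f • m⁆ = f • ⁅x, m⁆ + D x f • m)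
  (h3 : ∀ (f : A) (x : L) (m : M), ⁅f • x, m⁆ = f • ⁅x, m⁆)

-- The terms in which `f` is differentiated cancel. The first sum produces `Q j` for every `j ≠ k`;
-- the brackets produce `-Q i` from the pairs `(i, k)` with `i < k`, and `-Q j` from the pairs `(k,
-- j)` with `k < j`.
include h1 h2 h3 in
lemma differential_update_smul (v : Fin (p + 1) → L) (k : Fin (p + 1)) (f : A) (x : L) :
    differential β (Function.update v k (f • x)) = f • differential β (Function.update v k x) := by
  have h1' : ∀ (f : A) (x y : L), ⁅f • x, y⁆ = f • ⁅x, y⁆ - D y f • x := fun f x y => by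
    rw [← lie_skew, h1, ← lie_skew x y, smul_neg]
    abel
  set w := Function.update v k x with hw
  have hwk : w k = x := Function.update_self _ _ _
  let Q : Fin (p + 1) → M := fun j => (-1 : ℤ) ^ (j : ℕ) • D (w j) f • β (w ∘ j.succAbove)
  have e1 : ∀ j : Fin (p + 1), (-1 : ℤ) ^ (j : ℕ) • ⁅Function.update v k (f • x) j,
      β (Function.update v k (f • x) ∘ j.succAbove)⁆ =
      f • (-1 : ℤ) ^ (j : ℕ) • ⁅w j, β (w ∘ j.succAbove)⁆ + if j = k then 0 else Q j := by
    intro j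
    rw [smul_comm f]
    rcases eq_or_ne k j with rfl | h
    · simp only [hw, Function.update_self, update_self_comp_succAbove, h3, if_true, add_zero]
    · rw [if_neg h.symm, ← smul_add]
      congr 1
      obtain ⟨k, rfl⟩ := Fin.exists_succAbove_eq h
      simp only [hw, Function.update_of_ne h.symm, update_comp_succAbove,
        AlternatingMap.map_update_smul, h2]
  have e2 : ∀ j i : Fin (p + 1), i < j → (-1 : ℤ) ^ (j : ℕ) •
      β (Function.update (Function.update v k (f • x)) i
        ⁅Function.update v k (f • x) i, Function.update v k (f • x) j⁆ ∘ j.succAbove) =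
      f • (-1 : ℤ) ^ (j : ℕ) • β (Function.update w i ⁅w i, w j⁆ ∘ j.succAbove) +
        ((if j = k then -Q i else 0) + if i = k then -Q j else 0) := by
    intro j i hlt
    have hij : i ≠ j := hlt.ne
    rw [smul_comm f]
    obtain ⟨i, rfl⟩ := Fin.exists_succAbove_eq hij
    rcases eq_or_ne k j with rfl | h
    · have h4 := β.neg_one_pow_smul_map_removeNth_add_eq_zero_of_eq
        (v := Function.update w (k.succAbove i) x) (i := k.succAbove i) (j := k)
        (by rw [Function.update_self, Function.update_of_ne hij.symm, hwk]) hij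
      have h5 : (k.succAbove i).removeNth (Function.update w (k.succAbove i) x) =
        w ∘ (k.succAbove i).succAbove := update_self_comp_succAbove _ _ _
      have h6 : k.removeNth (Function.update w (k.succAbove i) x) =
        Function.update (v ∘ k.succAbove) i x := by
        refine (update_comp_succAbove _ _ _ _).trans ?_
        rw [hw, update_self_comp_succAbove]
      rw [h5, h6] at h4
      have h7 : -Q (k.succAbove i) = (-1 : ℤ) ^ (k : ℕ) •
          D (w (k.succAbove i)) f • β (Function.update (v ∘ k.succAbove) i x) := by
        simp only [Q]
        rw [smul_comm ((-1 : ℤ) ^ _), smul_comm ((-1 : ℤ) ^ _), ← smul_neg]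
        congr 1
        exact (neg_eq_of_add_eq_zero_right h4)
      rw [if_pos rfl, if_neg hij, add_zero, h7, ← smul_add]
      congr 1
      simp only [hw, update_comp_succAbove, Function.update_self, Function.update_of_ne hij,
        update_self_comp_succAbove, h1, AlternatingMap.map_update_add,
        AlternatingMap.map_update_smul]
    · obtain ⟨k, rfl⟩ := Fin.exists_succAbove_eq h
      rw [if_neg h.symm, zero_add]
      rcases eq_or_ne k i with rfl | hki
      · rw [if_pos rfl]
        simp only [Q]
        rw [← smul_neg, ← smul_add]
        congr 1
        simp only [hw, Function.update_self, Function.update_of_ne h.symm, update_comp_succAbove, h1',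
          Function.update_idem, sub_eq_add_neg, AlternatingMap.map_update_add,
          AlternatingMap.map_update_smul, ← neg_smul]
      · have hki' : j.succAbove i ≠ j.succAbove k := fun e => hki (Fin.succAbove_right_injective e).symm
        rw [if_neg hki', add_zero]
        congr 1
        simp only [hw, Function.update_of_ne h.symm, Function.update_of_ne hki',
          update_comp_succAbove]
        simp only [Function.update_comm hki, AlternatingMap.map_update_smul]
  have e3 : ∑ j, (if j = k then 0 else Q j) + ∑ j : Fin (p + 1), ∑ i : Fin (p + 1) with i < j,
      ((if j = k then -Q i else 0) + if i = k then -Q j else 0) = 0 := by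
    have e4 : ∀ j : Fin (p + 1), ∑ i : Fin (p + 1) with i < j,
        ((if j = k then -Q i else 0) + if i = k then -Q j else 0) =
        (if j = k then -∑ i, (if i < k then Q i else 0) else 0) + if k < j then -Q j else 0 := by
      intro j
      rw [Finset.sum_add_distrib]
      congr 1
      · split_ifs with h
        · rw [h, Finset.sum_neg_distrib, Finset.sum_filter]
        · exact Finset.sum_const_zero
      · rw [Finset.sum_ite_eq']
        simp
    simp only [e4]
    rw [Finset.sum_add_distrib, Finset.sum_ite_eq' Finset.univ k, if_pos (Finset.mem_univ _),
      ← Finset.sum_neg_distrib, ← Finset.sum_add_distrib, ← Finset.sum_add_distrib]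
    refine Finset.sum_eq_zero fun j _ => ?_
    rcases lt_trichotomy j k with h | h | h
    · simp [h, h.ne, h.le.not_gt]
    · simp [h]
    · simp [h, h.ne', h.le.not_gt]
  unfold differential
  simp only [e1]
  have e5 : ∑ j : Fin (p + 1), ∑ i : Fin (p + 1) with i < j, (-1 : ℤ) ^ (j : ℕ) •
      β (Function.update (Function.update v k (f • x)) i
        ⁅Function.update v k (f • x) i, Function.update v k (f • x) j⁆ ∘ j.succAbove) =
      ∑ j : Fin (p + 1), ∑ i : Fin (p + 1) with i < j,
      (f • (-1 : ℤ) ^ (j : ℕ) • β (Function.update w i ⁅w i, w j⁆ ∘ j.succAbove) +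
        ((if j = k then -Q i else 0) + if i = k then -Q j else 0)) :=
    Finset.sum_congr rfl fun j _ => Finset.sum_congr rfl fun i hi => e2 j i (Finset.mem_filter.1 hi).2
  rw [e5]
  simp only [Finset.sum_add_distrib] at e3 ⊢
  rw [add_add_add_comm, e3, add_zero, smul_add]
  simp only [Finset.smul_sum]

/-- The differential of a cochain with values in a module of a Lie–Rinehart algebra is
multilinear. -/
def differentialMultilinear : MultilinearMap A (fun _ : Fin (p + 1) => L) M where
  toFun := differential β
  map_update_add' {inst} v k x y := by
    rw [Subsingleton.elim inst (instDecidableEqFin _)]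
    exact differential_update_add β v k x y
  map_update_smul' {inst} v k f x := by
    rw [Subsingleton.elim inst (instDecidableEqFin _)]
    exact differential_update_smul β h1 h2 h3 v k f x

end Tensoriality

/-! ### Functoriality of cocycles modulo the closure of coboundaries. -/

section ReducedMap

variable {C C' : Type*} [AddCommGroup C] [Module ℂ C] [TopologicalSpace C] [IsTopologicalAddGroup C]
  [ContinuousSMul ℂ C] [AddCommGroup C'] [Module ℂ C'] [TopologicalSpace C']
  [IsTopologicalAddGroup C'] [ContinuousSMul ℂ C']
  {Z B : Submodule ℂ C} {Z' B' : Submodule ℂ C'}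

/-- A continuous linear map that preserves cocycles and coboundaries acts on the quotient of the
cocycles by the closure of the coboundaries. -/
def reducedMap (T : C →L[ℂ] C') (hZ : ∀ z ∈ Z, T z ∈ Z') (hB : ∀ z ∈ B, T z ∈ B') :
    (Z ⧸ B.topologicalClosure.submoduleOf Z) →L[ℂ] (Z' ⧸ B'.topologicalClosure.submoduleOf Z') where
  toLinearMap := Submodule.mapQ _ _ (T.toLinearMap.restrict hZ) fun z hz => by
    have h : T z.1 ∈ B'.topologicalClosure := map_mem_closure T.continuous hz hB
    exact h
  cont := by
    refine continuous_quot_lift _ ?_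
    exact continuous_quot_mk.comp ((T.continuous.comp continuous_subtype_val).subtype_mk _)

lemma reducedMap_mk (T : C →L[ℂ] C') (hZ : ∀ z ∈ Z, T z ∈ Z') (hB : ∀ z ∈ B, T z ∈ B') (z : Z) :
    reducedMap T hZ hB (Submodule.mkQ (B.topologicalClosure.submoduleOf Z) z) =
      Submodule.mkQ (B'.topologicalClosure.submoduleOf Z') ⟨T z, hZ z z.2⟩ := rfl

instance t3Space_reduced : T3Space (Z ⧸ B.topologicalClosure.submoduleOf Z) := by
  have : IsClosed ((B.topologicalClosure.submoduleOf Z : Submodule ℂ Z) : Set Z) :=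
    B.isClosed_topologicalClosure.preimage continuous_subtype_val
  exact Submodule.t3_quotient_of_isClosed _

lemma hasSum_mkQ {ι : Type*} {c : ι → Z} {z : Z} (h : HasSum (fun i => (c i : C)) z) :
    HasSum (fun i => Submodule.mkQ (B.topologicalClosure.submoduleOf Z) (c i))
      (Submodule.mkQ (B.topologicalClosure.submoduleOf Z) z) := by
  have h1 : HasSum c z := by
    refine (Topology.IsInducing.subtypeVal.hasSum_iff (g := Z.subtype) c z).1 ?_
    exact h
  exact h1.map (Submodule.mkQ (B.topologicalClosure.submoduleOf Z)) continuous_quot_mk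

end ReducedMap

/-! ### Change of coefficients. -/

section CochainMap

variable {L M M' : Type*} [LieRing L] [Module ℝ L] [AddCommGroup M] [Module ℂ M]
  [AddCommGroup M'] [Module ℂ M'] [LieRingModule L M] [LieRingModule L M']

/-- The map on cochains induced by a map of coefficients. -/
def cochainMap (T : M →ₗ[ℂ] M') (p : ℕ) : (L [⋀^Fin p]→ₗ[ℝ] M) →ₗ[ℂ] (L [⋀^Fin p]→ₗ[ℝ] M') where
  toFun α := (T.restrictScalars ℝ).compAlternatingMap α
  map_add' α β := by
    ext v
    exact map_add T _ _
  map_smul' c α := by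
    ext v
    exact map_smul T _ _

lemma cochainMap_apply (T : M →ₗ[ℂ] M') {p : ℕ} (α : L [⋀^Fin p]→ₗ[ℝ] M) (v : Fin p → L) :
    cochainMap T p α v = T (α v) := rfl

lemma differential_cochainMap {T : M →ₗ[ℂ] M'} (hT : ∀ (x : L) m, T ⁅x, m⁆ = ⁅x, T m⁆) {p : ℕ}
    (α : L [⋀^Fin p]→ₗ[ℝ] M) (v : Fin (p + 1) → L) :
    differential (cochainMap T p α) v = T (differential α v) := by
  simp only [differential, map_add, map_sum, map_zsmul, hT, cochainMap_apply]

variable [ComplexLinearAction L M] [ComplexLinearAction L M']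

lemma cochainMap_mem_cocycles {T : M →ₗ[ℂ] M'} (hT : ∀ (x : L) m, T ⁅x, m⁆ = ⁅x, T m⁆) {p : ℕ}
    {α : L [⋀^Fin p]→ₗ[ℝ] M} (hα : α ∈ cocycles ℝ L M p) :
    cochainMap T p α ∈ cocycles ℝ L M' p := by
  have h : ∀ v, differential α v = 0 := fun v => congrArg (fun F : (Fin (p + 1) → L) → M => F v) hα
  refine funext fun v => ?_
  exact (differential_cochainMap hT α v).trans (by rw [h, map_zero]; rfl)

lemma cochainMap_mem_coboundaries {T : M →ₗ[ℂ] M'} (hT : ∀ (x : L) m, T ⁅x, m⁆ = ⁅x, T m⁆) {p : ℕ}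
    {α : L [⋀^Fin p]→ₗ[ℝ] M} (hα : α ∈ coboundaries ℝ L M p) :
    cochainMap T p α ∈ coboundaries ℝ L M' p := by
  cases p with
  | zero =>
    rw [show α = 0 from hα, map_zero]
    exact zero_mem _
  | succ p =>
    obtain ⟨γ, hγ⟩ := hα
    refine ⟨cochainMap T p γ, funext fun v => ?_⟩
    refine (differential_cochainMap hT γ v).trans ?_
    have h : differential γ v = α v := congrArg (fun F : (Fin (p + 1) → L) → M => F v) hγ
    rw [h]
    rfl

omit [ComplexLinearAction L M] [ComplexLinearAction L M'] [LieRingModule L M] [LieRingModule L M'] in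
lemma continuous_cochainMap [TopologicalSpace M] [TopologicalSpace M'] {T : M →ₗ[ℂ] M'}
    (hT : Continuous T) (p : ℕ) : Continuous (cochainMap (L := L) T p) := by
  refine continuous_induced_rng.2 (continuous_pi fun v => ?_)
  exact hT.comp ((continuous_apply v).comp continuous_induced_dom)

end CochainMap

/-! ### Convergence of series of cochains. -/

section Evaluation

variable {A L M : Type*} [CommRing A] [LieRing L] [Module A L] [AddCommGroup M] [Module A M]
  [Module ℂ M] [SMulCommClass A ℂ M]

lemma hasSum_cochain [TopologicalSpace M] [IsTopologicalAddGroup M] {ι : Type*} {p : ℕ}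
    {c : ι → L [⋀^Fin p]→ₗ[A] M} {α : L [⋀^Fin p]→ₗ[A] M}
    (h : ∀ v, HasSum (fun i => c i v) (α v)) : HasSum c α := by
  have hind : Topology.IsInducing (evalₗ A L M p) := ⟨rfl⟩
  refine (hind.hasSum_iff (g := evalₗ A L M p) c α).1 ?_
  exact Pi.hasSum.2 h

end Evaluation

/-! ### Leafwise forms as Lie algebra cochains with values in `C^∞(X)`. -/

section Forms

variable {n : ℕ} {G : Type u} [TopologicalSpace G]
  [ChartedSpace (EuclideanSpace ℝ (Fin n)) G] [Group G] [LieGroup (𝓡 n) ∞ G]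
  (𝔭 : LieSubalgebra ℝ (GroupLieAlgebra (𝓡 n) G)) (Γ : Subgroup G)

/-- The action of `𝔭` on smooth functions by the induced fields. -/
instance : LieRingModule 𝔭 (SmoothFun n Γ) where
  bracket ξ f := ⁅leafwiseField 𝔭 Γ ξ, f⁆
  add_lie ξ η f := by rw [leafwiseField_add, add_lie]
  lie_add ξ f g := lie_add _ f g
  leibniz_lie ξ η f := by rw [leafwiseField_lie]; exact leibniz_lie _ _ _

instance : ComplexLinearAction 𝔭 (SmoothFun n Γ) :=
  ⟨fun ξ c f => ComplexLinearAction.lie_smul' (leafwiseField 𝔭 Γ ξ) c f⟩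

lemma lie_smoothFun (ξ : 𝔭) (f : SmoothFun n Γ) : ⁅ξ, f⁆ = ⁅leafwiseField 𝔭 Γ ξ, f⁆ := rfl

lemma algebraMap_real_smul (c : ℝ) (f : SmoothFun n Γ) :
    algebraMap ℂ (SmoothFun n Γ) c • f = c • f := by
  rw [algebraMap_smul]
  rfl

/-- The values of a leafwise form on the induced fields. -/
def restrictForm (p : ℕ) : LeafwiseForm 𝔭 Γ p →ₗ[ℂ] (𝔭 [⋀^Fin p]→ₗ[ℝ] SmoothFun n Γ) where
  toFun β :=
    { toFun := fun ξ => β (leafwiseField 𝔭 Γ ∘ ξ)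
      map_update_add' := fun {inst} ξ i x y => by
        rw [Subsingleton.elim inst (instDecidableEqFin _)]
        simp only [Function.comp_update, leafwiseField_add, AlternatingMap.map_update_add]
      map_update_smul' := fun {inst} ξ i c x => by
        rw [Subsingleton.elim inst (instDecidableEqFin _)]
        simp only [Function.comp_update, leafwiseField_smul, AlternatingMap.map_update_smul,
          algebraMap_real_smul]
      map_eq_zero_of_eq' := fun ξ i j h hij =>
        β.map_eq_zero_of_eq _ (congrArg (leafwiseField 𝔭 Γ) h) hij }
  map_add' _ _ := rfl
  map_smul' _ _ := rfl

variable {𝔭 Γ}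

lemma restrictForm_apply {p : ℕ} (β : LeafwiseForm 𝔭 Γ p) (ξ : Fin p → 𝔭) :
    restrictForm 𝔭 Γ p β ξ = β (leafwiseField 𝔭 Γ ∘ ξ) := rfl

lemma differential_restrictForm {p : ℕ} (β : LeafwiseForm 𝔭 Γ p) (ξ : Fin (p + 1) → 𝔭) :
    differential (restrictForm 𝔭 Γ p β) ξ = differential β (leafwiseField 𝔭 Γ ∘ ξ) := by
  simp only [differential, restrictForm_apply, lie_smoothFun]
  congr 1
  refine Finset.sum_congr rfl fun j _ => Finset.sum_congr rfl fun i _ => ?_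
  rw [← Function.comp_assoc, Function.comp_update, leafwiseField_lie]
  rfl

lemma restrictForm_mem_cocycles {p : ℕ} {β : LeafwiseForm 𝔭 Γ p}
    (hβ : β ∈ cocycles (SmoothFun n Γ) (leafwiseFields Γ 𝔭) (SmoothFun n Γ) p) :
    restrictForm 𝔭 Γ p β ∈ cocycles ℝ 𝔭 (SmoothFun n Γ) p :=
  funext fun ξ => (differential_restrictForm β ξ).trans
    (congrArg (fun F : (Fin (p + 1) → leafwiseFields Γ 𝔭) → SmoothFun n Γ => F _) hβ)

lemma restrictForm_mem_coboundaries {p : ℕ} {β : LeafwiseForm 𝔭 Γ p}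
    (hβ : β ∈ coboundaries (SmoothFun n Γ) (leafwiseFields Γ 𝔭) (SmoothFun n Γ) p) :
    restrictForm 𝔭 Γ p β ∈ coboundaries ℝ 𝔭 (SmoothFun n Γ) p := by
  cases p with
  | zero =>
    rw [show β = 0 from hβ, map_zero]
    exact zero_mem _
  | succ p =>
    obtain ⟨γ, hγ⟩ := hβ
    exact ⟨restrictForm 𝔭 Γ p γ, funext fun ξ => (differential_restrictForm γ ξ).trans
      (congrArg (fun F : (Fin (p + 1) → leafwiseFields Γ 𝔭) → SmoothFun n Γ => F _) hγ)⟩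

lemma continuous_restrictForm (p : ℕ) : Continuous (restrictForm 𝔭 Γ p) := by
  refine continuous_induced_rng.2 (continuous_pi fun ξ => ?_)
  exact (continuous_apply (leafwiseField 𝔭 Γ ∘ ξ)).comp continuous_induced_dom

/-- The differential of a leafwise form, as a multilinear map. -/
def formDifferential {p : ℕ} (β : LeafwiseForm 𝔭 Γ p) : MultilinearMap (SmoothFun n Γ)
    (fun _ : Fin (p + 1) => leafwiseFields Γ 𝔭) (SmoothFun n Γ) :=
  differentialMultilinear β (D := fun X f => X.1 f)
    (fun X f Y => Subtype.ext (lie_smul_field f X.1 Y.1))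
    (fun X f m => by
      refine (X.1.leibniz f m).trans ?_
      rw [smul_eq_mul (a := m), smul_eq_mul (a := X.1 f), mul_comm m]
      rfl)
    fun f X m => rfl

variable [IsTopologicalGroup G] [T2Space G] [LocallyCompactSpace G] [DiscreteTopology Γ]
  {ι : Type*} [Fintype ι] (b : Module.Basis ι ℝ 𝔭)

lemma fieldsBasis_repr (ξ : 𝔭) (i : ι) : (fieldsBasis Γ b).repr (leafwiseField 𝔭 Γ ξ) i =
    algebraMap ℂ (SmoothFun n Γ) (b.repr ξ i : ℝ) := by
  rw [leafwiseField_eq_sum Γ b ξ]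
  simp only [← fieldsBasis_apply Γ b]
  rw [Module.Basis.repr_sum_self]

include b in
lemma multilinearMap_eq_of_forall_leafwiseField {p : ℕ} {β γ : MultilinearMap (SmoothFun n Γ)
    (fun _ : Fin p => leafwiseFields Γ 𝔭) (SmoothFun n Γ)}
    (h : ∀ ξ : Fin p → 𝔭, β (leafwiseField 𝔭 Γ ∘ ξ) = γ (leafwiseField 𝔭 Γ ∘ ξ)) : β = γ := by
  refine Module.Basis.ext_multilinear (fun _ => fieldsBasis Γ b) fun a => ?_
  have e : (fun i => fieldsBasis Γ b (a i)) = leafwiseField 𝔭 Γ ∘ fun i => b (a i) :=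
    funext fun i => fieldsBasis_apply Γ b (a i)
  rw [e]
  exact h _

/-- The leafwise form with prescribed values on the induced fields, as a multilinear map. -/
def extendMultilinear {p : ℕ} (α : 𝔭 [⋀^Fin p]→ₗ[ℝ] SmoothFun n Γ) : MultilinearMap (SmoothFun n Γ)
    (fun _ : Fin p => leafwiseFields Γ 𝔭) (SmoothFun n Γ) := by
  classical
  exact ∑ a : Fin p → ι, (((MultilinearMap.mkPiAlgebra (SmoothFun n Γ) (Fin p) (SmoothFun n Γ)).compLinearMap
    fun i => (fieldsBasis Γ b).coord (a i)).smulRight (α (b ∘ a)))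

lemma extendMultilinear_apply {p : ℕ} (α : 𝔭 [⋀^Fin p]→ₗ[ℝ] SmoothFun n Γ)
    (v : Fin p → leafwiseFields Γ 𝔭) : extendMultilinear b α v =
      ∑ a : Fin p → ι, (∏ i, (fieldsBasis Γ b).repr (v i) (a i)) * α (b ∘ a) := by
  classical
  simp [extendMultilinear]

/-- The leafwise form with prescribed values on the induced fields. -/
def extendForm (p : ℕ) : (𝔭 [⋀^Fin p]→ₗ[ℝ] SmoothFun n Γ) →ₗ[ℂ] LeafwiseForm 𝔭 Γ p where
  toFun α :=
    { extendMultilinear b α with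
      map_eq_zero_of_eq' := fun v i j h hij => by
        classical
        change extendMultilinear b α v = 0
        rw [extendMultilinear_apply]
        have hv : ∀ k, v (Equiv.swap i j k) = v k := fun k => by
          rcases eq_or_ne k i with rfl | hi
          · rw [Equiv.swap_apply_left, h]
          · rcases eq_or_ne k j with rfl | hj
            · rw [Equiv.swap_apply_right, h]
            · rw [Equiv.swap_apply_of_ne_of_ne hi hj]
        -- The terms of `a` and `a ∘ swap i j` cancel, since the coordinate product is unchanged and
        -- `α` changes sign. If the swap fixes `a`, then `α (b ∘ a) = 0`.
        refine Finset.sum_involution (fun a _ => a ∘ Equiv.swap i j) (fun a _ => ?_)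
          (fun a _ h0 h1 => h0 ?_) (fun a _ => Finset.mem_univ _) fun a _ => ?_
        · have h1 : ∏ k, (fieldsBasis Γ b).repr (v k) ((a ∘ Equiv.swap i j) k) =
              ∏ k, (fieldsBasis Γ b).repr (v k) (a k) := by
            refine Eq.trans (Finset.prod_congr rfl fun k _ => ?_)
              (Equiv.prod_comp (Equiv.swap i j) fun k => (fieldsBasis Γ b).repr (v k) (a k))
            rw [hv]
            rfl
          rw [h1, ← Function.comp_assoc, α.map_swap _ hij, mul_neg, add_neg_cancel]
        · have h2 : b (a i) = b (a j) := by
            have := congrFun h1 j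
            rw [Function.comp_apply, Equiv.swap_apply_right] at this
            rw [this]
          rw [α.map_eq_zero_of_eq (b ∘ a) h2 hij, mul_zero]
        · funext k
          simp }
  map_add' α α' := by
    refine AlternatingMap.ext fun v => ?_
    change extendMultilinear b (α + α') v = extendMultilinear b α v + extendMultilinear b α' v
    simp only [extendMultilinear_apply, AlternatingMap.add_apply, mul_add, Finset.sum_add_distrib]
  map_smul' c α := by
    refine AlternatingMap.ext fun v => ?_
    change extendMultilinear b (c • α) v = c • extendMultilinear b α v
    simp only [extendMultilinear_apply, AlternatingMap.smul_apply, mul_smul_comm, Finset.smul_sum]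

lemma extendForm_apply {p : ℕ} (α : 𝔭 [⋀^Fin p]→ₗ[ℝ] SmoothFun n Γ)
    (v : Fin p → leafwiseFields Γ 𝔭) : extendForm b p α v =
      ∑ a : Fin p → ι, (∏ i, (fieldsBasis Γ b).repr (v i) (a i)) * α (b ∘ a) :=
  extendMultilinear_apply b α v

/-- The coordinates of an induced field are real constants, so on induced fields the defining
formula is the multilinear expansion of `α` in the basis `b`. -/
lemma restrictForm_extendForm {p : ℕ} (α : 𝔭 [⋀^Fin p]→ₗ[ℝ] SmoothFun n Γ) :
    restrictForm 𝔭 Γ p (extendForm b p α) = α := by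
  classical
  refine AlternatingMap.ext fun ξ => ?_
  rw [restrictForm_apply, extendForm_apply]
  have h1 : α ξ = ∑ a : Fin p → ι, α fun i => b.repr (ξ i) (a i) • b (a i) := by
    refine Eq.trans (congrArg α (funext fun i => (b.sum_repr (ξ i)).symm)) ?_
    exact α.toMultilinearMap.map_sum fun i j => b.repr (ξ i) j • b j
  rw [h1]
  refine Finset.sum_congr rfl fun a _ => ?_
  have h2 := α.toMultilinearMap.map_smul_univ (fun i => b.repr (ξ i) (a i)) (b ∘ a)
  refine Eq.trans ?_ h2.symm
  simp only [Function.comp_apply, fieldsBasis_repr]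
  rw [← map_prod, ← Complex.ofReal_prod]
  exact algebraMap_real_smul Γ _ _

lemma differential_extendForm {p : ℕ} (α : 𝔭 [⋀^Fin p]→ₗ[ℝ] SmoothFun n Γ) (ξ : Fin (p + 1) → 𝔭) :
    formDifferential (extendForm b p α) (leafwiseField 𝔭 Γ ∘ ξ) = differential α ξ := by
  conv_rhs => rw [← restrictForm_extendForm b α]
  exact (differential_restrictForm _ ξ).symm

/-- Since the differential of a form is multilinear over `C^∞(X)`, it vanishes once it vanishes on
induced fields, where it is the differential of `α`. -/
lemma extendForm_mem_cocycles {p : ℕ} {α : 𝔭 [⋀^Fin p]→ₗ[ℝ] SmoothFun n Γ}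
    (hα : α ∈ cocycles ℝ 𝔭 (SmoothFun n Γ) p) : extendForm b p α ∈
      cocycles (SmoothFun n Γ) (leafwiseFields Γ 𝔭) (SmoothFun n Γ) p := by
  have h : formDifferential (extendForm b p α) = 0 :=
    multilinearMap_eq_of_forall_leafwiseField b fun ξ => (differential_extendForm b α ξ).trans
      (congrArg (fun F : (Fin (p + 1) → 𝔭) → SmoothFun n Γ => F ξ) hα)
  exact funext fun v => congrArg (fun F : MultilinearMap (SmoothFun n Γ)
    (fun _ : Fin (p + 1) => leafwiseFields Γ 𝔭) (SmoothFun n Γ) => F v) h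

lemma extendForm_mem_coboundaries {p : ℕ} {α : 𝔭 [⋀^Fin p]→ₗ[ℝ] SmoothFun n Γ}
    (hα : α ∈ coboundaries ℝ 𝔭 (SmoothFun n Γ) p) : extendForm b p α ∈
      coboundaries (SmoothFun n Γ) (leafwiseFields Γ 𝔭) (SmoothFun n Γ) p := by
  cases p with
  | zero =>
    rw [show α = 0 from hα, map_zero]
    exact zero_mem _
  | succ p =>
    obtain ⟨γ, hγ⟩ := hα
    have h : formDifferential (extendForm b p γ) = (extendForm b (p + 1) α).toMultilinearMap :=
      multilinearMap_eq_of_forall_leafwiseField b fun ξ => by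
        refine (differential_extendForm b γ ξ).trans ?_
        refine (congrArg (fun F : (Fin (p + 1) → 𝔭) → SmoothFun n Γ => F ξ) hγ).trans ?_
        exact congrArg (fun F : 𝔭 [⋀^Fin (p + 1)]→ₗ[ℝ] SmoothFun n Γ => F ξ)
          (restrictForm_extendForm b α).symm
    exact ⟨extendForm b p γ, funext fun v => congrArg (fun F : MultilinearMap (SmoothFun n Γ)
      (fun _ : Fin (p + 1) => leafwiseFields Γ 𝔭) (SmoothFun n Γ) => F v) h⟩

lemma extendForm_restrictForm {p : ℕ} (β : LeafwiseForm 𝔭 Γ p) :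
    extendForm b p (restrictForm 𝔭 Γ p β) = β := by
  refine AlternatingMap.coe_multilinearMap_injective
    (multilinearMap_eq_of_forall_leafwiseField b fun ξ => ?_)
  exact congrArg (fun F : 𝔭 [⋀^Fin p]→ₗ[ℝ] SmoothFun n Γ => F ξ)
    (restrictForm_extendForm b (restrictForm 𝔭 Γ p β))

lemma continuous_extendForm [CompactSpace (LeftQuotient Γ)] [T2Space (LeftQuotient Γ)] (p : ℕ) :
    Continuous (extendForm (Γ := Γ) b p) := by
  refine continuous_induced_rng.2 (continuous_pi fun v => ?_)
  change Continuous fun α => extendForm b p α v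
  simp only [extendForm_apply]
  refine continuous_finsetSum _ fun a _ => ?_
  exact (SmoothFun.continuous_const_mul _).comp ((continuous_apply (b ∘ a)).comp continuous_induced_dom)

end Forms

/-! ### Composites of maps on reduced cohomology. -/

section ReducedComposition

variable {C C' : Type*} [AddCommGroup C] [Module ℂ C] [TopologicalSpace C] [IsTopologicalAddGroup C]
  [ContinuousSMul ℂ C] [AddCommGroup C'] [Module ℂ C'] [TopologicalSpace C']
  [IsTopologicalAddGroup C'] [ContinuousSMul ℂ C'] {C'' : Type*} [AddCommGroup C''] [Module ℂ C'']
  [TopologicalSpace C''] [IsTopologicalAddGroup C''] [ContinuousSMul ℂ C'']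
  {Z B : Submodule ℂ C} {Z' B' : Submodule ℂ C'} {Z'' B'' : Submodule ℂ C''}
  {T : C →L[ℂ] C'}

lemma reducedMap_leftInverse {S : C' →L[ℂ] C} (hST : ∀ z, S (T z) = z)
    {hZ : ∀ z ∈ Z, T z ∈ Z'} {hB : ∀ z ∈ B, T z ∈ B'} {hZ' : ∀ z ∈ Z', S z ∈ Z}
    {hB' : ∀ z ∈ B', S z ∈ B} (x : Z ⧸ B.topologicalClosure.submoduleOf Z) :
    reducedMap S hZ' hB' (reducedMap T hZ hB x) = x := by
  obtain ⟨z, rfl⟩ := Submodule.mkQ_surjective _ x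
  rw [reducedMap_mk, reducedMap_mk]
  exact congrArg _ (Subtype.ext (hST z.1))

lemma reducedMap_reducedMap_eq_zero {S : C' →L[ℂ] C''} (hST : ∀ z, S (T z) = 0)
    {hZ : ∀ z ∈ Z, T z ∈ Z'} {hB : ∀ z ∈ B, T z ∈ B'} {hZ' : ∀ z ∈ Z', S z ∈ Z''}
    {hB' : ∀ z ∈ B', S z ∈ B''} (x : Z ⧸ B.topologicalClosure.submoduleOf Z) :
    reducedMap S hZ' hB' (reducedMap T hZ hB x) = 0 := by
  obtain ⟨z, rfl⟩ := Submodule.mkQ_surjective _ x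
  rw [reducedMap_mk, reducedMap_mk]
  exact (congrArg _ (Subtype.ext (hST z.1))).trans (map_zero _)

end ReducedComposition

/-! ### Injectivity and density on algebraic direct sums. -/

section DirectSums

open scoped DirectSum

variable {ι : Type*} [DecidableEq ι] {H : ι → Type*} [∀ i, AddCommMonoid (H i)]
  [∀ i, Module ℂ (H i)] [∀ i, TopologicalSpace (H i)]
  {K : Type*} [AddCommMonoid K] [Module ℂ K] [TopologicalSpace K] {κ : ∀ i, H i →L[ℂ] K}

/-- The map `s j` recovers the `j`-th component of `x` from its image, because the contributions of
all other summands vanish. -/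
lemma toModule_injective_of_leftInverse {s : ∀ i, K →L[ℂ] H i} (h : ∀ i x, s i (κ i x) = x)
    (h0 : ∀ i j, i ≠ j → ∀ x, s j (κ i x) = 0) :
    Function.Injective (DirectSum.toModule ℂ ι K fun i => (κ i : H i →ₗ[ℂ] K)) := by
  have key : ∀ j (x : ⨁ i, H i),
      s j (DirectSum.toModule ℂ ι K (fun i => (κ i : H i →ₗ[ℂ] K)) x) = x j := fun j x => by
    induction x using DirectSum.induction_on with
    | zero => simp
    | of i x =>
      rw [← DirectSum.lof_eq_of ℂ, DirectSum.toModule_lof, ContinuousLinearMap.coe_coe]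
      rcases eq_or_ne i j with rfl | hne
      · rw [h, DirectSum.lof_apply]
      · rw [h0 i j hne, DirectSum.lof_eq_of, DirectSum.of_eq_of_ne _ _ _ hne.symm]
    | add x y hx hy => rw [map_add, map_add, hx, hy, DirectSum.add_apply]
  intro x y hxy
  refine DFinsupp.ext fun j => ?_
  rw [← key, ← key, hxy]

lemma toModule_denseRange_of_hasSum
    (h : ∀ y : K, ∃ c : ∀ i, H i, HasSum (fun i => κ i (c i)) y) :
    DenseRange (DirectSum.toModule ℂ ι K fun i => (κ i : H i →ₗ[ℂ] K)) := fun y => by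
  obtain ⟨c, hc⟩ := h y
  refine mem_closure_of_tendsto hc (Filter.Eventually.of_forall fun s => ?_)
  exact ⟨∑ i ∈ s, DirectSum.lof ℂ ι H i (c i), by
    simp only [map_sum, DirectSum.toModule_lof, ContinuousLinearMap.coe_coe]⟩

end DirectSums

/-! ### The natural maps and their left inverses. -/

section NaturalMaps

variable {n : ℕ} {G : Type u} [TopologicalSpace G]
  [ChartedSpace (EuclideanSpace ℝ (Fin n)) G] [Group G] [LieGroup (𝓡 n) ∞ G]
  [IsTopologicalGroup G] [T2Space G] [LocallyCompactSpace G] [SecondCountableTopology G]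
  {Γ : Subgroup G} [DiscreteTopology Γ] [CompactSpace (LeftQuotient Γ)]
  [T2Space (LeftQuotient Γ)] [SecondCountableTopology (LeftQuotient Γ)]
  (μ : Measure (LeftQuotient Γ)) [IsProbabilityMeasure μ] [IsRightInvariant μ]
  {𝔭 : LieSubalgebra ℝ (GroupLieAlgebra (𝓡 n) G)} {ι : Type*} [Fintype ι]
  (b : Module.Basis ι ℝ 𝔭) (π : UnitaryDual G) (p : ℕ)

lemma isotypicToFun_lie (ξ : 𝔭) (v : SmoothVectors n μ π) :
    isotypicToFun μ π ⁅ξ, v⁆ = ⁅ξ, isotypicToFun μ π v⁆ :=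
  isotypicToFun_deriv μ π (ξ : GroupLieAlgebra (𝓡 n) G) v

lemma isotypicOfFun_lie (ξ : 𝔭) (f : SmoothFun n Γ) :
    isotypicOfFun μ π ⁅ξ, f⁆ = ⁅ξ, isotypicOfFun μ π f⁆ :=
  isotypicOfFun_deriv μ π (ξ : GroupLieAlgebra (𝓡 n) G) f

/-- The leafwise form corresponding to a cochain with values in `H(π)^∞`. -/
def formOfCochain : (𝔭 [⋀^Fin p]→ₗ[ℝ] SmoothVectors n μ π) →L[ℂ] LeafwiseForm 𝔭 Γ p where
  toLinearMap := extendForm b p ∘ₗ cochainMap (isotypicToFun μ π) p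
  cont := (continuous_extendForm b p).comp (continuous_cochainMap (continuous_isotypicToFun μ π) p)

/-- The component in `H(π)^∞` of a leafwise form. -/
def cochainOfForm : LeafwiseForm 𝔭 Γ p →L[ℂ] (𝔭 [⋀^Fin p]→ₗ[ℝ] SmoothVectors n μ π) where
  toLinearMap := cochainMap (isotypicOfFun μ π) p ∘ₗ restrictForm 𝔭 Γ p
  cont := (continuous_cochainMap (continuous_isotypicOfFun μ π) p).comp (continuous_restrictForm p)

lemma formOfCochain_apply (α : 𝔭 [⋀^Fin p]→ₗ[ℝ] SmoothVectors n μ π) :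
    formOfCochain μ b π p α = extendForm b p (cochainMap (isotypicToFun μ π) p α) := rfl

lemma cochainOfForm_apply (β : LeafwiseForm 𝔭 Γ p) :
    cochainOfForm μ π p β = cochainMap (isotypicOfFun μ π) p (restrictForm 𝔭 Γ p β) := rfl

lemma cochainOfForm_formOfCochain (α : 𝔭 [⋀^Fin p]→ₗ[ℝ] SmoothVectors n μ π) :
    cochainOfForm μ π p (formOfCochain μ b π p α) = α := by
  rw [formOfCochain_apply, cochainOfForm_apply, restrictForm_extendForm]
  exact AlternatingMap.ext fun ξ => isotypicOfFun_toFun μ π (α ξ)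

lemma cochainOfForm_formOfCochain_of_ne {σ : UnitaryDual G} (h : π ≠ σ)
    (α : 𝔭 [⋀^Fin p]→ₗ[ℝ] SmoothVectors n μ π) :
    cochainOfForm μ σ p (formOfCochain μ b π p α) = 0 := by
  rw [formOfCochain_apply, cochainOfForm_apply, restrictForm_extendForm]
  exact AlternatingMap.ext fun ξ => isotypicOfFun_toFun_of_ne μ h (α ξ)

lemma hasSum_formOfCochain (β : LeafwiseForm 𝔭 Γ p) :
    HasSum (fun π : UnitaryDual G => formOfCochain μ b π p (cochainOfForm μ π p β)) β := by
  have h : HasSum (fun π : UnitaryDual G => cochainMap (isotypicToFun μ π) p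
      (cochainMap (isotypicOfFun μ π) p (restrictForm 𝔭 Γ p β))) (restrictForm 𝔭 Γ p β) :=
    hasSum_cochain fun ξ => hasSum_isotypicToFun μ (restrictForm 𝔭 Γ p β ξ)
  have h1 := h.map (extendForm (Γ := Γ) b p) (continuous_extendForm b p)
  rw [extendForm_restrictForm] at h1
  exact h1

/-- The natural map on reduced cohomology. -/
def naturalMap : IsotypicReducedCohomology 𝔭 μ π p →L[ℂ] LeafwiseReducedCohomology 𝔭 Γ p :=
  reducedMap (formOfCochain μ b π p)
    (fun _ h => extendForm_mem_cocycles b (cochainMap_mem_cocycles (isotypicToFun_lie μ π) h))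
    fun _ h => extendForm_mem_coboundaries b (cochainMap_mem_coboundaries (isotypicToFun_lie μ π) h)

/-- The map on reduced cohomology given by the projection to an isotypic component. -/
def isotypicComponent :
    LeafwiseReducedCohomology 𝔭 Γ p →L[ℂ] IsotypicReducedCohomology 𝔭 μ π p :=
  reducedMap (cochainOfForm μ π p)
    (fun _ h => cochainMap_mem_cocycles (isotypicOfFun_lie μ π) (restrictForm_mem_cocycles h))
    fun _ h => cochainMap_mem_coboundaries (isotypicOfFun_lie μ π) (restrictForm_mem_coboundaries h)

lemma isotypicComponent_naturalMap (x : IsotypicReducedCohomology 𝔭 μ π p) :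
    isotypicComponent μ π p (naturalMap μ b π p x) = x :=
  reducedMap_leftInverse (cochainOfForm_formOfCochain μ b π p) x

lemma isotypicComponent_naturalMap_of_ne {σ : UnitaryDual G} (h : π ≠ σ)
    (x : IsotypicReducedCohomology 𝔭 μ π p) :
    isotypicComponent μ σ p (naturalMap μ b π p x) = 0 :=
  reducedMap_reducedMap_eq_zero (cochainOfForm_formOfCochain_of_ne μ b π p h) x

/-- A closed form is the sum of its isotypic components, each of them closed, and the class map is
continuous. -/
lemma hasSum_naturalMap (h : LeafwiseReducedCohomology 𝔭 Γ p) :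
    HasSum (fun π : UnitaryDual G => naturalMap μ b π p (isotypicComponent μ π p h)) h := by
  obtain ⟨β, rfl⟩ := Submodule.mkQ_surjective _ h
  exact hasSum_mkQ (c := fun π : UnitaryDual G => ⟨formOfCochain μ b π p (cochainOfForm μ π p β.1),
    extendForm_mem_cocycles b (cochainMap_mem_cocycles (isotypicToFun_lie μ π)
      (cochainMap_mem_cocycles (isotypicOfFun_lie μ π) (restrictForm_mem_cocycles β.2)))⟩)
    (hasSum_formOfCochain μ b p β.1)

lemma corresponds_formOfCochain (α : 𝔭 [⋀^Fin p]→ₗ[ℝ] SmoothVectors n μ π) :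
    Corresponds 𝔭 μ α (formOfCochain μ b π p α) := fun ξ => by
  have h : formOfCochain μ b π p α (fun i => leafwiseField 𝔭 Γ (ξ i)) = isotypicToFun μ π (α ξ) :=
    congrArg (fun F : 𝔭 [⋀^Fin p]→ₗ[ℝ] SmoothFun n Γ => F ξ)
      (restrictForm_extendForm b (cochainMap (isotypicToFun μ π) p α))
  rw [h]
  exact isotypicToFun_ae_eq μ π (α ξ)

-- The measure has full support, so smooth functions that agree almost everywhere are equal, and a
-- form is determined by its values on induced fields.
include b in
lemma Corresponds.unique {α : 𝔭 [⋀^Fin p]→ₗ[ℝ] SmoothVectors n μ π} {β γ : LeafwiseForm 𝔭 Γ p}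
    (hβ : Corresponds 𝔭 μ α β) (hγ : Corresponds 𝔭 μ α γ) : β = γ := by
  refine AlternatingMap.coe_multilinearMap_injective
    (multilinearMap_eq_of_forall_leafwiseField b fun ξ => ?_)
  exact SmoothFun.eq_of_ae_eq μ ((hβ ξ).trans (hγ ξ).symm)

lemma isNaturalMap_naturalMap : IsNaturalMap 𝔭 μ (naturalMap μ b π p) := fun α => by
  have hc := extendForm_mem_cocycles b (cochainMap_mem_cocycles (isotypicToFun_lie μ π) α.2)
  refine ⟨⟨⟨formOfCochain μ b π p α.1, hc⟩, corresponds_formOfCochain μ b π p α.1⟩, fun β hβ => ?_⟩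
  have h : β = ⟨formOfCochain μ b π p α.1, hc⟩ :=
    Subtype.ext (hβ.unique μ b π p (corresponds_formOfCochain μ b π p α.1))
  rw [h]
  rfl

/-- The range is the fixed set of the continuous idempotent `naturalMap ∘ isotypicComponent`; the
target is Hausdorff, since the coboundaries were closed up before dividing. -/
lemma isClosed_range_naturalMap : IsClosed (Set.range (naturalMap (p := p) μ b π)) := by
  have h : Set.range (naturalMap (p := p) μ b π) =
      {y | naturalMap μ b π p (isotypicComponent μ π p y) = y} := by
    ext y
    constructor
    · rintro ⟨x, rfl⟩
      exact congrArg _ (isotypicComponent_naturalMap μ b π p x)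
    · exact fun hy => ⟨_, hy⟩
  rw [h]
  exact isClosed_eq ((naturalMap μ b π p).continuous.comp (isotypicComponent μ π p).continuous)
    continuous_id

variable {p} in
lemma directSumMap_injective_of_leftInverse
    {κ : ∀ π : UnitaryDual G, IsotypicReducedCohomology 𝔭 μ π p →L[ℂ] LeafwiseReducedCohomology 𝔭 Γ p}
    {s : ∀ π : UnitaryDual G, LeafwiseReducedCohomology 𝔭 Γ p →L[ℂ] IsotypicReducedCohomology 𝔭 μ π p}
    (h : ∀ π x, s π (κ π x) = x) (h0 : ∀ π σ, π ≠ σ → ∀ x, s σ (κ π x) = 0) :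
    Function.Injective (directSumMap 𝔭 μ κ) := by
  classical
  exact toModule_injective_of_leftInverse (s := s) h h0

variable {p} in
lemma directSumMap_denseRange_of_hasSum
    {κ : ∀ π : UnitaryDual G, IsotypicReducedCohomology 𝔭 μ π p →L[ℂ] LeafwiseReducedCohomology 𝔭 Γ p}
    (h : ∀ y, ∃ c : ∀ π, IsotypicReducedCohomology 𝔭 μ π p, HasSum (fun π => κ π (c π)) y) :
    DenseRange (directSumMap 𝔭 μ κ) := by
  classical
  exact toModule_denseRange_of_hasSum h

lemma directSumMap_injective :
    Function.Injective (directSumMap 𝔭 μ fun π => naturalMap μ b π p) :=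
  directSumMap_injective_of_leftInverse μ (s := fun π => isotypicComponent μ π p)
    (fun π => isotypicComponent_naturalMap μ b π p)
    fun π _ hne => isotypicComponent_naturalMap_of_ne μ b π p hne

lemma directSumMap_denseRange :
    DenseRange (directSumMap 𝔭 μ fun π => naturalMap μ b π p) :=
  directSumMap_denseRange_of_hasSum μ fun y =>
    ⟨fun π => isotypicComponent μ π p y, hasSum_naturalMap μ b p y⟩

end NaturalMaps

end LatticeQuotient

end

/-! ### The theorem. -/

open LatticeQuotient in
theorem lemma2p1 {n : ℕ} {G : Type*} [TopologicalSpace G]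
    [ChartedSpace (EuclideanSpace ℝ (Fin n)) G] [Group G] [LieGroup (𝓡 n) ∞ G]
    [T2Space G] [SecondCountableTopology G] [ConnectedSpace G]
    (Γ : Subgroup G) [DiscreteTopology Γ] [CompactSpace (LeftQuotient Γ)]
    (μ : Measure (LeftQuotient Γ)) [IsProbabilityMeasure μ] [IsRightInvariant μ]
    (𝔭 : LieSubalgebra ℝ (GroupLieAlgebra (𝓡 n) G)) (p : ℕ) :
    ∃ κ : ∀ π : UnitaryDual G,
        IsotypicReducedCohomology 𝔭 μ π p →L[ℂ] LeafwiseReducedCohomology 𝔭 Γ p,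
      (∀ π, IsNaturalMap 𝔭 μ (κ π)) ∧
      (∀ π, ∃ s : LeafwiseReducedCohomology 𝔭 Γ p →L[ℂ] IsotypicReducedCohomology 𝔭 μ π p,
        s ∘L κ π = ContinuousLinearMap.id ℂ _) ∧
      (∀ π, IsClosed (Set.range (κ π))) ∧
      Function.Injective (directSumMap 𝔭 μ κ) ∧
      DenseRange (directSumMap 𝔭 μ κ) ∧
      ∀ h : LeafwiseReducedCohomology 𝔭 Γ p,
        ∃ c : ∀ π : UnitaryDual G, IsotypicReducedCohomology 𝔭 μ π p,
          HasSum (fun π => κ π (c π)) h := by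
  have := topologicalGroup_of_lieGroup (𝓡 n) ∞ (G := G)
  have : LocallyCompactSpace G := Manifold.locallyCompact_of_finiteDimensional (𝓡 n)
  have : T2Space (LeftQuotient Γ) := t2Space_leftQuotient
  have : SecondCountableTopology (LeftQuotient Γ) := secondCountable_leftQuotient
  have : FiniteDimensional ℝ (GroupLieAlgebra (𝓡 n) G) :=
    inferInstanceAs (FiniteDimensional ℝ (EuclideanSpace ℝ (Fin n)))
  -- Any basis will do: by `Corresponds.unique` the form attached to a cochain does not depend on
  -- it.
  let b := Module.finBasis ℝ 𝔭
  exact ⟨fun π => naturalMap μ b π p, fun π => isNaturalMap_naturalMap μ b π p,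
    fun π => ⟨isotypicComponent μ π p,
      ContinuousLinearMap.ext (isotypicComponent_naturalMap μ b π p)⟩,
    fun π => isClosed_range_naturalMap μ b π p, directSumMap_injective μ b p,
    directSumMap_denseRange μ b p, fun h => ⟨_, hasSum_naturalMap μ b p h⟩⟩
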